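/- **Conventions.** A *hypergraph* $\Sigma$ consists of a set $W(\Sigma)$ of wires and, for all $k,\ell\in\mathbb N$, a set $B_{k,\ell}(\Sigma)$ of boxes, each with an ordered list of $k$ input wires and an ordered list of $\ell$ output wires; a hypergraph morphism maps wires to wires and $(k,\ell)$-boxes to $(k,\ell)$-boxes, preserving input and output lists. A *gs-monoidal category* is a symmetric monoidal category in which every object carries a commutative comonoid structure $(\mathsf{copy}_X,\mathsf{del}_X)$, multiplicative with respect to $\otimes$ and $I$; it is *strict* if its underlying monoidal category is strict. A *strict gs-monoidal functor* strictly preserves $I$, $\otimes$, the symmetry, and all $\mathsf{copy}_X$, $\mathsf{del}_X$. For a strict gs-monoidal category $\mathsf C$, its underlying hypergraph $\mathrm{hyp}(\mathsf C)$ has the objects of $\mathsf C$ as wires, and a $(k,\ell)$-box consists of objects $A_1,\dots,A_k,B_1,\dots,B_\ell$ together with a morphism $A_1\otimes\cdots\otimes A_k\to B_1\otimes\cdots\otimes B_\ell$; strict gs-monoidal functors $F$ induce hypergraph morphisms $\mathrm{hyp}(F)$. Let $\Sigma$ be a hypergraph. The strict gs-monoidal category $\mathsf{FreeGS}_\Sigma$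 has as objects the words over $W(\Sigma)$ (equivalently, pairs $(m,\sigma)$ of $m\in\mathbb N$ and a labeling $\sigma:\underline m\to\Sigma$ of the discrete hypergraph with $m$ wires). Morphisms are isomorphism classes of cospans $\underline m\xrightarrow{p}G\xleftarrow{q}\underline n$ of hypergraphs over $\Sigma$ where $G$ has finitely many wires and boxes, $G$ is acyclic (there is no closed directed path through at least one box), and left monogamy holds: for every wire $w$ of $G$, $|p^{-1}(w)|+\sum_{b}\mathsf{out}(b,w)=1$, where $\mathsf{out}(b,w)$ is the number of times $w$ occurs as an output of the box $b$. Composition is by pushout, the tensor product is concatenation of words and disjoint union of cospans, the symmetries are the block permutations, and $\mathsf{copy}$ and $\mathsf{del}$ on $\underline n$ are the cospans $\underline n\xrightarrow{\mathrm{id}}\underline n\xleftarrow{\langle\mathrm{id},\mathrm{id}\rangle}\underline{n+n}$ and $\underline n\xrightarrow{\mathrm{id}}\underline n\leftarrow\underline 0$. The canonical hypergraph morphism $\eta:\Sigma\to\mathrm{hyp}(\mathsf{FreeGS}_\Sigma)$ sends a wire to the corresponding one-letter word and a box to the string diagram consisting of just that box. **Corollary.** Let $\mathsf C$ be a strict gs-monoidal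 category whose monoid of objects is the free monoid with generating set $W(\Sigma)$. Then restriction along $\eta$, i.e. $F\mapsto\mathrm{hyp}(F)\circ\eta$, is a bijection from the set of strict gs-monoidal functors $\mathsf{FreeGS}_\Sigma\to\mathsf C$ to the set of hypergraph morphisms $\Sigma\to\mathrm{hyp}(\mathsf C)$. This bijection restricts to a bijection from the strict gs-monoidal functors $\mathsf{FreeGS}_\Sigma\to\mathsf C$ that are the identity on objects to the hypergraph morphisms $\Sigma\to\mathrm{hyp}(\mathsf C)$ that are the identity on wires (that is, send each wire $w$ to the generator $w$ of the monoid of objects of $\mathsf C$). -/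

import Mathlib

universe u v u₁ v₁ u₂ v₂ u₃ v₃

namespace GSMon

open CategoryTheory MonoidalCategory

/-! ## Directed hypergraphs -/

/-- A (directed) hypergraph: a set of wires and, for all `k` and `l`, a set of boxes with an
ordered list of `k` input wires and an ordered list of `l` output wires. -/
structure Hyp : Type (max (u + 1) (v + 1)) where
  W : Type u
  B : ℕ → ℕ → Type v
  inp : ∀ {k l : ℕ}, B k l → Fin k → W
  out : ∀ {k l : ℕ}, B k l → Fin l → W

namespace Hyp

/-- The set of all boxes, of arbitrary arity and coarity. -/
def Box (G : Hyp.{u, v}) : Type v := Σ k l : ℕ, G.B k l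

/-- The number of times that `w` occurs as an input of `b`. -/
noncomputable def inDeg (G : Hyp.{u, v}) (b : G.Box) (w : G.W) : ℕ :=
  Nat.card {i : Fin b.1 // G.inp b.2.2 i = w}

/-- The number of times that `w` occurs as an output of `b`. -/
noncomputable def outDeg (G : Hyp.{u, v}) (b : G.Box) (w : G.W) : ℕ :=
  Nat.card {j : Fin b.2.1 // G.out b.2.2 j = w}

/-- Hypergraph morphisms. -/
@[ext]
structure Hom (G : Hyp.{u, v}) (H : Hyp.{u₁, v₁}) where
  wire : G.W → H.W
  box : ∀ {k l : ℕ}, G.B k l → H.B k l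
  inp_box : ∀ {k l : ℕ} (b : G.B k l) (i : Fin k), H.inp (box b) i = wire (G.inp b i)
  out_box : ∀ {k l : ℕ} (b : G.B k l) (j : Fin l), H.out (box b) j = wire (G.out b j)

/-- The identity morphism. -/
def Hom.id (G : Hyp.{u, v}) : G.Hom G := ⟨fun w => w, fun b => b, fun _ _ => rfl, fun _ _ => rfl⟩

/-- The composite "first `f`, then `g`". -/
def Hom.comp {G : Hyp.{u, v}} {H : Hyp.{u₁, v₁}} {K : Hyp.{u₂, v₂}} (f : G.Hom H) (g : H.Hom K) :
    G.Hom K where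
  wire w := g.wire (f.wire w)
  box b := g.box (f.box b)
  inp_box b i := by rw [g.inp_box, f.inp_box]
  out_box b i := by rw [g.out_box, f.out_box]

theorem Hom.box_congr {G : Hyp.{u, v}} {H : Hyp.{u₁, v₁}} {f g : G.Hom H} (h : f = g) {k l : ℕ}
    (b : G.B k l) : f.box b = g.box b := by
  rw [h]

/-- Isomorphisms: all components are bijective. -/
structure Hom.IsIso {G : Hyp.{u, v}} {H : Hyp.{u₁, v₁}} (f : G.Hom H) : Prop where
  wire : Function.Bijective f.wire
  box : ∀ k l : ℕ, Function.Bijective (f.box : G.B k l → H.B k l)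

/-- A hypergraph is finite if it has finitely many wires and finitely many boxes in total. -/
structure IsFinite (G : Hyp.{u, v}) : Prop where
  wires : Finite G.W
  boxes : Finite G.Box

/-- `w` is an input wire and `w'` is an output wire of a common box. -/
def Step (G : Hyp.{u, v}) (w w' : G.W) : Prop :=
  ∃ b : G.Box, 1 ≤ G.inDeg b w ∧ 1 ≤ G.outDeg b w'

/-- There is no cycle `w₁, b₁, …, wₙ, bₙ, w₁` with `n ≥ 1` in which every `bᵢ` has `wᵢ` as an
input and the next wire as an output. -/
def Acyclic (G : Hyp.{u, v}) : Prop := ∀ w : G.W, ¬ Relation.TransGen G.Step w w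

theorem step_iff {G : Hyp.{u, v}} {w w' : G.W} :
    G.Step w w' ↔ ∃ (k l : ℕ) (b : G.B k l) (i : Fin k) (j : Fin l),
      G.inp b i = w ∧ G.out b j = w' := by
  have key : ∀ (n : ℕ) (f : Fin n → G.W) (x : G.W),
      1 ≤ Nat.card {i : Fin n // f i = x} ↔ ∃ i, f i = x := by
    intro n f x
    rw [Nat.one_le_iff_ne_zero, Nat.card_ne_zero]
    constructor
    · rintro ⟨⟨i, h⟩, -⟩
      exact ⟨i, h⟩
    · rintro ⟨i, h⟩
      exact ⟨⟨i, h⟩, inferInstance⟩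
  constructor
  · rintro ⟨⟨k, l, b⟩, h1, h2⟩
    obtain ⟨i, hi⟩ := (key _ _ _).1 h1
    obtain ⟨j, hj⟩ := (key _ _ _).1 h2
    exact ⟨k, l, b, i, j, hi, hj⟩
  · rintro ⟨k, l, b, i, j, hi, hj⟩
    exact ⟨⟨k, l, b⟩, (key _ _ _).2 ⟨i, hi⟩, (key _ _ _).2 ⟨j, hj⟩⟩

/-- Left monogamy of a cospan with apex `G` whose left leg, a map from a finite ordinal to the
wires of `G`, is given by the list `p` of its values: every wire is hit exactly once by `p` and
by the box outputs together. (The sum is over the boxes of a finite hypergraph.) -/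
def LeftMonogamous (G : Hyp.{u, v}) (p : List G.W) : Prop :=
  ∀ w : G.W, Nat.card {i : Fin p.length // p.get i = w} + ∑ᶠ b : G.Box, G.outDeg b w = 1

/-- An unfolded form of left monogamy. -/
structure LeftMono (G : Hyp.{u, v}) (p : List G.W) : Prop where
  cover : ∀ w, w ∈ p ∨ ∃ (k l : ℕ) (b : G.B k l) (j : Fin l), G.out b j = w
  nodup : p.Nodup
  disj : ∀ {k l : ℕ} (b : G.B k l) (j : Fin l), G.out b j ∉ p
  inj : ∀ {k l : ℕ} (b : G.B k l) (j : Fin l) {k' l' : ℕ} (b' : G.B k' l') (j' : Fin l'),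
    G.out b j = G.out b' j' →
      (⟨⟨k, l, b⟩, j⟩ : Σ x : G.Box, Fin x.2.1) = ⟨⟨k', l', b'⟩, j'⟩

theorem leftMonogamous_iff {G : Hyp.{u, v}} (hG : Finite G.Box) (p : List G.W) :
    G.LeftMonogamous p ↔ G.LeftMono p := by
  classical
  let T : Type v := Σ x : G.Box, Fin x.2.1
  let f : Fin p.length ⊕ T → G.W := Sum.elim p.get (fun x => G.out x.1.2.2 x.2)
  have hcard : ∀ w, Nat.card {i : Fin p.length // p.get i = w} + ∑ᶠ b : G.Box, G.outDeg b w
      = Nat.card {x // f x = w} := by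
    intro w
    have := Fintype.ofFinite G.Box
    have e : {x // f x = w} ≃ {i : Fin p.length // p.get i = w} ⊕
        (Σ b : G.Box, {j : Fin b.2.1 // G.out b.2.2 j = w}) :=
      { toFun := fun x => match x with
          | ⟨Sum.inl i, h⟩ => Sum.inl ⟨i, h⟩
          | ⟨Sum.inr ⟨b, j⟩, h⟩ => Sum.inr ⟨b, j, h⟩
        invFun := fun x => match x with
          | Sum.inl ⟨i, h⟩ => ⟨Sum.inl i, h⟩
          | Sum.inr ⟨b, j, h⟩ => ⟨Sum.inr ⟨b, j⟩, h⟩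
        left_inv := by rintro ⟨_ | ⟨_, _⟩, _⟩ <;> rfl
        right_inv := by rintro (⟨_, _⟩ | ⟨_, _, _⟩) <;> rfl }
    rw [Nat.card_congr e, Nat.card_sum, Nat.card_sigma, finsum_eq_sum_of_fintype]
    rfl
  have hbij : G.LeftMonogamous p ↔ Function.Bijective f := by
    rw [Function.bijective_iff_existsUnique]
    refine forall_congr' fun w => ?_
    rw [hcard w, Nat.card_eq_one_iff_exists]
    constructor
    · rintro ⟨⟨x, hx⟩, h⟩
      exact ⟨x, hx, fun y hy => congrArg Subtype.val (h ⟨y, hy⟩)⟩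
    · rintro ⟨x, hx, h⟩
      exact ⟨⟨x, hx⟩, fun y => Subtype.ext (h y.1 y.2)⟩
  rw [hbij]
  constructor
  · rintro ⟨hi, hs⟩
    refine ⟨fun w => ?_, ?_, fun {k l} b j h => ?_, fun {k l} b j {k' l'} b' j' h => ?_⟩
    · obtain ⟨i | ⟨⟨k, l, b⟩, j⟩, h⟩ := hs w
      · exact Or.inl (h ▸ List.get_mem p i)
      · exact Or.inr ⟨k, l, b, j, h⟩
    · rw [List.nodup_iff_injective_get]
      exact fun i j h => Sum.inl_injective (hi (a₁ := Sum.inl i) (a₂ := Sum.inl j) h)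
    · obtain ⟨i, hp⟩ := List.get_of_mem h
      exact Sum.inl_ne_inr (hi (a₁ := Sum.inl i) (a₂ := Sum.inr ⟨⟨k, l, b⟩, j⟩) hp)
    · exact Sum.inr_injective
        (hi (a₁ := Sum.inr ⟨⟨k, l, b⟩, j⟩) (a₂ := Sum.inr ⟨⟨k', l', b'⟩, j'⟩) h)
  · intro h
    constructor
    · rintro (i | ⟨⟨k, l, b⟩, j⟩) (i' | ⟨⟨k', l', b'⟩, j'⟩) hf
      · exact congrArg Sum.inl (List.nodup_iff_injective_get.1 h.nodup hf)
      · exact absurd ((show p.get i = G.out b' j' from hf) ▸ List.get_mem p i) (h.disj b' j')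
      · exact absurd ((show G.out b j = p.get i' from hf) ▸ List.get_mem p i') (h.disj b j)
      · exact congrArg Sum.inr (h.inj b j b' j' hf)
    · intro w
      rcases h.cover w with hw | ⟨k, l, b, j, hw⟩
      · obtain ⟨i, hi⟩ := List.get_of_mem hw
        exact ⟨Sum.inl i, hi⟩
      · exact ⟨Sum.inr ⟨⟨k, l, b⟩, j⟩, hw⟩

/-- A morphism between left monogamous cospans which is bijective on boxes is bijective on
wires. -/
theorem Hom.wire_bijective {G : Hyp.{u, v}} {H : Hyp.{u₁, v₁}} (f : G.Hom H) {p : List G.W}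
    (hp : G.LeftMono p) (hq : H.LeftMono (p.map f.wire))
    (hf : ∀ k l, Function.Bijective (f.box : G.B k l → H.B k l)) :
    Function.Bijective f.wire := by
  constructor
  · intro w w' h
    rcases hp.cover w with hw | ⟨k, l, b, j, hw⟩ <;>
      rcases hp.cover w' with hw' | ⟨k', l', b', j', hw'⟩
    · exact List.inj_on_of_nodup_map hq.nodup hw hw' h
    · refine absurd (List.mem_map_of_mem (f := f.wire) hw) ?_
      rw [h, ← hw', ← f.out_box]
      exact hq.disj _ _
    · refine absurd (List.mem_map_of_mem (f := f.wire) hw') ?_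
      rw [← h, ← hw, ← f.out_box]
      exact hq.disj _ _
    · rw [← hw, ← hw', ← f.out_box, ← f.out_box] at h
      have := hq.inj _ _ _ _ h
      obtain ⟨h1, h3⟩ := Sigma.mk.inj_iff.1 this
      obtain ⟨rfl, h2⟩ := Sigma.mk.inj_iff.1 h1
      obtain ⟨rfl, h2⟩ := Sigma.mk.inj_iff.1 (eq_of_heq h2)
      have h3 := eq_of_heq h3
      subst h3
      have h2 := eq_of_heq h2
      rw [(hf _ _).1 h2] at hw
      exact hw.symm.trans hw'
  · intro w
    rcases hq.cover w with hw | ⟨k, l, b, j, hw⟩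
    · obtain ⟨x, -, hx⟩ := List.mem_map.1 hw
      exact ⟨x, hx⟩
    · obtain ⟨b, rfl⟩ := (hf _ _).2 b
      exact ⟨_, (f.out_box b j).symm.trans hw⟩

/-- The disjoint union of two hypergraphs. -/
@[reducible]
def sum (G : Hyp.{u, v}) (H : Hyp.{u, v}) : Hyp.{u, v} where
  W := G.W ⊕ H.W
  B k l := G.B k l ⊕ H.B k l
  inp b i := Sum.elim (fun b => Sum.inl (G.inp b i)) (fun b => Sum.inr (H.inp b i)) b
  out b j := Sum.elim (fun b => Sum.inl (G.out b j)) (fun b => Sum.inr (H.out b j)) b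

/-- The first map into the disjoint union, on wires. -/
@[reducible]
def sinl {G H : Hyp.{u, v}} (x : G.W) : (sum G H).W := Sum.inl x

/-- The second map into the disjoint union, on wires. -/
@[reducible]
def sinr {G H : Hyp.{u, v}} (x : H.W) : (sum G H).W := Sum.inr x

/-- The relation that identifies the `i`-th entry of `q` with the `i`-th entry of `r`. -/
inductive Glue {A B : Type u} (q : List A) (r : List B) : A ⊕ B → A ⊕ B → Prop
  | mk {a : A} {b : B} (h : (a, b) ∈ q.zip r) : Glue q r (Sum.inl a) (Sum.inr b)

/-- The pushout of two hypergraphs along maps from a finite discrete hypergraph to both of them,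
given by the lists `q` and `r` of their values (of equal length): a quotient of the disjoint
union of the sets of wires, and the disjoint union of the sets of boxes. -/
def pushout (G : Hyp.{u, v}) (H : Hyp.{u, v}) (q : List G.W) (r : List H.W) : Hyp.{u, v} where
  W := Quot (Glue q r)
  B k l := G.B k l ⊕ H.B k l
  inp b i := Quot.mk _ ((sum G H).inp b i)
  out b j := Quot.mk _ ((sum G H).out b j)

/-- The hypergraph without boxes. -/
@[reducible]
def discrete (A : Type u) : Hyp.{u, v} where
  W := A
  B _ _ := PEmpty
  inp b := b.elim
  out b := b.elim

end Hyp

/-! ## String diagrams -/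

open Hyp

/-- A gs-monoidal string diagram for the signature `S`, with the word `X` of input wires and the
word `Y` of output wires: a cospan over `S` from the discrete hypergraph on the positions of `X`
to the one on the positions of `Y`, whose apex is a finite acyclic hypergraph, and which is left
monogamous. A leg, being a label-preserving map from the positions of a word to the wires of the
apex, is given by the list of its values. -/
structure Diagram (S : Hyp.{u, v}) (X Y : List S.W) where
  apex : Hyp.{0, 0}
  finite : apex.IsFinite
  label : apex.Hom S
  ins : List apex.W
  outs : List apex.W
  ins_label : ins.map label.wire = X
  outs_label : outs.map label.wire = Y
  acyclic : apex.Acyclic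
  monogamous : apex.LeftMonogamous ins

namespace Diagram

variable {S : Hyp.{u, v}}

theorem mono {X Y : List S.W} (D : Diagram S X Y) : D.apex.LeftMono D.ins :=
  (leftMonogamous_iff D.finite.boxes _).1 D.monogamous

/-- Two diagrams are isomorphic as cospans over `S`. -/
def Iso {X Y : List S.W} (D E : Diagram S X Y) : Prop :=
  ∃ f : D.apex.Hom E.apex, f.IsIso ∧ f.comp E.label = D.label ∧
    D.ins.map f.wire = E.ins ∧ D.outs.map f.wire = E.outs

/-- Bijectivity on wires is automatic. -/
theorem Iso.mk' {X Y : List S.W} {D E : Diagram S X Y} (f : D.apex.Hom E.apex)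
    (hb : ∀ k l, Function.Bijective (f.box : D.apex.B k l → E.apex.B k l))
    (hl : f.comp E.label = D.label) (hi : D.ins.map f.wire = E.ins)
    (ho : D.outs.map f.wire = E.outs) : Iso D E :=
  ⟨f, ⟨f.wire_bijective D.mono (by rw [hi]; exact E.mono) hb, hb⟩, hl, hi, ho⟩

theorem Iso.refl {X Y : List S.W} (D : Diagram S X Y) : Iso D D :=
  Iso.mk' (Hom.id _) (fun _ _ => Function.bijective_id) rfl
    (by simp [Hom.id]) (by simp [Hom.id])

theorem Iso.trans {X Y : List S.W} {D E F : Diagram S X Y} (h : Iso D E) (h' : Iso E F) :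
    Iso D F := by
  obtain ⟨f, hf, h1, h2, h3⟩ := h
  obtain ⟨g, hg, h1', h2', h3'⟩ := h'
  refine Iso.mk' (f.comp g) (fun k l => (hg.box k l).comp (hf.box k l)) ?_ ?_ ?_
  · rw [← h1, ← h1']; rfl
  · rw [← h2', ← h2, List.map_map]; rfl
  · rw [← h3', ← h3, List.map_map]; rfl

theorem Iso.symm {X Y : List S.W} {D E : Diagram S X Y} (h : Iso D E) : Iso E D := by
  obtain ⟨f, hf, h1, h2, h3⟩ := h
  let e := Equiv.ofBijective _ hf.wire
  let eb := fun k l => Equiv.ofBijective _ (hf.box k l)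
  have he : ∀ w, f.wire (e.symm w) = w := e.apply_symm_apply
  have he' : ∀ w, e.symm (f.wire w) = w := e.symm_apply_apply
  have heb : ∀ k l b, f.box ((eb k l).symm b) = b := fun k l => (eb k l).apply_symm_apply
  let g : E.apex.Hom D.apex :=
    { wire := e.symm
      box := fun {k l} b => (eb k l).symm b
      inp_box := fun {k l} b i => by
        apply hf.wire.1
        rw [he, ← f.inp_box, heb]
      out_box := fun {k l} b i => by
        apply hf.wire.1
        rw [he, ← f.out_box, heb] }
  refine Iso.mk' g (fun k l => (eb k l).symm.bijective) ?_ ?_ ?_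
  · rw [← h1]
    apply Hom.ext
    · funext w
      exact congrArg E.label.wire (he w)
    · funext k l b
      exact congrArg E.label.box (heb k l b)
  · rw [← h2, List.map_map]
    exact (List.map_congr_left fun w _ => he' w).trans (List.map_id _)
  · rw [← h3, List.map_map]
    exact (List.map_congr_left fun w _ => he' w).trans (List.map_id _)

/-- Isomorphism of diagrams as a setoid. -/
instance setoid (S : Hyp.{u, v}) (X Y : List S.W) : Setoid (Diagram S X Y) :=
  ⟨Iso, Iso.refl, Iso.symm, Iso.trans⟩

/-! ### Tensor products of diagrams -/

theorem map_map' {A B C : Type*} (f : B → C) (g : A → B) (l : List A) :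
    (l.map g).map f = l.map (f ∘ g) := by
  simp

theorem map_append_map {A B C C' : Type*} (f : C → C') (g : A → C) (h : B → C) (l : List A)
    (l' : List B) : (l.map g ++ l'.map h).map f = l.map (f ∘ g) ++ l'.map (f ∘ h) := by
  simp

theorem map_map_append {A B C C' C'' : Type*} (f : C → C'') (g : A → C) (f' : C' → C'')
    (g' : B → C') (l : List A) (l' : List B) :
    (l.map g).map f ++ (l'.map g').map f' = l.map (f ∘ g) ++ l'.map (f' ∘ g') := by
  simp

/-- The copairing out of a disjoint union. -/
def sumDesc {G H : Hyp.{0, 0}} {K : Hyp.{u, v}} (a : G.Hom K) (b : H.Hom K) : (G.sum H).Hom K where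
  wire := Sum.elim a.wire b.wire
  box := Sum.elim a.box b.box
  inp_box := by rintro k l (x | x) i <;> simp [a.inp_box, b.inp_box]
  out_box := by rintro k l (x | x) i <;> simp [a.out_box, b.out_box]

theorem finite_box_sum {G H K : Hyp.{0, 0}} (hG : Finite G.Box) (hH : Finite H.Box)
    (hK : ∀ k l, K.B k l = (G.B k l ⊕ H.B k l)) : Finite K.Box := by
  obtain ⟨KW, KB, Ki, Ko⟩ := K
  obtain rfl : KB = fun k l => G.B k l ⊕ H.B k l := by
    funext k l
    exact hK k l
  refine Finite.of_surjective (α := G.Box ⊕ H.Box)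
    (fun x => Sum.elim (fun b => ⟨b.1, b.2.1, Sum.inl b.2.2⟩)
      (fun b => ⟨b.1, b.2.1, Sum.inr b.2.2⟩) x) ?_
  rintro ⟨k, l, b | b⟩
  · exact ⟨Sum.inl ⟨k, l, b⟩, rfl⟩
  · exact ⟨Sum.inr ⟨k, l, b⟩, rfl⟩

theorem sum_acyclic {G H : Hyp.{0, 0}} (hG : G.Acyclic) (hH : H.Acyclic) :
    (G.sum H).Acyclic := by
  have h1 : ∀ a w, Relation.TransGen (G.sum H).Step (Sum.inl a) w →
      ∃ a', w = Sum.inl a' ∧ Relation.TransGen G.Step a a' := by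
    intro a w h
    have hs : ∀ a w, (G.sum H).Step (Sum.inl a) w → ∃ a', w = Sum.inl a' ∧ G.Step a a' := by
      intro a w h
      obtain ⟨k, l, b | b, i, j, hi, hj⟩ := step_iff.1 h
      · exact ⟨_, hj.symm, step_iff.2 ⟨k, l, b, i, j, Sum.inl_injective hi, rfl⟩⟩
      · exact absurd hi Sum.inr_ne_inl
    induction h with
    | single h =>
      obtain ⟨a', h1, h2⟩ := hs _ _ h
      exact ⟨a', h1, .single h2⟩
    | tail _ h ih =>
      obtain ⟨a', rfl, h2⟩ := ih
      obtain ⟨a'', h3, h4⟩ := hs _ _ h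
      exact ⟨a'', h3, h2.tail h4⟩
  have h2 : ∀ a w, Relation.TransGen (G.sum H).Step (Sum.inr a) w →
      ∃ a', w = Sum.inr a' ∧ Relation.TransGen H.Step a a' := by
    intro a w h
    have hs : ∀ a w, (G.sum H).Step (Sum.inr a) w → ∃ a', w = Sum.inr a' ∧ H.Step a a' := by
      intro a w h
      obtain ⟨k, l, b | b, i, j, hi, hj⟩ := step_iff.1 h
      · exact absurd hi Sum.inl_ne_inr
      · exact ⟨_, hj.symm, step_iff.2 ⟨k, l, b, i, j, Sum.inr_injective hi, rfl⟩⟩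
    induction h with
    | single h =>
      obtain ⟨a', h1, h2⟩ := hs _ _ h
      exact ⟨a', h1, .single h2⟩
    | tail _ h ih =>
      obtain ⟨a', rfl, h2⟩ := ih
      obtain ⟨a'', h3, h4⟩ := hs _ _ h
      exact ⟨a'', h3, h2.tail h4⟩
  rintro (a | a) h
  · obtain ⟨a', ha, h⟩ := h1 _ _ h
    obtain rfl := Sum.inl_injective ha
    exact hG _ h
  · obtain ⟨a', ha, h⟩ := h2 _ _ h
    obtain rfl := Sum.inr_injective ha
    exact hH _ h

theorem sum_mono {G H : Hyp.{0, 0}} {p : List G.W} {q : List H.W} (hp : G.LeftMono p)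
    (hq : H.LeftMono q) : (G.sum H).LeftMono (p.map sinl ++ q.map sinr) where
  cover := by
    rintro (w | w)
    · rcases hp.cover w with h | ⟨k, l, b, j, h⟩
      · exact Or.inl (List.mem_append_left _ (List.mem_map_of_mem h))
      · exact Or.inr ⟨k, l, Sum.inl b, j, congrArg Sum.inl h⟩
    · rcases hq.cover w with h | ⟨k, l, b, j, h⟩
      · exact Or.inl (List.mem_append_right _ (List.mem_map_of_mem h))
      · exact Or.inr ⟨k, l, Sum.inr b, j, congrArg Sum.inr h⟩
  nodup := by
    refine List.Nodup.append (hp.nodup.map Sum.inl_injective) (hq.nodup.map Sum.inr_injective) ?_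
    intro w h h'
    obtain ⟨a, -, rfl⟩ := List.mem_map.1 h
    obtain ⟨b, -, h⟩ := List.mem_map.1 h'
    exact Sum.inr_ne_inl h
  disj := by
    rintro k l (b | b) j h
    · have h' : G.out b j ∈ p := by
        rcases List.mem_append.1 h with h | h <;> obtain ⟨a, ha, h⟩ := List.mem_map.1 h
        · exact Sum.inl_injective h ▸ ha
        · exact absurd h Sum.inr_ne_inl
      exact hp.disj b j h'
    · have h' : H.out b j ∈ q := by
        rcases List.mem_append.1 h with h | h <;> obtain ⟨a, ha, h⟩ := List.mem_map.1 h
        · exact absurd h Sum.inl_ne_inr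
        · exact Sum.inr_injective h ▸ ha
      exact hq.disj b j h'
  inj := by
    rintro k l (b | b) j k' l' (b' | b') j' h
    · have := hp.inj b j b' j' (Sum.inl_injective h)
      exact congrArg (fun x : (Σ x : G.Box, Fin x.2.1) =>
        (⟨⟨x.1.1, x.1.2.1, Sum.inl x.1.2.2⟩, x.2⟩ : Σ x : (G.sum H).Box, Fin x.2.1)) this
    · exact absurd h Sum.inl_ne_inr
    · exact absurd h Sum.inr_ne_inl
    · have := hq.inj b j b' j' (Sum.inr_injective h)
      exact congrArg (fun x : (Σ x : H.Box, Fin x.2.1) =>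
        (⟨⟨x.1.1, x.1.2.1, Sum.inr x.1.2.2⟩, x.2⟩ : Σ x : (G.sum H).Box, Fin x.2.1)) this

/-- The tensor product (juxtaposition) of two diagrams. -/
@[reducible]
def tensor {X Y X' Y' : List S.W} (D : Diagram S X Y) (E : Diagram S X' Y') :
    Diagram S (X ++ X') (Y ++ Y') where
  apex := D.apex.sum E.apex
  finite :=
    ⟨by
      have := D.finite.wires
      have := E.finite.wires
      exact inferInstanceAs (Finite (D.apex.W ⊕ E.apex.W)),
    finite_box_sum D.finite.boxes E.finite.boxes fun _ _ => rfl⟩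
  label := sumDesc D.label E.label
  ins := D.ins.map sinl ++ E.ins.map sinr
  outs := D.outs.map sinl ++ E.outs.map sinr
  ins_label := by
    rw [List.map_append, List.map_map, List.map_map]
    exact congrArg₂ _ D.ins_label E.ins_label
  outs_label := by
    rw [List.map_append, List.map_map, List.map_map]
    exact congrArg₂ _ D.outs_label E.outs_label
  acyclic := sum_acyclic D.acyclic E.acyclic
  monogamous := (leftMonogamous_iff
    (finite_box_sum D.finite.boxes E.finite.boxes fun _ _ => rfl) _).2 (sum_mono D.mono E.mono)

/-! ### Composition of diagrams -/

theorem eq_of_mem_zip {A B C : Type*} {f : A → C} {g : B → C} :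
    ∀ {q : List A} {r : List B}, q.map f = r.map g → ∀ {a b}, (a, b) ∈ q.zip r → f a = g b
  | [], _, _, _, _, h => by simp at h
  | _ :: _, [], h, _, _, _ => by simp at h
  | x :: q, y :: r, h, a, b, hm => by
    simp only [List.map_cons, List.cons.injEq] at h
    simp only [List.zip_cons_cons, List.mem_cons, Prod.mk.injEq] at hm
    rcases hm with ⟨rfl, rfl⟩ | hm
    · exact h.1
    · exact eq_of_mem_zip h.2 hm

theorem map_eq_of_mem_zip {A B C : Type*} {f : A → C} {g : B → C} :
    ∀ {q : List A} {r : List B}, q.length = r.length →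
      (∀ a b, (a, b) ∈ q.zip r → f a = g b) → q.map f = r.map g
  | [], [], _, _ => rfl
  | [], _ :: _, h, _ => by simp at h
  | _ :: _, [], h, _ => by simp at h
  | x :: q, y :: r, h, hm => by
    simp only [List.map_cons, List.cons.injEq]
    exact ⟨hm _ _ (by simp), map_eq_of_mem_zip (by simpa using h)
      fun a b hab => hm _ _ (by simp [hab])⟩

theorem zip_unique {A B : Type*} : ∀ {q : List A} {r : List B}, r.Nodup → ∀ {a a' b},
    (a, b) ∈ q.zip r → (a', b) ∈ q.zip r → a = a'
  | [], _, _, _, _, _, h, _ => by simp at h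
  | _ :: _, [], _, _, _, _, h, _ => by simp at h
  | x :: q, y :: r, hr, a, a', b, h, h' => by
    simp only [List.nodup_cons] at hr
    simp only [List.zip_cons_cons, List.mem_cons, Prod.mk.injEq] at h h'
    rcases h with ⟨rfl, rfl⟩ | h <;> rcases h' with ⟨rfl, h''⟩ | h'
    · rfl
    · exact absurd (List.of_mem_zip h').2 hr.1
    · exact absurd (h'' ▸ (List.of_mem_zip h).2) hr.1
    · exact zip_unique hr.2 h h'

theorem exists_mem_zip {A B : Type*} : ∀ {q : List A} {r : List B}, q.length = r.length →
    ∀ {b}, b ∈ r → ∃ a, (a, b) ∈ q.zip r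
  | [], [], _, _, h => by simp at h
  | [], _ :: _, h, _, _ => by simp at h
  | _ :: _, [], h, _, _ => by simp at h
  | x :: q, y :: r, h, b, hb => by
    rcases List.mem_cons.1 hb with rfl | hb
    · exact ⟨x, by simp⟩
    · obtain ⟨a, ha⟩ := exists_mem_zip (q := q) (r := r) (by simpa using h) hb
      exact ⟨a, by simp [ha]⟩

section Pushout

variable {G H : Hyp.{0, 0}} {q : List G.W} {r : List H.W}

/-- The morphism out of a pushout given by its universal property. -/
def pushDesc {K : Hyp.{u, v}} (a : G.Hom K) (b : H.Hom K) (h : q.map a.wire = r.map b.wire) :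
    (pushout G H q r).Hom K where
  wire := Quot.lift (Sum.elim a.wire b.wire) (by
    rintro _ _ ⟨hm⟩
    exact eq_of_mem_zip h hm)
  box := Sum.elim a.box b.box
  inp_box := by rintro k l (x | x) i <;> simp [pushout, a.inp_box, b.inp_box]
  out_box := by rintro k l (x | x) i <;> simp [pushout, a.out_box, b.out_box]

variable (q r) in
/-- The first map into the pushout, on wires. -/
def pinl (x : G.W) : (pushout G H q r).W := Quot.mk _ (Sum.inl x)

variable (q r) in
/-- The second map into the pushout, on wires. -/
def pinr (x : H.W) : (pushout G H q r).W := Quot.mk _ (Sum.inr x)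

theorem pinl_eq_pinr {a : G.W} {b : H.W} (h : (a, b) ∈ q.zip r) : pinl q r a = pinr q r b :=
  Quot.sound (.mk h)

theorem map_pinl_eq (h : q.length = r.length) : q.map (pinl q r) = r.map (pinr q r) :=
  map_eq_of_mem_zip h fun _ _ => pinl_eq_pinr

variable (q r) in
/-- A normal form of the wires of a pushout. -/
noncomputable def pnf (hr : r.Nodup) : (pushout G H q r).W → G.W ⊕ H.W :=
  Quot.lift (fun x => Sum.elim Sum.inl (fun b => @dite _ (∃ a, (a, b) ∈ q.zip r)
    (Classical.propDecidable _) (fun h => Sum.inl h.choose) (fun _ => Sum.inr b)) x) (by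
      rintro _ _ ⟨hm⟩
      rename_i a b
      have h : ∃ a, (a, b) ∈ q.zip r := ⟨a, hm⟩
      simp only [Sum.elim_inl, Sum.elim_inr, dif_pos h]
      exact congrArg _ (zip_unique hr hm h.choose_spec))

theorem pnf_inr {hr : r.Nodup} {b : H.W} (hb : b ∉ r) : pnf q r hr (pinr q r b) = Sum.inr b := by
  have h : ¬ ∃ a, (a, b) ∈ q.zip r := fun ⟨a, ha⟩ => hb (List.of_mem_zip ha).2
  exact dif_neg h

theorem pinl_injective (hr : r.Nodup) : Function.Injective (pinl q r) := fun _ _ h =>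
  Sum.inl_injective (congrArg (pnf q r hr) h)

theorem pinr_inj (hr : r.Nodup) {b b' : H.W} (hb : b ∉ r) (hb' : b' ∉ r)
    (h : pinr q r b = pinr q r b') : b = b' := by
  have := congrArg (pnf q r hr) h
  rw [pnf_inr hb, pnf_inr hb'] at this
  exact Sum.inr_injective this

theorem pinl_ne_pinr (hr : r.Nodup) {a : G.W} {b : H.W} (hb : b ∉ r) :
    pinl q r a ≠ pinr q r b := fun h => by
  have := congrArg (pnf q r hr) h
  rw [pnf_inr hb] at this
  exact Sum.inl_ne_inr this

theorem push_mono (hl : q.length = r.length) {p : List G.W} (hp : G.LeftMono p)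
    (hr : H.LeftMono r) : (pushout G H q r).LeftMono (p.map (pinl q r)) where
  cover := by
    have hG : ∀ w : G.W, pinl q r w ∈ p.map (pinl q r) ∨ ∃ (k l : ℕ)
        (b : (pushout G H q r).B k l) (j : Fin l), (pushout G H q r).out b j = pinl q r w := by
      intro w
      rcases hp.cover w with h | ⟨k, l, b, j, h⟩
      · exact Or.inl (List.mem_map_of_mem h)
      · exact Or.inr ⟨k, l, Sum.inl b, j, congrArg (pinl q r) h⟩
    rintro ⟨w | w⟩
    · exact hG w
    · rcases hr.cover w with h | ⟨k, l, b, j, h⟩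
      · obtain ⟨a, ha⟩ := exists_mem_zip hl h
        have := hG a
        rw [pinl_eq_pinr ha] at this
        exact this
      · exact Or.inr ⟨k, l, Sum.inr b, j, congrArg (pinr q r) h⟩
  nodup := hp.nodup.map (pinl_injective hr.nodup)
  disj := by
    rintro k l (b | b) j h
    · obtain ⟨a, ha, h⟩ := List.mem_map.1 h
      obtain rfl := pinl_injective hr.nodup h
      exact hp.disj b j ha
    · obtain ⟨a, -, h⟩ := List.mem_map.1 h
      exact pinl_ne_pinr hr.nodup (hr.disj b j) h
  inj := by
    rintro k l (b | b) j k' l' (b' | b') j' h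
    · have := hp.inj b j b' j' (pinl_injective hr.nodup h)
      exact congrArg (fun x : (Σ x : G.Box, Fin x.2.1) =>
        (⟨⟨x.1.1, x.1.2.1, Sum.inl x.1.2.2⟩, x.2⟩ :
          Σ x : (pushout G H q r).Box, Fin x.2.1)) this
    · exact absurd h (pinl_ne_pinr hr.nodup (hr.disj b' j'))
    · exact absurd h.symm (pinl_ne_pinr hr.nodup (hr.disj b j))
    · have := hr.inj b j b' j' (pinr_inj hr.nodup (hr.disj b j) (hr.disj b' j') h)
      exact congrArg (fun x : (Σ x : H.Box, Fin x.2.1) =>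
        (⟨⟨x.1.1, x.1.2.1, Sum.inr x.1.2.2⟩, x.2⟩ :
          Σ x : (pushout G H q r).Box, Fin x.2.1)) this

theorem push_acyclic (hG : G.Acyclic) (hH : H.Acyclic) (hl : q.length = r.length)
    (hr : H.LeftMono r) : (pushout G H q r).Acyclic := by
  have h1 : ∀ w x, Relation.TransGen (pushout G H q r).Step w x → ∀ a, x = pinl q r a →
      ∃ a', w = pinl q r a' ∧ Relation.TransGen G.Step a' a := by
    have hs : ∀ w a, (pushout G H q r).Step w (pinl q r a) →
        ∃ a', w = pinl q r a' ∧ G.Step a' a := by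
      intro w a h
      obtain ⟨k, l, b | b, i, j, hi, hj⟩ := step_iff.1 h
      · exact ⟨_, hi.symm, step_iff.2 ⟨k, l, b, i, j, rfl, pinl_injective hr.nodup hj⟩⟩
      · exact absurd hj.symm (pinl_ne_pinr hr.nodup (hr.disj b j))
    intro w x h
    induction h with
    | single h =>
      rintro a rfl
      obtain ⟨a', h1, h2⟩ := hs _ _ h
      exact ⟨a', h1, .single h2⟩
    | tail _ h ih =>
      rintro a rfl
      obtain ⟨a', h1, h2⟩ := hs _ _ h
      obtain ⟨a'', h3, h4⟩ := ih _ h1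
      exact ⟨a'', h3, h4.tail h2⟩
  have h2 : ∀ b w, b ∉ r → Relation.TransGen (pushout G H q r).Step (pinr q r b) w →
      ∃ b', b' ∉ r ∧ w = pinr q r b' ∧ Relation.TransGen H.Step b b' := by
    have hs : ∀ b w, b ∉ r → (pushout G H q r).Step (pinr q r b) w →
        ∃ b', b' ∉ r ∧ w = pinr q r b' ∧ H.Step b b' := by
      intro b w hb h
      obtain ⟨k, l, c | c, i, j, hi, hj⟩ := step_iff.1 h
      · exact absurd hi (pinl_ne_pinr hr.nodup hb)
      · refine ⟨_, hr.disj c j, hj.symm, step_iff.2 ⟨k, l, c, i, j, ?_, rfl⟩⟩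
        refine pinr_inj hr.nodup (fun hc => ?_) hb hi
        obtain ⟨a, ha⟩ := exists_mem_zip hl hc
        exact pinl_ne_pinr hr.nodup hb ((pinl_eq_pinr ha).trans hi)
    intro b w hb h
    induction h with
    | single h =>
      obtain ⟨b', h1, h2, h3⟩ := hs _ _ hb h
      exact ⟨b', h1, h2, .single h3⟩
    | tail _ h ih =>
      obtain ⟨b', h1, rfl, h3⟩ := ih
      obtain ⟨b'', h4, h5, h6⟩ := hs _ _ h1 h
      exact ⟨b'', h4, h5, h3.tail h6⟩
  have h3 : ∀ a, ¬ Relation.TransGen (pushout G H q r).Step (pinl q r a) (pinl q r a) := by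
    intro a h
    obtain ⟨a', ha, h⟩ := h1 _ _ h a rfl
    obtain rfl := pinl_injective hr.nodup ha
    exact hG _ h
  rintro ⟨a | b⟩ h
  · exact h3 a h
  · by_cases hb : b ∈ r
    · obtain ⟨a, ha⟩ := exists_mem_zip hl hb
      have h : Relation.TransGen (pushout G H q r).Step (pinr q r b) (pinr q r b) := h
      rw [← pinl_eq_pinr ha] at h
      exact h3 a h
    · obtain ⟨b', hb', h4, h5⟩ := h2 _ _ hb h
      obtain rfl := pinr_inj hr.nodup hb hb' h4
      exact hH _ h5

end Pushout

theorem match_labels {X Y Z : List S.W} (D : Diagram S X Y) (E : Diagram S Y Z) :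
    D.outs.map D.label.wire = E.ins.map E.label.wire := D.outs_label.trans E.ins_label.symm

theorem match_length {X Y Z : List S.W} (D : Diagram S X Y) (E : Diagram S Y Z) :
    D.outs.length = E.ins.length := by
  simpa using congrArg List.length (match_labels D E)

/-- The composite of two diagrams, by pushout over the intermediate interface. -/
def comp {X Y Z : List S.W} (D : Diagram S X Y) (E : Diagram S Y Z) : Diagram S X Z where
  apex := pushout D.apex E.apex D.outs E.ins
  finite :=
    ⟨by
      have := D.finite.wires
      have := E.finite.wires
      exact inferInstanceAs (Finite (Quot (Glue D.outs E.ins))),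
    finite_box_sum D.finite.boxes E.finite.boxes fun _ _ => rfl⟩
  label := pushDesc D.label E.label (match_labels D E)
  ins := D.ins.map (pinl D.outs E.ins)
  outs := E.outs.map (pinr D.outs E.ins)
  ins_label := by
    rw [List.map_map]
    exact D.ins_label
  outs_label := by
    rw [List.map_map]
    exact E.outs_label
  acyclic := push_acyclic D.acyclic E.acyclic (match_length D E) E.mono
  monogamous := (leftMonogamous_iff
    (finite_box_sum D.finite.boxes E.finite.boxes fun _ _ => rfl) _).2
      (push_mono (match_length D E) D.mono E.mono)

/-- A criterion for recognizing a composite. -/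
theorem comp_iso {X Y Z : List S.W} {D : Diagram S X Y} {E : Diagram S Y Z} {F : Diagram S X Z}
    (a : D.apex.Hom F.apex) (b : E.apex.Hom F.apex) (ha : a.comp F.label = D.label)
    (hb : b.comp F.label = E.label) (h1 : D.ins.map a.wire = F.ins)
    (h2 : D.outs.map a.wire = E.ins.map b.wire) (h3 : E.outs.map b.wire = F.outs)
    (hbij : ∀ k l, Function.Bijective
      (Sum.elim a.box b.box : D.apex.B k l ⊕ E.apex.B k l → F.apex.B k l)) :
    Iso (D.comp E) F := by
  refine Iso.mk' (pushDesc a b h2) hbij ?_ ?_ ?_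
  · apply Hom.ext
    · funext x
      obtain ⟨x | x⟩ := x
      · exact congrFun (congrArg Hom.wire ha) x
      · exact congrFun (congrArg Hom.wire hb) x
    · funext k l x
      obtain x | x := x
      · exact Hom.box_congr ha x
      · exact Hom.box_congr hb x
  · rw [← h1]
    exact List.map_map
  · rw [← h3]
    exact List.map_map

end Diagram

/-! ## The category of string diagrams -/

/-- The objects of the free gs-monoidal category on `S`: words over the set of wires of `S`. (A
word of length `n` is the same thing as a map from the discrete hypergraph with `n` wires.) -/
@[ext]
structure FreeGS (S : Hyp.{u, v}) : Type u where
  /-- The object given by a word. -/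
  ofWord ::
  /-- The underlying word of an object. -/
  word : List S.W

namespace FreeGS

open Diagram

variable {S : Hyp.{u, v}}

/-- Morphisms: isomorphism classes of string diagrams. -/
def Hom (X Y : FreeGS S) : Type (max 1 u v) := Quotient (Diagram.setoid S X.word Y.word)

/-- The morphism represented by a diagram. -/
def cls {X Y : FreeGS S} (D : Diagram S X.word Y.word) : Hom X Y := Quotient.mk _ D

theorem cls_eq {X Y : FreeGS S} {D E : Diagram S X.word Y.word} (h : Iso D E) :
    cls D = cls E := Quotient.sound h

theorem comp_congr {X Y Z : List S.W} {D D' : Diagram S X Y} {E E' : Diagram S Y Z}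
    (h : Iso D D') (h' : Iso E E') : Iso (D.comp E) (D'.comp E') := by
  obtain ⟨f, hf, h1, h2, h3⟩ := h
  obtain ⟨g, hg, h1', h2', h3'⟩ := h'
  let a : D.apex.Hom (D'.comp E').apex :=
    { wire := fun w => pinl D'.outs E'.ins (f.wire w)
      box := fun b => Sum.inl (f.box b)
      inp_box := fun b i => congrArg (pinl D'.outs E'.ins) (f.inp_box b i)
      out_box := fun b i => congrArg (pinl D'.outs E'.ins) (f.out_box b i) }
  let b : E.apex.Hom (D'.comp E').apex :=
    { wire := fun w => pinr D'.outs E'.ins (g.wire w)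
      box := fun b => Sum.inr (g.box b)
      inp_box := fun b i => congrArg (pinr D'.outs E'.ins) (g.inp_box b i)
      out_box := fun b i => congrArg (pinr D'.outs E'.ins) (g.out_box b i) }
  refine comp_iso a b h1 h1' ?_ ?_ ?_ ?_
  · change D.ins.map (pinl D'.outs E'.ins ∘ f.wire) = D'.ins.map (pinl D'.outs E'.ins)
    rw [← h2, List.map_map]
  · change D.outs.map (pinl D'.outs E'.ins ∘ f.wire) = E.ins.map (pinr D'.outs E'.ins ∘ g.wire)
    rw [← List.map_map, ← List.map_map, h3, h2']
    exact map_pinl_eq (match_length D' E')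
  · change E.outs.map (pinr D'.outs E'.ins ∘ g.wire) = E'.outs.map (pinr D'.outs E'.ins)
    rw [← h3', List.map_map]
  · intro k l
    exact (Equiv.sumCongr (Equiv.ofBijective _ (hf.box k l))
      (Equiv.ofBijective _ (hg.box k l))).bijective

theorem tensor_congr {X Y X' Y' : List S.W} {D D' : Diagram S X Y} {E E' : Diagram S X' Y'}
    (h : Iso D D') (h' : Iso E E') : Iso (D.tensor E) (D'.tensor E') := by
  obtain ⟨f, hf, h1, h2, h3⟩ := h
  obtain ⟨g, hg, h1', h2', h3'⟩ := h'
  let a : (D.tensor E).apex.Hom (D'.tensor E').apex :=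
    { wire := Sum.map f.wire g.wire
      box := Sum.map f.box g.box
      inp_box := by
        rintro k l (b | b) i
        · exact congrArg Sum.inl (f.inp_box b i)
        · exact congrArg Sum.inr (g.inp_box b i)
      out_box := by
        rintro k l (b | b) i
        · exact congrArg Sum.inl (f.out_box b i)
        · exact congrArg Sum.inr (g.out_box b i) }
  refine Iso.mk' a ?_ ?_ ?_ ?_
  · intro k l
    exact (Equiv.sumCongr (Equiv.ofBijective _ (hf.box k l))
      (Equiv.ofBijective _ (hg.box k l))).bijective
  · apply Hom.ext
    · funext x
      obtain x | x := x
      · exact congrFun (congrArg Hom.wire h1) x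
      · exact congrFun (congrArg Hom.wire h1') x
    · funext k l x
      obtain x | x := x
      · exact Hom.box_congr h1 x
      · exact Hom.box_congr h1' x
  · refine (map_append_map a.wire sinl sinr D.ins E.ins).trans ?_
    change _ = D'.ins.map sinl ++ E'.ins.map sinr
    rw [← h2, ← h2']
    exact (map_map_append sinl f.wire sinr g.wire _ _).symm
  · refine (map_append_map a.wire sinl sinr D.outs E.outs).trans ?_
    change _ = D'.outs.map sinl ++ E'.outs.map sinr
    rw [← h3, ← h3']
    exact (map_map_append sinl f.wire sinr g.wire _ _).symm

/-- The diagram without boxes given by a finite set `A` of labelled wires, with inputs `a` and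
outputs `b`, where `a` enumerates `A` without repetition. -/
def wiring {A : Type} [Finite A] (lab : A → S.W) (a b : List A) (ha : a.Nodup ∧ ∀ x, x ∈ a)
    {X Y : List S.W} (hX : a.map lab = X) (hY : b.map lab = Y) : Diagram S X Y where
  apex := discrete A
  finite := ⟨inferInstanceAs (Finite A), by
    have : IsEmpty (discrete.{0, 0} A).Box := ⟨fun x => x.2.2.elim⟩
    infer_instance⟩
  label := ⟨lab, fun b => b.elim, fun b => b.elim, fun b => b.elim⟩
  ins := a
  outs := b
  ins_label := hX
  outs_label := hY
  acyclic w h := by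
    have hs : ∀ x y, ¬ (discrete.{0, 0} A).Step x y := fun x y ⟨b, _⟩ => b.2.2.elim
    obtain h | ⟨-, h⟩ := h <;> exact hs _ _ h
  monogamous := by
    have : IsEmpty (discrete.{0, 0} A).Box := ⟨fun x => x.2.2.elim⟩
    exact (leftMonogamous_iff inferInstance _).2
      ⟨fun w => Or.inl (ha.2 w), ha.1, fun b => b.elim, fun b => b.elim⟩

theorem finRange_spec (n : ℕ) : (List.finRange n).Nodup ∧ ∀ x, x ∈ List.finRange n :=
  ⟨List.nodup_finRange n, List.mem_finRange⟩

theorem map_finRange_get {A : Type*} (X : List A) : (List.finRange X.length).map X.get = X := by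
  simp

/-- The identity diagram. -/
def idDiagram (X : List S.W) : Diagram S X X :=
  wiring X.get (List.finRange X.length) (List.finRange X.length) (finRange_spec _)
    (map_finRange_get X) (map_finRange_get X)

/-- The diagram that copies a word. -/
def copyDiagram (X : List S.W) : Diagram S X (X ++ X) :=
  wiring X.get (List.finRange X.length) (List.finRange X.length ++ List.finRange X.length)
    (finRange_spec _) (map_finRange_get X) (by rw [List.map_append, map_finRange_get])

/-- The diagram that discards a word. -/
def delDiagram (X : List S.W) : Diagram S X [] :=
  wiring X.get (List.finRange X.length) [] (finRange_spec _) (map_finRange_get X) rfl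

/-- The diagram that swaps two words. -/
def swapDiagram (X Y : List S.W) : Diagram S (X ++ Y) (Y ++ X) :=
  wiring (Sum.elim X.get Y.get)
    ((List.finRange X.length).map Sum.inl ++ (List.finRange Y.length).map Sum.inr)
    ((List.finRange Y.length).map Sum.inr ++ (List.finRange X.length).map Sum.inl)
    (by
      refine ⟨List.Nodup.append ((finRange_spec _).1.map Sum.inl_injective)
        ((finRange_spec _).1.map Sum.inr_injective) ?_, ?_⟩
      · intro w h h'
        obtain ⟨a, -, rfl⟩ := List.mem_map.1 h
        obtain ⟨b, -, h⟩ := List.mem_map.1 h'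
        exact Sum.inr_ne_inl h
      · rintro (x | x) <;> simp)
    (by
      rw [List.map_append, List.map_map, List.map_map, Sum.elim_comp_inl, Sum.elim_comp_inr,
        map_finRange_get, map_finRange_get])
    (by
      rw [List.map_append, List.map_map, List.map_map, Sum.elim_comp_inl, Sum.elim_comp_inr,
        map_finRange_get, map_finRange_get])

theorem exists_index {A B : Type*} {f : A → B} {X : List B} {l : List A} (h : l.map f = X) :
    ∃ g : Fin X.length → A, (List.finRange X.length).map g = l ∧ ∀ i, f (g i) = X.get i := by
  subst h
  refine ⟨fun i => l.get (i.cast (by simp)), ?_, fun i => by simp⟩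
  apply List.ext_get <;> simp

/-- A map of wires out of a diagram without boxes. -/
def discHom {A : Type} {K : Hyp.{0, 0}} (g : A → K.W) : (discrete.{0, 0} A).Hom K :=
  ⟨g, fun b => b.elim, fun b => b.elim, fun b => b.elim⟩

theorem discHom_label {A : Type} {lab : A → S.W} {K : Hyp.{0, 0}} {g : A → K.W} {L : K.Hom S}
    {M : (discrete A).Hom S} (hM : M.wire = lab) (h : ∀ i, L.wire (g i) = lab i) :
    (discHom g).comp L = M := by
  apply Hom.ext
  · rw [hM]
    exact funext h
  · funext k l b
    exact b.elim

/-- Composing with a wiring. -/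
theorem comp_wiring {X Y Z : List S.W} {D : Diagram S X Y} {F : Diagram S X Z} {A : Type}
    [Finite A] {lab : A → S.W} {a b : List A} {ha : a.Nodup ∧ ∀ x, x ∈ a} {hX : a.map lab = Y}
    {hY : b.map lab = Z} (f : D.apex.Hom F.apex) (g : A → F.apex.W)
    (hg : ∀ i, F.label.wire (g i) = lab i) (hf : f.comp F.label = D.label)
    (h1 : D.ins.map f.wire = F.ins) (h2 : D.outs.map f.wire = a.map g) (h3 : b.map g = F.outs)
    (hb : ∀ k l, Function.Bijective (f.box : D.apex.B k l → F.apex.B k l)) :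
    Iso (D.comp (wiring lab a b ha hX hY)) F := by
  refine comp_iso f (discHom g) hf (discHom_label rfl hg) h1 h2 h3 fun k l => ?_
  have : IsEmpty ((discrete.{0, 0} A).B k l) := inferInstanceAs (IsEmpty PEmpty)
  constructor
  · rintro (x | x) (y | y) h
    · exact congrArg _ ((hb k l).1 h)
    · exact y.elim
    · exact x.elim
    · exact x.elim
  · intro x
    obtain ⟨y, hy⟩ := (hb k l).2 x
    exact ⟨Sum.inl y, hy⟩

/-- Precomposing with a wiring. -/
theorem wiring_comp {X Y Z : List S.W} {D : Diagram S Y Z} {F : Diagram S X Z} {A : Type}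
    [Finite A] {lab : A → S.W} {a b : List A} {ha : a.Nodup ∧ ∀ x, x ∈ a} {hX : a.map lab = X}
    {hY : b.map lab = Y} (f : D.apex.Hom F.apex) (g : A → F.apex.W)
    (hg : ∀ i, F.label.wire (g i) = lab i) (hf : f.comp F.label = D.label)
    (h1 : a.map g = F.ins) (h2 : b.map g = D.ins.map f.wire) (h3 : D.outs.map f.wire = F.outs)
    (hb : ∀ k l, Function.Bijective (f.box : D.apex.B k l → F.apex.B k l)) :
    Iso ((wiring lab a b ha hX hY).comp D) F := by
  refine comp_iso (discHom g) f (discHom_label rfl hg) hf h1 h2 h3 fun k l => ?_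
  have : IsEmpty ((discrete.{0, 0} A).B k l) := inferInstanceAs (IsEmpty PEmpty)
  constructor
  · rintro (x | x) (y | y) h
    · exact x.elim
    · exact x.elim
    · exact y.elim
    · exact congrArg _ ((hb k l).1 h)
  · intro x
    obtain ⟨y, hy⟩ := (hb k l).2 x
    exact ⟨Sum.inr y, hy⟩

theorem comp_id {X Y : List S.W} (D : Diagram S X Y) : Iso (D.comp (idDiagram Y)) D := by
  obtain ⟨g, hg, hg'⟩ := exists_index D.outs_label
  exact comp_wiring (Hom.id _) g hg' rfl (List.map_id _) ((List.map_id _).trans hg.symm) hg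
    fun _ _ => Function.bijective_id

theorem id_comp {X Y : List S.W} (D : Diagram S X Y) : Iso ((idDiagram X).comp D) D := by
  obtain ⟨g, hg, hg'⟩ := exists_index D.ins_label
  exact wiring_comp (Hom.id _) g hg' rfl hg (hg.trans (List.map_id _).symm) (List.map_id _)
    fun _ _ => Function.bijective_id

/-- The first map into a pushout. -/
def pinlHom {G H : Hyp.{0, 0}} (q : List G.W) (r : List H.W) : G.Hom (pushout G H q r) :=
  ⟨pinl q r, Sum.inl, fun _ _ => rfl, fun _ _ => rfl⟩

/-- The second map into a pushout. -/
def pinrHom {G H : Hyp.{0, 0}} (q : List G.W) (r : List H.W) : H.Hom (pushout G H q r) :=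
  ⟨pinr q r, Sum.inr, fun _ _ => rfl, fun _ _ => rfl⟩

/-- The first map into a disjoint union. -/
def sinlHom {G H : Hyp.{0, 0}} : G.Hom (G.sum H) := ⟨sinl, Sum.inl, fun _ _ => rfl, fun _ _ => rfl⟩

/-- The second map into a disjoint union. -/
def sinrHom {G H : Hyp.{0, 0}} : H.Hom (G.sum H) := ⟨sinr, Sum.inr, fun _ _ => rfl, fun _ _ => rfl⟩

theorem push_hom_ext {G H : Hyp.{0, 0}} {q : List G.W} {r : List H.W} {K : Hyp.{u₁, v₁}}
    {f g : (pushout G H q r).Hom K} (h1 : (pinlHom q r).comp f = (pinlHom q r).comp g)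
    (h2 : (pinrHom q r).comp f = (pinrHom q r).comp g) : f = g := by
  apply Hom.ext
  · funext x
    obtain ⟨x | x⟩ := x
    · exact congrFun (congrArg Hom.wire h1) x
    · exact congrFun (congrArg Hom.wire h2) x
  · funext k l x
    obtain x | x := x
    · exact Hom.box_congr h1 x
    · exact Hom.box_congr h2 x

theorem sum_hom_ext {G H : Hyp.{0, 0}} {K : Hyp.{u₁, v₁}}
    {f g : (G.sum H).Hom K} (h1 : sinlHom.comp f = sinlHom.comp g)
    (h2 : sinrHom.comp f = sinrHom.comp g) : f = g := by
  apply Hom.ext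
  · funext x
    obtain x | x := x
    · exact congrFun (congrArg Hom.wire h1) x
    · exact congrFun (congrArg Hom.wire h2) x
  · funext k l x
    obtain x | x := x
    · exact Hom.box_congr h1 x
    · exact Hom.box_congr h2 x

theorem bij_of_eq {A B : Type*} (e : A ≃ B) {f : A → B} (h : ∀ x, f x = e x) :
    Function.Bijective f := by
  rw [show f = e from funext h]
  exact e.bijective

theorem comp_assoc {X Y Z T : List S.W} (D : Diagram S X Y) (E : Diagram S Y Z)
    (F : Diagram S Z T) : Iso ((D.comp E).comp F) (D.comp (E.comp F)) := by
  let i1 : D.apex.Hom (D.comp (E.comp F)).apex := pinlHom _ _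
  let i2 : E.apex.Hom (D.comp (E.comp F)).apex :=
    Hom.comp (pinlHom E.outs F.ins) (pinrHom D.outs (E.comp F).ins)
  let i3 : F.apex.Hom (D.comp (E.comp F)).apex :=
    Hom.comp (pinrHom E.outs F.ins) (pinrHom D.outs (E.comp F).ins)
  have h12 : D.outs.map i1.wire = E.ins.map i2.wire := by
    have := map_pinl_eq (match_length D (E.comp F))
    exact this.trans List.map_map
  have h23 : E.outs.map i2.wire = F.ins.map i3.wire := by
    have := congrArg (List.map (pinr D.outs (E.comp F).ins)) (map_pinl_eq (match_length E F))
    exact (map_map' _ (pinl E.outs F.ins) _).symm.trans (this.trans (map_map' _ _ _))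
  refine comp_iso (pushDesc i1 i2 h12) i3 (push_hom_ext rfl rfl) rfl ?_ ?_ ?_ ?_
  · exact List.map_map
  · exact List.map_map.trans h23
  · exact (map_map' (pinr D.outs (E.comp F).ins) (pinr E.outs F.ins) F.outs).symm
  · intro k l
    refine bij_of_eq (Equiv.sumAssoc (D.apex.B k l) (E.apex.B k l) (F.apex.B k l)) fun x => ?_
    obtain (x | x) | x := x <;> rfl

instance category : Category (FreeGS S) where
  Hom := Hom
  id X := cls (idDiagram X.word)
  comp := Quotient.map₂ Diagram.comp fun _ _ h _ _ h' => comp_congr h h'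
  id_comp := by
    rintro X Y ⟨D⟩
    exact cls_eq (id_comp D)
  comp_id := by
    rintro X Y ⟨D⟩
    exact cls_eq (comp_id D)
  assoc := by
    rintro X Y Z T ⟨D⟩ ⟨E⟩ ⟨F⟩
    exact cls_eq (comp_assoc D E F)

/-- The morphism represented by a diagram. -/
def mk {X Y : FreeGS S} (D : Diagram S X.word Y.word) : X ⟶ Y := Quotient.mk _ D

theorem mk_surj {X Y : FreeGS S} (f : X ⟶ Y) : ∃ D, mk D = f := Quotient.exists_rep f

theorem mk_eq {X Y : FreeGS S} {D E : Diagram S X.word Y.word} (h : Iso D E) : mk D = mk E :=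
  Quotient.sound h

theorem mk_comp {X Y Z : FreeGS S} (D : Diagram S X.word Y.word) (E : Diagram S Y.word Z.word) :
    mk D ≫ mk E = mk (D.comp E) := rfl

theorem id_eq (X : FreeGS S) : 𝟙 X = mk (idDiagram X.word) := rfl

/-- Concatenation of words. -/
@[reducible]
def tensorObj (X Y : FreeGS S) : FreeGS S := ofWord (X.word ++ Y.word)

/-- Juxtaposition. -/
def tensorHom {X Y X' Y' : FreeGS S} (f : X ⟶ Y) (g : X' ⟶ Y') :
    tensorObj X X' ⟶ tensorObj Y Y' :=
  Quotient.map₂ Diagram.tensor (fun _ _ h _ _ h' => tensor_congr h h') f g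

theorem mk_tensor {X Y X' Y' : FreeGS S} (D : Diagram S X.word Y.word)
    (E : Diagram S X'.word Y'.word) : tensorHom (mk D) (mk E) =
      mk (X := tensorObj X X') (Y := tensorObj Y Y') (D.tensor E) := rfl

theorem tensor_comp {X Y Z X' Y' Z' : List S.W} (D : Diagram S X Y) (E : Diagram S Y Z)
    (D' : Diagram S X' Y') (E' : Diagram S Y' Z') :
    Iso ((D.tensor D').comp (E.tensor E')) ((D.comp E).tensor (D'.comp E')) := by
  let i1 : D.apex.Hom ((D.comp E).tensor (D'.comp E')).apex :=
    Hom.comp (pinlHom D.outs E.ins) sinlHom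
  let i2 : E.apex.Hom ((D.comp E).tensor (D'.comp E')).apex :=
    Hom.comp (pinrHom D.outs E.ins) sinlHom
  let i3 : D'.apex.Hom ((D.comp E).tensor (D'.comp E')).apex :=
    Hom.comp (pinlHom D'.outs E'.ins) sinrHom
  let i4 : E'.apex.Hom ((D.comp E).tensor (D'.comp E')).apex :=
    Hom.comp (pinrHom D'.outs E'.ins) sinrHom
  refine comp_iso (sumDesc i1 i3) (sumDesc i2 i4) (sum_hom_ext rfl rfl) (sum_hom_ext rfl rfl)
    ?_ ?_ ?_ ?_
  · exact (map_append_map _ sinl sinr D.ins D'.ins).trans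
      (map_map_append sinl (pinl D.outs E.ins) sinr (pinl D'.outs E'.ins) _ _).symm
  · refine (map_append_map _ sinl sinr D.outs D'.outs).trans
      (Eq.trans ?_ (map_append_map _ sinl sinr E.ins E'.ins).symm)
    have h1 := congrArg (List.map (sinl (H := (D'.comp E').apex)))
      (map_pinl_eq (match_length D E))
    have h2 := congrArg (List.map (sinr (G := (D.comp E).apex)))
      (map_pinl_eq (match_length D' E'))
    exact congrArg₂ _ ((map_map' sinl (pinl D.outs E.ins) _).symm.trans (h1.trans (map_map' _ _ _)))
      ((map_map' sinr (pinl D'.outs E'.ins) _).symm.trans (h2.trans (map_map' _ _ _)))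
  · exact (map_append_map _ sinl sinr E.outs E'.outs).trans
      (map_map_append sinl (pinr D.outs E.ins) sinr (pinr D'.outs E'.ins) _ _).symm
  · intro k l
    refine bij_of_eq (Equiv.sumSumSumComm (D.apex.B k l) (D'.apex.B k l) (E.apex.B k l)
      (E'.apex.B k l)) fun x => ?_
    obtain (x | x) | (x | x) := x <;> rfl

/-- Changing the words at the ends of a diagram along equalities. -/
def recast {X Y X' Y' : List S.W} (hX : X = X') (hY : Y = Y') (D : Diagram S X Y) :
    Diagram S X' Y' :=
  { D with ins_label := D.ins_label.trans hX, outs_label := D.outs_label.trans hY }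

theorem mk_eqToHom {X Y Y' : FreeGS S} (h : Y = Y') (D : Diagram S X.word Y.word) :
    mk D ≫ eqToHom h = mk (recast rfl (congrArg word h) D) := by
  subst h
  rw [eqToHom_refl, Category.comp_id]
  rfl

theorem eqToHom_mk {X X' Y : FreeGS S} (h : X' = X) (D : Diagram S X.word Y.word) :
    eqToHom h ≫ mk D = mk (recast (congrArg word h.symm) rfl D) := by
  subst h
  rw [eqToHom_refl, Category.id_comp]
  rfl


/-! ### The gs-monoidal structure -/

/-- Diagrams without boxes. -/
def NoBox {X Y : List S.W} (D : Diagram S X Y) : Prop := ∀ k l, IsEmpty (D.apex.B k l)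

theorem wiring_noBox {A : Type} [Finite A] {lab : A → S.W} {a b : List A}
    {ha : a.Nodup ∧ ∀ x, x ∈ a} {X Y : List S.W} {hX : a.map lab = X} {hY : b.map lab = Y} :
    NoBox (wiring lab a b ha hX hY) := fun _ _ => inferInstanceAs (IsEmpty PEmpty)

theorem id_noBox (X : List S.W) : NoBox (idDiagram X) := wiring_noBox

theorem swap_noBox (X Y : List S.W) : NoBox (swapDiagram X Y) := wiring_noBox

theorem copy_noBox (X : List S.W) : NoBox (copyDiagram X) := wiring_noBox

theorem del_noBox (X : List S.W) : NoBox (delDiagram X) := wiring_noBox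

theorem NoBox.recast {X Y X' Y' : List S.W} {D : Diagram S X Y} (h : NoBox D) (hX : X = X')
    (hY : Y = Y') : NoBox (recast hX hY D) := h

theorem NoBox.tensor {X Y X' Y' : List S.W} {D : Diagram S X Y} {E : Diagram S X' Y'}
    (hD : NoBox D) (hE : NoBox E) : NoBox (D.tensor E) := fun k l =>
  have := hD k l
  have := hE k l
  inferInstanceAs (IsEmpty (_ ⊕ _))

/-- A map of wires out of a hypergraph without boxes. -/
def emptyHom {G : Hyp.{0, 0}} {K : Hyp.{u₁, v₁}} (hG : ∀ k l, IsEmpty (G.B k l)) (g : G.W → K.W) :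
    G.Hom K :=
  ⟨g, fun {k l} b => (hG k l).elim b, fun {k l} b => (hG k l).elim b,
    fun {k l} b => (hG k l).elim b⟩

theorem emptyHom_ext {G : Hyp.{0, 0}} {K : Hyp.{u₁, v₁}} (hG : ∀ k l, IsEmpty (G.B k l))
    {f g : G.Hom K} (h : ∀ w, f.wire w = g.wire w) : f = g := by
  apply Hom.ext
  · exact funext h
  · funext k l b
    exact (hG k l).elim b

theorem iso_of_noBox {X Y : List S.W} {D E : Diagram S X Y} (hD : NoBox D) (hE : NoBox E)
    (g : D.apex.W → E.apex.W) (hg : ∀ w, E.label.wire (g w) = D.label.wire w)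
    (hi : D.ins.map g = E.ins) (ho : D.outs.map g = E.outs) : Iso D E :=
  Iso.mk' (emptyHom hD g) (fun k l => ⟨fun x => (hD k l).elim x, fun x => (hE k l).elim x⟩)
    (emptyHom_ext hD hg) hi ho

theorem comp_of_noBox {X Y Z : List S.W} {D : Diagram S X Y} {E : Diagram S Y Z}
    {F : Diagram S X Z} (hD : NoBox D) (hE : NoBox E) (hF : NoBox F)
    (a : D.apex.W → F.apex.W) (b : E.apex.W → F.apex.W)
    (ha : ∀ w, F.label.wire (a w) = D.label.wire w) (hb : ∀ w, F.label.wire (b w) = E.label.wire w)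
    (h1 : D.ins.map a = F.ins) (h2 : D.outs.map a = E.ins.map b) (h3 : E.outs.map b = F.outs) :
    Iso (D.comp E) F :=
  comp_iso (emptyHom hD a) (emptyHom hE b) (emptyHom_ext hD ha) (emptyHom_ext hE hb) h1 h2 h3
    fun k l => ⟨fun x => x.elim (hD k l).elim (hE k l).elim, fun x => (hF k l).elim x⟩

/-- The identity diagram is the only one without boxes whose inputs agree with the outputs. -/
theorem id_iso {X : List S.W} {D : Diagram S X X} (hD : NoBox D) (h : D.ins = D.outs) :
    Iso (idDiagram X) D := by
  obtain ⟨g, hg, hg'⟩ := exists_index D.ins_label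
  exact iso_of_noBox wiring_noBox hD g hg' hg (hg.trans h)

theorem id_tensor_id (X Y : FreeGS S) :
    tensorHom (𝟙 X) (𝟙 Y) = 𝟙 (tensorObj X Y) := by
  rw [id_eq, id_eq, id_eq, mk_tensor]
  exact (mk_eq (id_iso (wiring_noBox.tensor wiring_noBox) rfl)).symm

theorem tensorHom_comp {X Y Z X' Y' Z' : FreeGS S} (f : X ⟶ Y) (f' : X' ⟶ Y') (g : Y ⟶ Z)
    (g' : Y' ⟶ Z') :
    tensorHom f f' ≫ tensorHom g g' = tensorHom (f ≫ g) (f' ≫ g') := by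
  obtain ⟨D, rfl⟩ := mk_surj f
  obtain ⟨D', rfl⟩ := mk_surj f'
  obtain ⟨E, rfl⟩ := mk_surj g
  obtain ⟨E', rfl⟩ := mk_surj g'
  exact mk_eq (tensor_comp D E D' E')

theorem eqToHom_tensor {X X' Y Y' : FreeGS S} (h : X = X') (h' : Y = Y') :
    tensorHom (eqToHom h) (eqToHom h') = eqToHom (by rw [h, h']) := by
  subst h
  subst h'
  exact id_tensor_id X Y

theorem eqToHom_tensor_id {X X' : FreeGS S} (h : X = X') (Y : FreeGS S) :
    tensorHom (eqToHom h) (𝟙 Y) = eqToHom (by rw [h]) := eqToHom_tensor h rfl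

theorem id_tensor_eqToHom {X X' : FreeGS S} (h : X = X') (Y : FreeGS S) :
    tensorHom (𝟙 Y) (eqToHom h) = eqToHom (by rw [h]) := eqToHom_tensor rfl h

theorem tensorObj_assoc (X Y Z : FreeGS S) :
    tensorObj (tensorObj X Y) Z = tensorObj X (tensorObj Y Z) :=
  FreeGS.ext (List.append_assoc _ _ _)

theorem tensorObj_nil (X : FreeGS S) : tensorObj X (ofWord []) = X := FreeGS.ext (List.append_nil _)

theorem nil_tensorObj (X : FreeGS S) : tensorObj (ofWord []) X = X := FreeGS.ext (List.nil_append _)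

theorem assoc_naturality {X₁ X₂ X₃ Y₁ Y₂ Y₃ : FreeGS S} (f₁ : X₁ ⟶ Y₁) (f₂ : X₂ ⟶ Y₂)
    (f₃ : X₃ ⟶ Y₃) :
    tensorHom (tensorHom f₁ f₂) f₃ ≫ eqToHom (tensorObj_assoc Y₁ Y₂ Y₃) =
      eqToHom (tensorObj_assoc X₁ X₂ X₃) ≫ tensorHom f₁ (tensorHom f₂ f₃) := by
  obtain ⟨D, rfl⟩ := mk_surj f₁
  obtain ⟨E, rfl⟩ := mk_surj f₂
  obtain ⟨F, rfl⟩ := mk_surj f₃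
  rw [mk_tensor, mk_tensor, mk_tensor, mk_tensor, mk_eqToHom, eqToHom_mk]
  apply mk_eq
  refine Iso.mk' (sumDesc (sumDesc sinlHom (sinlHom.comp sinrHom)) (sinrHom.comp sinrHom))
    ?_ ?_ ?_ ?_
  · intro k l
    refine bij_of_eq (Equiv.sumAssoc (D.apex.B k l) (E.apex.B k l) (F.apex.B k l)) fun x => ?_
    obtain (x | x) | x := x <;> rfl
  · exact sum_hom_ext (sum_hom_ext rfl rfl) rfl
  · simp [recast, Diagram.tensor, sumDesc, sinlHom, sinrHom, Hom.comp, Function.comp_def]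
  · simp [recast, Diagram.tensor, sumDesc, sinlHom, sinrHom, Hom.comp, Function.comp_def]

theorem left_naturality {X Y : FreeGS S} (f : X ⟶ Y) :
    tensorHom (𝟙 (ofWord [])) f ≫ eqToHom (nil_tensorObj Y) = eqToHom (nil_tensorObj X) ≫ f := by
  obtain ⟨D, rfl⟩ := mk_surj f
  rw [id_eq, mk_tensor, mk_eqToHom, eqToHom_mk]
  apply mk_eq
  refine Iso.mk' (sumDesc (discHom (fun i => i.elim0)) (Hom.id _)) ?_ ?_ ?_ ?_
  · intro k l
    constructor
    · rintro (x | x) (y | y) h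
      · exact x.elim
      · exact x.elim
      · exact y.elim
      · exact congrArg _ h
    · exact fun x => ⟨Sum.inr x, rfl⟩
  · refine sum_hom_ext (emptyHom_ext (fun _ _ => inferInstanceAs (IsEmpty PEmpty)) ?_) rfl
    exact fun i => i.elim0
  · simp [recast, Diagram.tensor, sumDesc, idDiagram, wiring, Hom.id, Function.comp_def]
  · simp [recast, Diagram.tensor, sumDesc, idDiagram, wiring, Hom.id, Function.comp_def]

theorem right_naturality {X Y : FreeGS S} (f : X ⟶ Y) :
    tensorHom f (𝟙 (ofWord [])) ≫ eqToHom (tensorObj_nil Y) = eqToHom (tensorObj_nil X) ≫ f := by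
  obtain ⟨D, rfl⟩ := mk_surj f
  rw [id_eq, mk_tensor, mk_eqToHom, eqToHom_mk]
  apply mk_eq
  refine Iso.mk' (sumDesc (Hom.id _) (discHom (fun i => i.elim0))) ?_ ?_ ?_ ?_
  · intro k l
    constructor
    · rintro (x | x) (y | y) h
      · exact congrArg _ h
      · exact y.elim
      · exact x.elim
      · exact x.elim
    · exact fun x => ⟨Sum.inl x, rfl⟩
  · refine sum_hom_ext rfl (emptyHom_ext (fun _ _ => inferInstanceAs (IsEmpty PEmpty)) ?_)
    exact fun i => i.elim0
  · simp [recast, Diagram.tensor, sumDesc, idDiagram, wiring, Hom.id, Function.comp_def]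
  · simp [recast, Diagram.tensor, sumDesc, idDiagram, wiring, Hom.id, Function.comp_def]

theorem pentagon_eq (W X Y Z : FreeGS S) :
    tensorHom (eqToHom (tensorObj_assoc W X Y)) (𝟙 Z) ≫
        eqToHom (tensorObj_assoc W (tensorObj X Y) Z) ≫
          tensorHom (𝟙 W) (eqToHom (tensorObj_assoc X Y Z)) =
      eqToHom (tensorObj_assoc (tensorObj W X) Y Z) ≫
        eqToHom (tensorObj_assoc W X (tensorObj Y Z)) := by
  rw [eqToHom_tensor_id, id_tensor_eqToHom, eqToHom_trans, eqToHom_trans, eqToHom_trans]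

theorem triangle_eq (X Y : FreeGS S) :
    eqToHom (tensorObj_assoc X (ofWord []) Y) ≫ tensorHom (𝟙 X) (eqToHom (nil_tensorObj Y)) =
      tensorHom (eqToHom (tensorObj_nil X)) (𝟙 Y) := by
  rw [eqToHom_tensor_id, id_tensor_eqToHom, eqToHom_trans]

instance monoidalStruct : MonoidalCategoryStruct (FreeGS S) where
  tensorObj := tensorObj
  tensorHom := tensorHom
  whiskerLeft X _ _ f := tensorHom (𝟙 X) f
  whiskerRight f Y := tensorHom f (𝟙 Y)
  tensorUnit := ofWord []
  associator X Y Z := eqToIso (tensorObj_assoc X Y Z)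
  leftUnitor X := eqToIso (nil_tensorObj X)
  rightUnitor X := eqToIso (tensorObj_nil X)

/-- The strict monoidal structure: concatenation of words and juxtaposition of diagrams. -/
instance monoidal : MonoidalCategory (FreeGS S) :=
  MonoidalCategory.ofTensorHom
    (id_tensorHom_id := id_tensor_id)
    (id_tensorHom := fun _ _ _ _ => rfl)
    (tensorHom_id := fun _ _ => rfl)
    (tensorHom_comp_tensorHom := fun f f' g g' => tensorHom_comp f f' g g')
    (associator_naturality := fun f g h => assoc_naturality f g h)
    (leftUnitor_naturality := fun f => left_naturality f)
    (rightUnitor_naturality := fun f => right_naturality f)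
    (pentagon := fun W X Y Z => pentagon_eq W X Y Z)
    (triangle := fun X Y => triangle_eq X Y)

/-- Changing the right leg of a diagram. -/
@[reducible]
def withOuts {X Y Z : List S.W} (D : Diagram S X Y) (o : List D.apex.W)
    (h : o.map D.label.wire = Z) : Diagram S X Z :=
  { D with outs := o, outs_label := h }

theorem swap_naturality {X Y X' Y' : List S.W} (D : Diagram S X Y) (E : Diagram S X' Y') :
    ∃ F : Diagram S (X ++ X') (Y' ++ Y), Iso ((D.tensor E).comp (swapDiagram Y Y')) F ∧
      Iso ((swapDiagram X X').comp (E.tensor D)) F := by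
  let F : Diagram S (X ++ X') (Y' ++ Y) :=
    withOuts (D.tensor E) (E.outs.map sinr ++ D.outs.map sinl) (by
      exact (map_append_map _ _ _ _ _).trans (congrArg₂ _ E.outs_label D.outs_label))
  refine ⟨F, ?_, ?_⟩
  · obtain ⟨g, hg, hg'⟩ := exists_index D.outs_label
    obtain ⟨g', hh, hh'⟩ := exists_index E.outs_label
    refine comp_wiring (F := F) (Hom.id _) (Sum.map g g') ?_ rfl (List.map_id _) ?_ ?_
      fun _ _ => Function.bijective_id
    · rintro (i | i)
      · exact hg' i
      · exact hh' i
    · simp [Diagram.tensor, Hom.id, ← hg, ← hh, Function.comp_def]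
    · simp [F, withOuts, Diagram.tensor, ← hg, ← hh, Function.comp_def]
  · obtain ⟨g, hg, hg'⟩ := exists_index D.ins_label
    obtain ⟨g', hh, hh'⟩ := exists_index E.ins_label
    refine wiring_comp (F := F) (sumDesc sinrHom sinlHom) (Sum.map g g') ?_
      (sum_hom_ext rfl rfl) ?_ ?_ ?_ ?_
    · rintro (i | i)
      · exact hg' i
      · exact hh' i
    · simp [F, withOuts, Diagram.tensor, ← hg, ← hh, Function.comp_def]
    · simp [Diagram.tensor, ← hg, ← hh, Function.comp_def, sumDesc, sinlHom, sinrHom]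
    · simp [F, withOuts, Diagram.tensor, Function.comp_def, sumDesc, sinlHom, sinrHom]
    · intro k l
      refine bij_of_eq (Equiv.sumComm (E.apex.B k l) (D.apex.B k l)) fun x => ?_
      obtain x | x := x <;> rfl

theorem swap_swap (X Y : List S.W) :
    Iso ((swapDiagram X Y).comp (swapDiagram Y X)) (idDiagram (X ++ Y)) := by
  let F : Diagram S (X ++ Y) (X ++ Y) := withOuts (swapDiagram X Y) (swapDiagram X Y).ins
    (swapDiagram X Y).ins_label
  have hF : NoBox F := fun _ _ => inferInstanceAs (IsEmpty PEmpty)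
  refine Iso.trans (E := F) ?_ (id_iso hF rfl).symm
  refine comp_of_noBox wiring_noBox wiring_noBox hF id Sum.swap ?_ ?_ ?_ ?_ ?_
  · exact fun _ => rfl
  · rintro (i | i) <;> rfl
  · exact List.map_id _
  · exact (List.map_id _).trans (map_append_map Sum.swap Sum.inl Sum.inr _ _).symm
  · simp [F, swapDiagram, wiring, Function.comp_def, withOuts]

/-- The swap morphism. -/
def swap (X Y : FreeGS S) : X ⊗ Y ⟶ Y ⊗ X :=
  mk (X := tensorObj X Y) (Y := tensorObj Y X) (swapDiagram X.word Y.word)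

theorem swap_nat {X Y X' Y' : FreeGS S} (f : X ⟶ Y) (g : X' ⟶ Y') :
    (f ⊗ₘ g) ≫ swap Y Y' = swap X X' ≫ (g ⊗ₘ f) := by
  obtain ⟨D, rfl⟩ := mk_surj f
  obtain ⟨E, rfl⟩ := mk_surj g
  obtain ⟨F, h1, h2⟩ := swap_naturality D E
  exact (mk_eq (X := tensorObj X X') (Y := tensorObj Y' Y) h1).trans
    (mk_eq (X := tensorObj X X') (Y := tensorObj Y' Y) h2).symm

theorem map_three {A B C W : Type*} (f : (A ⊕ B) ⊕ C → W) (a : List A) (b : List B) (c : List C) :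
    ((a.map Sum.inl ++ b.map Sum.inr).map Sum.inl ++ c.map Sum.inr).map f =
      a.map (fun x => f (Sum.inl (Sum.inl x))) ++ b.map (fun x => f (Sum.inl (Sum.inr x))) ++
        c.map (fun x => f (Sum.inr x)) := by
  simp [Function.comp_def]

theorem map_three' {A B C W : Type*} (f : A ⊕ (B ⊕ C) → W) (a : List A) (b : List B)
    (c : List C) :
    (a.map Sum.inl ++ (b.map Sum.inl ++ c.map Sum.inr).map Sum.inr).map f =
      a.map (fun x => f (Sum.inl x)) ++ (b.map (fun x => f (Sum.inr (Sum.inl x))) ++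
        c.map (fun x => f (Sum.inr (Sum.inr x)))) := by
  simp [Function.comp_def]

theorem map_three_swap {A B C W : Type*} (f : (A ⊕ B) ⊕ C → W) (a : List A) (b : List B)
    (c : List C) :
    ((b.map Sum.inr ++ a.map Sum.inl).map Sum.inl ++ c.map Sum.inr).map f =
      b.map (fun x => f (Sum.inl (Sum.inr x))) ++ a.map (fun x => f (Sum.inl (Sum.inl x))) ++
        c.map (fun x => f (Sum.inr x)) := by
  simp [Function.comp_def]

theorem map_three_swap' {A B C W : Type*} (f : A ⊕ (B ⊕ C) → W) (a : List A) (b : List B)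
    (c : List C) :
    (a.map Sum.inl ++ (c.map Sum.inr ++ b.map Sum.inl).map Sum.inr).map f =
      a.map (fun x => f (Sum.inl x)) ++ (c.map (fun x => f (Sum.inr (Sum.inr x))) ++
        b.map (fun x => f (Sum.inr (Sum.inl x)))) := by
  simp [Function.comp_def]

/-- The wires of three words in parallel. -/
abbrev threeIns (X Y Z : List S.W) : List ((Fin X.length ⊕ Fin Y.length) ⊕ Fin Z.length) :=
  ((List.finRange X.length).map Sum.inl ++ (List.finRange Y.length).map Sum.inr).map Sum.inl ++
    (List.finRange Z.length).map Sum.inr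

/-- A diagram without boxes whose wires are those of three words in parallel. -/
def threeDiagram (X Y Z : List S.W) {P Q : List S.W}
    (b : List ((Fin X.length ⊕ Fin Y.length) ⊕ Fin Z.length))
    (hP : X ++ Y ++ Z = P) (hQ : b.map (Sum.elim (Sum.elim X.get Y.get) Z.get) = Q) :
    Diagram S P Q :=
  wiring (Sum.elim (Sum.elim X.get Y.get) Z.get) (threeIns X Y Z) b
    (by
      constructor
      · refine List.Nodup.append (List.Nodup.map Sum.inl_injective (List.Nodup.append
          ((finRange_spec _).1.map Sum.inl_injective) ((finRange_spec _).1.map Sum.inr_injective)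
            ?_)) ((finRange_spec _).1.map Sum.inr_injective) ?_
        · intro w h h'
          obtain ⟨a, -, rfl⟩ := List.mem_map.1 h
          obtain ⟨b, -, h⟩ := List.mem_map.1 h'
          exact Sum.inr_ne_inl h
        · intro w h h'
          obtain ⟨a, -, rfl⟩ := List.mem_map.1 h
          obtain ⟨b, -, h⟩ := List.mem_map.1 h'
          exact Sum.inr_ne_inl h
      · rintro ((x | x) | x) <;> simp)
    ((map_three _ _ _ _).trans (by
      simp only [Sum.elim_inl, Sum.elim_inr]
      rw [← hP]
      exact congrArg₂ _ (congrArg₂ _ (map_finRange_get X) (map_finRange_get Y))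
        (map_finRange_get Z)))
    hQ

theorem hexagon_forward_diagram (X Y Z : List S.W) (h1 : X ++ (Y ++ Z) = X ++ Y ++ Z)
    (h2 : Y ++ Z ++ X = Y ++ (Z ++ X)) (h3 : Y ++ (X ++ Z) = Y ++ X ++ Z) :
    ∃ F : Diagram S (X ++ Y ++ Z) (Y ++ (Z ++ X)),
      Iso (recast h1 h2 (swapDiagram X (Y ++ Z))) F ∧
      Iso (((swapDiagram X Y).tensor (idDiagram Z)).comp
        (recast h3 rfl ((idDiagram Y).tensor (swapDiagram X Z)))) F := by
  let pX : Fin X.length → (Fin X.length ⊕ Fin Y.length) ⊕ Fin Z.length := fun i => .inl (.inl i)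
  let pY : Fin Y.length → (Fin X.length ⊕ Fin Y.length) ⊕ Fin Z.length := fun i => .inl (.inr i)
  let pZ : Fin Z.length → (Fin X.length ⊕ Fin Y.length) ⊕ Fin Z.length := fun i => .inr i
  let F : Diagram S (X ++ Y ++ Z) (Y ++ (Z ++ X)) := threeDiagram X Y Z
    ((List.finRange Y.length).map pY ++ ((List.finRange Z.length).map pZ ++
      (List.finRange X.length).map pX)) rfl (by
        rw [List.map_append, List.map_append, List.map_map, List.map_map, List.map_map]
        exact congrArg₂ _ (map_finRange_get Y)
          (congrArg₂ _ (map_finRange_get Z) (map_finRange_get X)))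
  refine ⟨F, ?_, ?_⟩
  · have hl : ((List.finRange Y.length).map pY ++ (List.finRange Z.length).map pZ).map
        (Sum.elim (Sum.elim X.get Y.get) Z.get) = Y ++ Z := by
      rw [List.map_append, List.map_map, List.map_map]
      exact congrArg₂ _ (map_finRange_get Y) (map_finRange_get Z)
    obtain ⟨g, hg, hg'⟩ := exists_index hl
    refine iso_of_noBox ((swap_noBox _ _).recast _ _) wiring_noBox (Sum.elim pX g) ?_ ?_ ?_
    · rintro (i | i)
      · rfl
      · exact hg' i
    · refine (map_append_map _ Sum.inl Sum.inr _ _).trans ?_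
      refine Eq.trans ?_ ((List.map_id _).symm.trans (map_three id _ _ _)).symm
      exact (congrArg _ hg).trans (List.append_assoc _ _ _).symm
    · refine (map_append_map _ Sum.inr Sum.inl _ _).trans ?_
      exact (congrArg (· ++ (List.finRange X.length).map pX) hg).trans (List.append_assoc _ _ _)
  · refine comp_of_noBox (wiring_noBox.tensor wiring_noBox)
      (NoBox.tensor (D := idDiagram Y) (E := swapDiagram X Z) wiring_noBox wiring_noBox)
      wiring_noBox (Sum.elim (Sum.elim pX pY) pZ) (Sum.elim pY (Sum.elim pX pZ)) ?_ ?_ ?_ ?_ ?_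
    · rintro ((i | i) | i) <;> rfl
    · rintro (i | (i | i)) <;> rfl
    · exact (map_three _ _ _ _).trans ((List.map_id _).symm.trans (map_three id _ _ _)).symm
    · exact (map_three_swap _ _ _ _).trans ((List.append_assoc _ _ _).trans
        (map_three' (Sum.elim pY (Sum.elim pX pZ)) _ _ _).symm)
    · exact map_three_swap' _ _ _ _

theorem hexagon_reverse_diagram (X Y Z : List S.W) (h1 : X ++ Y ++ Z = X ++ (Y ++ Z))
    (h2 : Z ++ (X ++ Y) = Z ++ X ++ Y) (h3 : X ++ Z ++ Y = X ++ (Z ++ Y)) :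
    ∃ F : Diagram S (X ++ (Y ++ Z)) (Z ++ X ++ Y),
      Iso (recast h1 h2 (swapDiagram (X ++ Y) Z)) F ∧
      Iso (((idDiagram X).tensor (swapDiagram Y Z)).comp
        (recast h3 rfl ((swapDiagram X Z).tensor (idDiagram Y)))) F := by
  let pX : Fin X.length → (Fin X.length ⊕ Fin Y.length) ⊕ Fin Z.length := fun i => .inl (.inl i)
  let pY : Fin Y.length → (Fin X.length ⊕ Fin Y.length) ⊕ Fin Z.length := fun i => .inl (.inr i)
  let pZ : Fin Z.length → (Fin X.length ⊕ Fin Y.length) ⊕ Fin Z.length := fun i => .inr i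
  let F : Diagram S (X ++ (Y ++ Z)) (Z ++ X ++ Y) := threeDiagram X Y Z
    ((List.finRange Z.length).map pZ ++ (List.finRange X.length).map pX ++
      (List.finRange Y.length).map pY) h1 (by
        rw [List.map_append, List.map_append, List.map_map, List.map_map, List.map_map]
        exact congrArg₂ _ (congrArg₂ _ (map_finRange_get Z) (map_finRange_get X))
          (map_finRange_get Y))
  refine ⟨F, ?_, ?_⟩
  · have hl : ((List.finRange X.length).map pX ++ (List.finRange Y.length).map pY).map
        (Sum.elim (Sum.elim X.get Y.get) Z.get) = X ++ Y := by
      rw [List.map_append, List.map_map, List.map_map]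
      exact congrArg₂ _ (map_finRange_get X) (map_finRange_get Y)
    obtain ⟨g, hg, hg'⟩ := exists_index hl
    refine iso_of_noBox ((swap_noBox _ _).recast _ _) wiring_noBox (Sum.elim g pZ) ?_ ?_ ?_
    · rintro (i | i)
      · exact hg' i
      · rfl
    · refine (map_append_map _ Sum.inl Sum.inr _ _).trans ?_
      refine Eq.trans ?_ ((List.map_id _).symm.trans (map_three id _ _ _)).symm
      exact congrArg (· ++ (List.finRange Z.length).map pZ) hg
    · refine (map_append_map _ Sum.inr Sum.inl _ _).trans ?_
      exact (congrArg _ hg).trans (List.append_assoc _ _ _).symm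
  · refine comp_of_noBox
      (NoBox.tensor (D := idDiagram X) (E := swapDiagram Y Z) wiring_noBox wiring_noBox)
      (NoBox.tensor (D := swapDiagram X Z) (E := idDiagram Y) wiring_noBox wiring_noBox)
      wiring_noBox (Sum.elim pX (Sum.elim pY pZ)) (Sum.elim (Sum.elim pX pZ) pY) ?_ ?_ ?_ ?_ ?_
    · rintro (i | (i | i)) <;> rfl
    · rintro ((i | i) | i) <;> rfl
    · exact (map_three' _ _ _ _).trans ((List.append_assoc _ _ _).symm.trans
        ((List.map_id _).symm.trans (map_three id _ _ _)).symm)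
    · exact (map_three_swap' _ _ _ _).trans ((List.append_assoc _ _ _).symm.trans
        (map_three (Sum.elim (Sum.elim pX pZ) pY) _ _ _).symm)
    · exact map_three_swap _ _ _ _

/-- The braiding as an isomorphism. -/
def braid (X Y : FreeGS S) : X ⊗ Y ≅ Y ⊗ X where
  hom := swap X Y
  inv := swap Y X
  hom_inv_id := mk_eq (X := tensorObj X Y) (Y := tensorObj X Y) (swap_swap _ _)
  inv_hom_id := mk_eq (X := tensorObj Y X) (Y := tensorObj Y X) (swap_swap _ _)

theorem hexagon_forward_eq (X Y Z : FreeGS S) :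
    eqToHom (tensorObj_assoc X Y Z) ≫ swap X (tensorObj Y Z) ≫ eqToHom (tensorObj_assoc Y Z X) =
      tensorHom (swap X Y) (𝟙 Z) ≫ eqToHom (tensorObj_assoc Y X Z) ≫
        tensorHom (𝟙 Y) (swap X Z) := by
  obtain ⟨F, h1, h2⟩ := hexagon_forward_diagram X.word Y.word Z.word
    (List.append_assoc _ _ _).symm (List.append_assoc _ _ _) (List.append_assoc _ _ _).symm
  unfold swap
  rw [id_eq, id_eq, mk_tensor, mk_tensor]
  erw [mk_eqToHom, eqToHom_mk, eqToHom_mk, mk_comp]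
  exact (mk_eq (X := tensorObj (tensorObj X Y) Z) (Y := tensorObj Y (tensorObj Z X)) h1).trans
    (mk_eq (X := tensorObj (tensorObj X Y) Z) (Y := tensorObj Y (tensorObj Z X)) h2).symm

theorem hexagon_reverse_eq (X Y Z : FreeGS S) :
    eqToHom (tensorObj_assoc X Y Z).symm ≫ swap (tensorObj X Y) Z ≫
        eqToHom (tensorObj_assoc Z X Y).symm =
      tensorHom (𝟙 X) (swap Y Z) ≫ eqToHom (tensorObj_assoc X Z Y).symm ≫
        tensorHom (swap X Z) (𝟙 Y) := by
  obtain ⟨F, h1, h2⟩ := hexagon_reverse_diagram X.word Y.word Z.word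
    (List.append_assoc _ _ _) (List.append_assoc _ _ _).symm (List.append_assoc _ _ _)
  unfold swap
  rw [id_eq, id_eq, mk_tensor, mk_tensor]
  erw [mk_eqToHom, eqToHom_mk, eqToHom_mk, mk_comp]
  exact (mk_eq (X := tensorObj X (tensorObj Y Z)) (Y := tensorObj (tensorObj Z X) Y) h1).trans
    (mk_eq (X := tensorObj X (tensorObj Y Z)) (Y := tensorObj (tensorObj Z X) Y) h2).symm

/-- The strict symmetric monoidal structure. -/
instance symmetric : SymmetricCategory (FreeGS S) where
  braiding := braid
  braiding_naturality_right X _ _ f := swap_nat (𝟙 X) f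
  braiding_naturality_left f Z := swap_nat f (𝟙 Z)
  hexagon_forward := hexagon_forward_eq
  hexagon_reverse := hexagon_reverse_eq
  symmetry X Y := (braid X Y).hom_inv_id

/-- The copy morphism. -/
def copy (X : FreeGS S) : X ⟶ tensorObj X X := mk (copyDiagram X.word)

/-- The discard morphism. -/
def del (X : FreeGS S) : X ⟶ ofWord [] := mk (delDiagram X.word)

theorem eqToHom_eq_mk {X Y : FreeGS S} (h : X = Y) :
    eqToHom h = mk (recast rfl (congrArg word h) (idDiagram X.word)) := by
  subst h
  rfl

theorem copy_del_left (X : FreeGS S) :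
    copy X ≫ tensorHom (del X) (𝟙 X) = eqToHom (nil_tensorObj X).symm := by
  unfold copy del
  rw [id_eq, mk_tensor, eqToHom_eq_mk, mk_comp]
  apply mk_eq
  refine comp_of_noBox (copy_noBox _) ((del_noBox _).tensor (id_noBox _))
    ((id_noBox _).recast _ _) id (Sum.elim id id) (fun _ => rfl) ?_ (List.map_id _) ?_ ?_
  · rintro (i | i) <;> rfl
  · refine (List.map_id _).trans
      (Eq.trans ?_ (map_append_map (Sum.elim id id) Sum.inl Sum.inr _ _).symm)
    exact (congrArg₂ _ (List.map_id _) (List.map_id _)).symm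
  · refine (map_append_map (Sum.elim id id) Sum.inl Sum.inr [] _).trans ?_
    exact List.map_id _

theorem copy_del_right (X : FreeGS S) :
    copy X ≫ tensorHom (𝟙 X) (del X) = eqToHom (tensorObj_nil X).symm := by
  unfold copy del
  rw [id_eq, mk_tensor, eqToHom_eq_mk, mk_comp]
  apply mk_eq
  refine comp_of_noBox (copy_noBox _) ((id_noBox _).tensor (del_noBox _))
    ((id_noBox _).recast _ _) id (Sum.elim id id) (fun _ => rfl) ?_ (List.map_id _) ?_ ?_
  · rintro (i | i) <;> rfl
  · refine (List.map_id _).trans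
      (Eq.trans ?_ (map_append_map (Sum.elim id id) Sum.inl Sum.inr _ _).symm)
    exact (congrArg₂ _ (List.map_id _) (List.map_id _)).symm
  · refine (map_append_map (Sum.elim id id) Sum.inl Sum.inr _ []).trans ?_
    exact (List.append_nil _).trans (List.map_id _)

/-- The diagram that makes three copies of a word. -/
def copyThree (X : List S.W) : Diagram S X (X ++ (X ++ X)) :=
  wiring X.get (List.finRange X.length)
    (List.finRange X.length ++ (List.finRange X.length ++ List.finRange X.length))
    (finRange_spec _) (map_finRange_get X)
    (by rw [List.map_append, List.map_append, map_finRange_get])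

theorem copy_assoc (X : FreeGS S) :
    copy X ≫ tensorHom (𝟙 X) (copy X) =
      copy X ≫ tensorHom (copy X) (𝟙 X) ≫ eqToHom (tensorObj_assoc X X X) := by
  unfold copy
  rw [id_eq, mk_tensor, mk_tensor, mk_eqToHom, mk_comp, mk_comp]
  trans mk (X := X) (Y := tensorObj X (tensorObj X X)) (copyThree X.word)
  · apply mk_eq
    refine comp_of_noBox (copy_noBox _) ((id_noBox _).tensor (copy_noBox _))
      wiring_noBox id (Sum.elim id id) (fun _ => rfl) ?_ (List.map_id _) ?_ ?_
    · rintro (i | i) <;> rfl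
    · refine (List.map_id _).trans
        (Eq.trans ?_ (map_append_map (Sum.elim id id) Sum.inl Sum.inr _ _).symm)
      exact (congrArg₂ _ (List.map_id _) (List.map_id _)).symm
    · refine (map_append_map (Sum.elim id id) Sum.inl Sum.inr _ _).trans ?_
      exact congrArg₂ _ (List.map_id _) (List.map_id _)
  · symm
    apply mk_eq
    refine comp_of_noBox (copy_noBox _) (((copy_noBox _).tensor (id_noBox _)).recast _ _)
      wiring_noBox id (Sum.elim id id) (fun _ => rfl) ?_ (List.map_id _) ?_ ?_
    · rintro (i | i) <;> rfl
    · refine (List.map_id _).trans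
        (Eq.trans ?_ (map_append_map (Sum.elim id id) Sum.inl Sum.inr _ _).symm)
      exact (congrArg₂ _ (List.map_id _) (List.map_id _)).symm
    · refine (map_append_map (Sum.elim id id) Sum.inl Sum.inr _ _).trans ?_
      exact (congrArg₂ _ (List.map_id _) (List.map_id _)).trans (List.append_assoc _ _ _)

theorem copy_swap (X : FreeGS S) : copy X ≫ swap X X = copy X := by
  refine mk_eq (X := X) (Y := tensorObj X X) ?_
  refine comp_of_noBox (copy_noBox _) (swap_noBox _ _) (copy_noBox _) id (Sum.elim id id)
    (fun _ => rfl) ?_ (List.map_id _) ?_ ?_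
  · rintro (i | i) <;> rfl
  · refine (List.map_id _).trans
      (Eq.trans ?_ (map_append_map (Sum.elim id id) Sum.inl Sum.inr _ _).symm)
    exact (congrArg₂ _ (List.map_id _) (List.map_id _)).symm
  · refine (map_append_map (Sum.elim id id) Sum.inr Sum.inl _ _).trans ?_
    exact congrArg₂ _ (List.map_id _) (List.map_id _)

instance comon (X : FreeGS S) : ComonObj X where
  counit := del X
  comul := copy X
  counit_comul := copy_del_left X
  comul_counit := copy_del_right X
  comul_assoc := copy_assoc X

theorem tensorMu_eq (X Y : FreeGS S) :
    tensorμ X X Y Y =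
      eqToHom (by simp only [tensorObj_assoc] : tensorObj (tensorObj X X) (tensorObj Y Y) =
        tensorObj X (tensorObj (tensorObj X Y) Y)) ≫
      tensorHom (𝟙 X) (tensorHom (swap X Y) (𝟙 Y)) ≫
      eqToHom (by simp only [tensorObj_assoc] : tensorObj X (tensorObj (tensorObj Y X) Y) =
        tensorObj (tensorObj X Y) (tensorObj X Y)) := by
  change eqToHom (tensorObj_assoc X X (tensorObj Y Y)) ≫
    tensorHom (𝟙 X) (eqToHom (tensorObj_assoc X Y Y).symm) ≫
      tensorHom (𝟙 X) (tensorHom (swap X Y) (𝟙 Y)) ≫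
        tensorHom (𝟙 X) (eqToHom (tensorObj_assoc Y X Y)) ≫
          eqToHom (tensorObj_assoc X Y (tensorObj X Y)).symm = _
  rw [id_tensor_eqToHom, id_tensor_eqToHom, eqToHom_trans, eqToHom_trans_assoc]

theorem copy_tensor_diagram (X Y : List S.W)
    (h1 : X ++ (X ++ Y ++ Y) = X ++ X ++ (Y ++ Y))
    (h2 : X ++ (Y ++ X ++ Y) = X ++ Y ++ (X ++ Y)) :
    Iso (copyDiagram (X ++ Y)) (((copyDiagram X).tensor (copyDiagram Y)).comp
      (recast h1 h2 ((idDiagram X).tensor ((swapDiagram X Y).tensor (idDiagram Y))))) := by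
  let l : List (Fin X.length ⊕ Fin Y.length) :=
    (List.finRange X.length).map Sum.inl ++ (List.finRange Y.length).map Sum.inr
  have hl : l.map (Sum.elim X.get Y.get) = X ++ Y := by
    rw [List.map_append, List.map_map, List.map_map]
    exact congrArg₂ _ (map_finRange_get X) (map_finRange_get Y)
  let F : Diagram S (X ++ Y) (X ++ Y ++ (X ++ Y)) :=
    withOuts ((idDiagram X).tensor (idDiagram Y)) (l ++ l) (by
      exact List.map_append.trans (congrArg₂ _ hl hl))
  have hF : NoBox F := (id_noBox X).tensor (id_noBox Y)
  obtain ⟨g, hg, hg'⟩ := exists_index hl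
  refine Iso.trans (E := F) ?_ (Iso.symm ?_)
  · refine iso_of_noBox (copy_noBox _) hF g hg' hg ?_
    exact List.map_append.trans (congrArg₂ _ hg hg)
  · let q : Fin X.length ⊕ ((Fin X.length ⊕ Fin Y.length) ⊕ Fin Y.length) →
        Fin X.length ⊕ Fin Y.length := Sum.elim Sum.inl (Sum.elim id Sum.inr)
    refine comp_of_noBox ((copy_noBox X).tensor (copy_noBox Y))
      (((id_noBox X).tensor ((swap_noBox X Y).tensor (id_noBox Y))).recast _ _) hF id q
      (fun _ => rfl) ?_ (List.map_id _) ?_ ?_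
    · rintro (i | (i | i) | i) <;> rfl
    · refine (List.map_id _).trans ?_
      change ((List.finRange X.length ++ List.finRange X.length).map Sum.inl ++
        (List.finRange Y.length ++ List.finRange Y.length).map Sum.inr) =
        ((List.finRange X.length).map Sum.inl ++ (l.map Sum.inl ++
          (List.finRange Y.length).map Sum.inr).map Sum.inr).map q
      simp [l, q, Function.comp_def]
    · change ((List.finRange X.length).map Sum.inl ++ (((List.finRange Y.length).map Sum.inr ++
        (List.finRange X.length).map Sum.inl).map Sum.inl ++
          (List.finRange Y.length).map Sum.inr).map Sum.inr).map q = l ++ l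
      simp [l, q, Function.comp_def]

theorem copy_tensor_eq (X Y : FreeGS S) :
    copy (tensorObj X Y) = tensorHom (copy X) (copy Y) ≫ tensorμ X X Y Y := by
  rw [tensorMu_eq]
  unfold copy swap
  rw [id_eq, id_eq, mk_tensor]
  erw [mk_tensor, mk_eqToHom, eqToHom_mk, mk_comp]
  exact mk_eq (X := tensorObj X Y) (Y := tensorObj (tensorObj X Y) (tensorObj X Y))
    (copy_tensor_diagram _ _ (by simp) (by simp))

theorem del_tensor_eq (X Y : FreeGS S) :
    del (tensorObj X Y) =
      tensorHom (del X) (del Y) ≫ eqToHom (nil_tensorObj (ofWord [])) := by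
  unfold del
  rw [mk_tensor, mk_eqToHom]
  apply mk_eq
  obtain ⟨g, hg, hg'⟩ := exists_index ((delDiagram X.word).tensor (delDiagram Y.word)).ins_label
  exact iso_of_noBox (del_noBox _) (((del_noBox _).tensor (del_noBox _)).recast _ _) g hg' hg rfl

theorem copy_nil : copy (ofWord [] : FreeGS S) = eqToHom (nil_tensorObj (ofWord [])).symm := by
  rw [eqToHom_eq_mk]
  exact mk_eq (iso_of_noBox (copy_noBox _) ((id_noBox _).recast _ _) id (fun _ => rfl) rfl rfl)

theorem del_nil : del (ofWord [] : FreeGS S) = 𝟙 _ :=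
  mk_eq (iso_of_noBox (del_noBox _) (id_noBox _) id (fun _ => rfl) rfl rfl)

/-- The free gs-monoidal category as a gs-monoidal category. -/
instance copyDiscard : CopyDiscardCategory (FreeGS S) where
  comonObj := comon
  isCommComonObj X := ⟨copy_swap X⟩
  copy_tensor := copy_tensor_eq
  discard_tensor := del_tensor_eq
  copy_unit := copy_nil
  discard_unit := del_nil

end FreeGS

/-! ## Strict gs-monoidal categories and functors -/

open ComonObj

/-- A monoidal category is strict if its tensor product is associative and unital on the nose and
its coherence isomorphisms are identities. Gs-monoidal categories are `CopyDiscardCategory`s. -/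
class IsStrict (C : Type u) [Category.{v} C] [MonoidalCategory C] : Prop where
  tensor_assoc : ∀ X Y Z : C, (X ⊗ Y) ⊗ Z = X ⊗ (Y ⊗ Z)
  unit_tensor : ∀ X : C, 𝟙_ C ⊗ X = X
  tensor_unit : ∀ X : C, X ⊗ 𝟙_ C = X
  associator_hom : ∀ X Y Z : C, (α_ X Y Z).hom = eqToHom (tensor_assoc X Y Z)
  leftUnitor_hom : ∀ X : C, (λ_ X).hom = eqToHom (unit_tensor X)
  rightUnitor_hom : ∀ X : C, (ρ_ X).hom = eqToHom (tensor_unit X)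

instance FreeGS.isStrict (S : Hyp.{u, v}) : IsStrict (FreeGS S) where
  tensor_assoc := FreeGS.tensorObj_assoc
  unit_tensor := FreeGS.nil_tensorObj
  tensor_unit := FreeGS.tensorObj_nil
  associator_hom _ _ _ := rfl
  leftUnitor_hom _ := rfl
  rightUnitor_hom _ := rfl

/-- A strict gs-monoidal functor between strict gs-monoidal categories: a functor that preserves
the unit, the tensor product of objects and of morphisms, the symmetry, and all copy and discard
morphisms on the nose. -/
@[ext]
structure StrictGSFunctor (C : Type u₁) [Category.{v₁} C] [MonoidalCategory C]
    [CopyDiscardCategory C] [IsStrict C] (D : Type u₂) [Category.{v₂} D] [MonoidalCategory D]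
    [CopyDiscardCategory D] [IsStrict D] extends C ⥤ D where
  obj_unit : obj (𝟙_ C) = 𝟙_ D
  obj_tensor : ∀ X Y : C, obj (X ⊗ Y) = obj X ⊗ obj Y
  map_tensor : ∀ {X Y X' Y' : C} (f : X ⟶ Y) (g : X' ⟶ Y'),
    map (f ⊗ₘ g) = eqToHom (obj_tensor X X') ≫ (map f ⊗ₘ map g) ≫ eqToHom (obj_tensor Y Y').symm
  map_braiding : ∀ X Y : C, map (β_ X Y).hom =
    eqToHom (obj_tensor X Y) ≫ (β_ (obj X) (obj Y)).hom ≫ eqToHom (obj_tensor Y X).symm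
  map_copy : ∀ X : C, map Δ[X] = Δ[obj X] ≫ eqToHom (obj_tensor X X).symm
  map_del : ∀ X : C, map ε[X] = ε[obj X] ≫ eqToHom obj_unit.symm

/-! ## The underlying hypergraph of a strict gs-monoidal category -/

/-- The tensor product `A₁ ⊗ ⋯ ⊗ Aₖ` of a finite sequence of objects. -/
def tensorFin {C : Type u} [Category.{v} C] [MonoidalCategory C] {k : ℕ} (A : Fin k → C) : C :=
  (List.ofFn A).foldr (fun X Y => X ⊗ Y) (𝟙_ C)

/-- The underlying hypergraph of a (strict) monoidal category: the wires are the objects, and a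
box of arity `(k, l)` consists of `k` objects, `l` objects and a morphism between their tensor
products. -/
def hyp (C : Type u) [Category.{v} C] [MonoidalCategory C] : Hyp.{u, max u v} where
  W := C
  B k l := Σ (A : Fin k → C) (B : Fin l → C), (tensorFin A ⟶ tensorFin B)
  inp b i := b.1 i
  out b j := b.2.1 j

section

variable {C : Type u₁} [Category.{v₁} C] [MonoidalCategory C] [CopyDiscardCategory C] [IsStrict C]
  {D : Type u₂} [Category.{v₂} D] [MonoidalCategory D] [CopyDiscardCategory D] [IsStrict D]

theorem StrictGSFunctor.obj_tensorFin (F : StrictGSFunctor C D) {k : ℕ} (A : Fin k → C) :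
    F.obj (tensorFin A) = tensorFin fun i => F.obj (A i) := by
  have key : ∀ l : List C, F.obj (l.foldr (fun X Y => X ⊗ Y) (𝟙_ C)) =
      (l.map F.obj).foldr (fun X Y => X ⊗ Y) (𝟙_ D) := by
    intro l
    induction l with
    | nil => exact F.obj_unit
    | cons X l ih =>
      rw [List.foldr_cons, F.obj_tensor, ih]
      rfl
  unfold tensorFin
  rw [key, List.map_ofFn]
  rfl

/-- The hypergraph morphism induced by a strict gs-monoidal functor. -/
def StrictGSFunctor.hypMap (F : StrictGSFunctor C D) : (hyp C).Hom (hyp D) where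
  wire X := F.obj X
  box b := ⟨fun i => F.obj (b.1 i), fun j => F.obj (b.2.1 j),
    eqToHom (F.obj_tensorFin b.1).symm ≫ F.map b.2.2 ≫ eqToHom (F.obj_tensorFin b.2.1)⟩
  inp_box _ _ := rfl
  out_box _ _ := rfl

end

/-! ## The generators -/

namespace FreeGS

variable {S : Hyp.{u, v}}

/-- The one-letter word. -/
def single (w : S.W) : FreeGS S := ofWord [w]

theorem word_tensorFin {k : ℕ} (f : Fin k → S.W) :
    (tensorFin fun i => single (f i)).word = List.ofFn f := by
  have key : ∀ l : List S.W, ((l.map single).foldr (fun X Y => X ⊗ Y) (𝟙_ (FreeGS S))).word = l := by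
    intro l
    induction l with
    | nil => rfl
    | cons x l ih => exact congrArg (List.cons x) ih
  have := key (List.ofFn f)
  rw [List.map_ofFn] at this
  exact this

/-- The hypergraph with a single box, of arity `(k, l)`, whose `k` inputs and `l` outputs are
pairwise distinct and are all the wires. -/
def boxHyp (k l : ℕ) : Hyp.{0, 0} where
  W := Fin k ⊕ Fin l
  B k' l' := PLift (k = k' ∧ l = l')
  inp b i := Sum.inl (i.cast b.down.1.symm)
  out b j := Sum.inr (j.cast b.down.2.symm)

/-- The string diagram consisting of a single box. -/
def boxDiagram {k l : ℕ} (b : S.B k l) :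
    Diagram S (tensorFin fun i => single (S.inp b i)).word
      (tensorFin fun j => single (S.out b j)).word where
  apex := boxHyp k l
  finite := ⟨inferInstanceAs (Finite (Fin k ⊕ Fin l)), by
    have : Subsingleton (boxHyp k l).Box := ⟨by
      rintro ⟨k₁, l₁, ⟨h₁⟩⟩ ⟨k₂, l₂, ⟨h₂⟩⟩
      obtain ⟨rfl, rfl⟩ := h₁
      obtain ⟨rfl, rfl⟩ := h₂
      rfl⟩
    exact Finite.of_subsingleton⟩
  label :=
    { wire := Sum.elim (S.inp b) (S.out b)
      box := fun {k' l'} e => (e.down.1 ▸ e.down.2 ▸ b : S.B k' l')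
      inp_box := by
        rintro k' l' ⟨h⟩ i
        obtain ⟨rfl, rfl⟩ := h
        rfl
      out_box := by
        rintro k' l' ⟨h⟩ j
        obtain ⟨rfl, rfl⟩ := h
        rfl }
  ins := (List.finRange k).map Sum.inl
  outs := (List.finRange l).map Sum.inr
  ins_label := by
    rw [word_tensorFin, List.ofFn_eq_map]
    exact List.map_map
  outs_label := by
    rw [word_tensorFin, List.ofFn_eq_map]
    exact List.map_map
  acyclic w h := by
    have h1 : ∀ x y, (boxHyp k l).Step x y → (∃ i, x = Sum.inl i) ∧ ∃ j, y = Sum.inr j := by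
      intro x y h
      obtain ⟨k', l', e, i, j, hi, hj⟩ := Hyp.step_iff.1 h
      exact ⟨⟨_, hi.symm⟩, ⟨_, hj.symm⟩⟩
    obtain ⟨y, hy, -⟩ := Relation.TransGen.head'_iff.1 h
    obtain ⟨z, -, hz⟩ := Relation.TransGen.tail'_iff.1 h
    obtain ⟨i, rfl⟩ := (h1 _ _ hy).1
    obtain ⟨j, hj⟩ := (h1 _ _ hz).2
    exact Sum.inl_ne_inr hj
  monogamous := by
    have : Subsingleton (boxHyp k l).Box := ⟨by
      rintro ⟨k₁, l₁, ⟨h₁⟩⟩ ⟨k₂, l₂, ⟨h₂⟩⟩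
      obtain ⟨rfl, rfl⟩ := h₁
      obtain ⟨rfl, rfl⟩ := h₂
      rfl⟩
    refine (Hyp.leftMonogamous_iff Finite.of_subsingleton _).2 ⟨?_, ?_, ?_, ?_⟩
    · rintro (i | j)
      · exact Or.inl (List.mem_map_of_mem (List.mem_finRange i))
      · exact Or.inr ⟨k, l, ⟨rfl, rfl⟩, j, rfl⟩
    · exact (List.nodup_finRange k).map Sum.inl_injective
    · intro k' l' e j h
      obtain ⟨i, -, hi⟩ := List.mem_map.1 h
      exact Sum.inl_ne_inr hi
    · rintro k₁ l₁ ⟨h₁⟩ j₁ k₂ l₂ ⟨h₂⟩ j₂ h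
      obtain ⟨rfl, rfl⟩ := h₁
      obtain ⟨rfl, rfl⟩ := h₂
      obtain rfl : j₁ = j₂ := Sum.inr_injective h
      rfl

/-- The canonical hypergraph morphism from `S` to the underlying hypergraph of `FreeGS S`. -/
def unit (S : Hyp.{u, v}) : S.Hom (hyp (FreeGS S)) where
  wire w := single w
  box b := ⟨fun i => single (S.inp b i), fun j => single (S.out b j), mk (boxDiagram b)⟩
  inp_box _ _ := rfl
  out_box _ _ := rfl

end FreeGS

/-- Restriction of a strict gs-monoidal functor along the canonical hypergraph morphism. -/
def restrict {S : Hyp.{u, v}} {C : Type u₁} [Category.{v₁} C] [MonoidalCategory C]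
    [CopyDiscardCategory C] [IsStrict C] (F : StrictGSFunctor (FreeGS S) C) : S.Hom (hyp C) :=
  (FreeGS.unit S).comp F.hypMap

end GSMon

/-! The two halves of bijectivity are separate: every interpretation of the boxes extends to all
diagrams, and a strict gs-monoidal functor has no freedom beyond the boxes.

Extension. Call a morphism of `C` deterministic if it is a homomorphism of comonoids. On
deterministic morphisms the tensor product behaves like a cartesian product: they can be paired, and
one into the tensor product of a repetition-free family is determined by its components
(`tens_hom_ext`). A diagram labelled in `C` is evaluated by running its boxes one at a time on a
growing list of available wires. Each step copies the whole state, sends a selection from one copy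
into the box, and keeps the other copy; at the end the output wires are selected and all the rest is
discarded. Finiteness and acyclicity provide an order of execution (`exists_enabled`,
`exists_eval`), and left monogamy keeps the available wires distinct, so that a wire can be found by
its name.

The order of execution is irrelevant: two boxes whose inputs are both available commute
(`step_step_sel`), hence any enabled box can be moved to the front (`Eval.front`), and any two
orders are compared by induction (`Eval.unique`). Since the values of boxes need not be
deterministic, this rests on identities valid for arbitrary morphisms (`pair_id_comp_pair`,
`pair_pair_swap`), in which the results of a box are only permuted and never duplicated. Because
rearrangements of wires are deterministic, they slide past the steps (`step_rel`, `Eval.map`). This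
makes the value invariant under isomorphism and compatible with gluing (`Eval.comp`); the wires of
an added identity are carried along (`Eval.whisker`). Whiskering on the other side follows by
symmetry, and the result is `evalGSFunctor`.

Uniqueness. Every diagram is generated by boxes under composition, tensor, copying and discarding
(`generated`). A diagram without boxes merely selects inputs, which takes copies and discards;
otherwise some box has only global inputs as its inputs and can be split off (`Diagram.erase_iso`),
leaving fewer boxes. Two strict functors with the same restriction therefore agree on all diagrams
(`restrict_injective`).

The statement about functors that are the identity on objects then concerns words only: both a
strict functor and the identification `e` are multiplicative, so they agree on all words once they
agree on letters. -/

namespace GSMon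

open CategoryTheory MonoidalCategory ComonObj

set_option linter.unusedSectionVars false

-- `Δ[X ⊗ Y]` has to mean the structure assigned by `CopyDiscardCategory`, not the tensor product of
-- the comonoids on `X` and `Y`; the two are related by the multiplicativity axioms, which are
-- invoked explicitly.
attribute [-instance] Comon.instComonObjTensorObj

/-! ## Pairing in copy-discard categories -/

section Pairing

variable {C : Type u₁} [Category.{v₁} C] [MonoidalCategory C] [CopyDiscardCategory C]

/-- The first marginal. -/
def fstHom (X Y : C) : X ⊗ Y ⟶ X := X ◁ ε[Y] ≫ (ρ_ X).hom

/-- The second marginal. -/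
def sndHom (X Y : C) : X ⊗ Y ⟶ Y := ε[X] ▷ Y ≫ (λ_ Y).hom

/-- Copy the input and apply two morphisms in parallel. -/
def pair {X Y Z : C} (f : X ⟶ Y) (g : X ⟶ Z) : X ⟶ Y ⊗ Z := Δ[X] ≫ (f ⊗ₘ g)

theorem pair_tensorHom {X Y Z Y' Z' : C} (f : X ⟶ Y) (g : X ⟶ Z) (h : Y ⟶ Y') (k : Z ⟶ Z') :
    pair f g ≫ (h ⊗ₘ k) = pair (f ≫ h) (g ≫ k) := by
  simp [pair]

theorem pair_whiskerRight {X Y Z Y' : C} (f : X ⟶ Y) (g : X ⟶ Z) (h : Y ⟶ Y') :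
    pair f g ≫ h ▷ Z = pair (f ≫ h) g := by
  rw [← tensorHom_id, pair_tensorHom, Category.comp_id]

theorem pair_whiskerLeft {X Y Z Z' : C} (f : X ⟶ Y) (g : X ⟶ Z) (k : Z ⟶ Z') :
    pair f g ≫ Y ◁ k = pair f (g ≫ k) := by
  rw [← id_tensorHom, pair_tensorHom, Category.comp_id]

/-- Determinism of `d` is what lets it pass through the copy. -/
theorem comp_pair {X' X Y Z : C} (d : X' ⟶ X) [IsComonHom d] (f : X ⟶ Y) (g : X ⟶ Z) :
    d ≫ pair f g = pair (d ≫ f) (d ≫ g) := by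
  simp [pair]

theorem pair_braiding {X Y Z : C} (f : X ⟶ Y) (g : X ⟶ Z) :
    pair f g ≫ (β_ Y Z).hom = pair g f := by
  rw [pair, Category.assoc, BraidedCategory.braiding_naturality, ← Category.assoc,
    IsCommComonObj.comul_comm]
  rfl

theorem pair_assoc {X Y Z T : C} (f : X ⟶ Y) (g : X ⟶ Z) (h : X ⟶ T) :
    pair (pair f g) h ≫ (α_ Y Z T).hom = pair f (pair g h) := by
  have h1 : pair (pair f g) h = Δ[X] ≫ Δ[X] ▷ X ≫ ((f ⊗ₘ g) ⊗ₘ h) := by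
    rw [← tensorHom_id, tensorHom_comp_tensorHom, Category.id_comp]
    rfl
  have h2 : pair f (pair g h) = Δ[X] ≫ X ◁ Δ[X] ≫ (f ⊗ₘ (g ⊗ₘ h)) := by
    rw [← id_tensorHom, tensorHom_comp_tensorHom, Category.id_comp]
    rfl
  rw [h1, h2, Category.assoc, Category.assoc, associator_naturality, comul_assoc_assoc]

theorem pair_assoc_inv {X Y Z T : C} (f : X ⟶ Y) (g : X ⟶ Z) (h : X ⟶ T) :
    pair f (pair g h) ≫ (α_ Y Z T).inv = pair (pair f g) h := by
  rw [← pair_assoc, Category.assoc, Iso.hom_inv_id, Category.comp_id]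

theorem pair_discard {X Y : C} (f : X ⟶ Y) : pair f ε[X] ≫ (ρ_ Y).hom = f := by
  rw [pair, comul_counit_hom, Category.assoc, Iso.inv_hom_id, Category.comp_id]

theorem discard_pair {X Y : C} (f : X ⟶ Y) : pair ε[X] f ≫ (λ_ Y).hom = f := by
  rw [pair, counit_comul_hom, Category.assoc, Iso.inv_hom_id, Category.comp_id]

/-- Only the component that is thrown away has to be deterministic; the surviving one may be the
value of an arbitrary box. -/
theorem pair_fst {X Y Z : C} (f : X ⟶ Y) (g : X ⟶ Z) [IsComonHom g] :
    pair f g ≫ fstHom Y Z = f := by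
  rw [fstHom, ← Category.assoc, pair_whiskerLeft, IsComonHom.hom_counit, pair_discard]

theorem pair_snd {X Y Z : C} (f : X ⟶ Y) (g : X ⟶ Z) [IsComonHom f] :
    pair f g ≫ sndHom Y Z = g := by
  rw [sndHom, ← Category.assoc, pair_whiskerRight, IsComonHom.hom_counit, discard_pair]

theorem pair_id_id (X : C) : pair (𝟙 X) (𝟙 X) = Δ[X] := by simp [pair]

theorem copy_tensor_eq_pair (X Y : C) :
    Δ[X ⊗ Y] = (Δ[X] ⊗ₘ Δ[Y]) ≫ tensorμ X X Y Y := CopyDiscardCategory.copy_tensor X Y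

theorem discard_tensor' (X Y : C) : ε[X ⊗ Y] = (ε[X] ⊗ₘ ε[Y]) ≫ (λ_ (𝟙_ C)).hom :=
  CopyDiscardCategory.discard_tensor X Y

/-- The middle interchange swaps two unit objects here, and that braiding is an identity. -/
theorem tensorμ_unit_unit (X Y : C) :
    tensorμ X (𝟙_ C) (𝟙_ C) Y ≫ ((ρ_ X).hom ⊗ₘ (λ_ Y).hom) = ((ρ_ X).hom ⊗ₘ (λ_ Y).hom) := by
  have : (β_ (𝟙_ C) (𝟙_ C)).hom = 𝟙 _ := by
    rw [braiding_tensorUnit_left]; monoidal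
  simp only [tensorμ, this]
  monoidal

/-- By multiplicativity, copying `X ⊗ Y` copies both factors and interchanges the middle ones. The
two discards move back across the interchange, where the counit laws cancel them against the two
copies. -/
theorem pair_fst_snd (X Y : C) : pair (fstHom X Y) (sndHom X Y) = 𝟙 (X ⊗ Y) := by
  have h : (fstHom X Y ⊗ₘ sndHom X Y) =
      ((𝟙 X ⊗ₘ ε[Y]) ⊗ₘ (ε[X] ⊗ₘ 𝟙 Y)) ≫ ((ρ_ X).hom ⊗ₘ (λ_ Y).hom) := by
    simp [fstHom, sndHom]
  rw [pair, copy_tensor_eq_pair, h, Category.assoc, ← tensorμ_natural_assoc, tensorμ_unit_unit]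
  simp only [tensorHom_comp_tensorHom]
  simp

theorem comp_fst_snd {X Y Z : C} (f : X ⟶ Y ⊗ Z) [IsComonHom f] :
    pair (f ≫ fstHom Y Z) (f ≫ sndHom Y Z) = f := by
  rw [← comp_pair, pair_fst_snd, Category.comp_id]

/-- This is where cocommutativity enters: both sides of the comultiplication law make four copies
and differ by a swap of the middle two. -/
instance isComonHom_copy (X : C) : IsComonHom Δ[X] where
  hom_counit := by
    rw [discard_tensor', ← Category.assoc, counit_comul_hom, Category.assoc, Iso.inv_hom_id,
      Category.comp_id]
  hom_comul := by
    have h1 : ∀ {Y : C} (f : X ⟶ Y), pair f f ≫ (β_ Y Y).hom = pair f f := fun f => pair_braiding f f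
    have h2 : Δ[X] ≫ (Δ[X] ⊗ₘ Δ[X]) = pair (pair (𝟙 X) (𝟙 X)) (pair (𝟙 X) (𝟙 X)) := by
      simp [pair]
    rw [copy_tensor_eq_pair, ← Category.assoc, h2, tensorμ, ← Category.assoc, pair_assoc]
    simp only [← Category.assoc]
    simp only [pair_whiskerLeft, pair_assoc_inv, pair_whiskerRight, pair_braiding, pair_assoc]

instance isComonHom_counit (X : C) : IsComonHom ε[X] where
  hom_counit := by rw [CopyDiscardCategory.discard_unit, Category.comp_id]
  hom_comul := by
    rw [CopyDiscardCategory.copy_unit, counit_comul_hom]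

instance isComonHom_eqToHom {X Y : C} (h : X = Y) : IsComonHom (eqToHom h) := by
  subst h
  rw [eqToHom_refl]
  infer_instance

instance isComonHom_tensorHom {X Y X' Y' : C} (f : X ⟶ Y) (g : X' ⟶ Y') [IsComonHom f]
    [IsComonHom g] : IsComonHom (f ⊗ₘ g) where
  hom_counit := by
    rw [discard_tensor', discard_tensor', tensorHom_comp_tensorHom_assoc, IsComonHom.hom_counit,
      IsComonHom.hom_counit]
  hom_comul := by
    rw [copy_tensor_eq_pair, copy_tensor_eq_pair, tensorHom_comp_tensorHom_assoc,
      IsComonHom.hom_comul, IsComonHom.hom_comul, Category.assoc, ← tensorμ_natural,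
      tensorHom_comp_tensorHom_assoc]

instance isComonHom_pair {X Y Z : C} (f : X ⟶ Y) (g : X ⟶ Z) [IsComonHom f] [IsComonHom g] :
    IsComonHom (pair f g) := by
  unfold pair
  infer_instance

end Pairing

/-! ## Iterated tensor products as products for deterministic morphisms -/

/-- The tensor product of a list of objects. -/
def tens {C : Type u₁} [Category.{v₁} C] [MonoidalCategory C] (L : List C) : C :=
  L.foldr (fun X Y => X ⊗ Y) (𝟙_ C)

section Tens

variable {C : Type u₁} [Category.{v₁} C] [MonoidalCategory C] [CopyDiscardCategory C] [IsStrict C]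

theorem tens_append (L M : List C) : tens (L ++ M) = tens L ⊗ tens M := by
  induction L with
  | nil => exact (IsStrict.unit_tensor _).symm
  | cons X L ih => exact (congrArg (X ⊗ ·) ih).trans (IsStrict.tensor_assoc X _ _).symm

instance isComonHom_leftUnitor (X : C) : IsComonHom (λ_ X).hom := by
  rw [IsStrict.leftUnitor_hom]
  infer_instance

instance isComonHom_rightUnitor (X : C) : IsComonHom (ρ_ X).hom := by
  rw [IsStrict.rightUnitor_hom]
  infer_instance

instance isComonHom_fst (X Y : C) : IsComonHom (fstHom X Y) := by
  unfold fstHom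
  rw [← id_tensorHom]
  infer_instance

instance isComonHom_snd (X Y : C) : IsComonHom (sndHom X Y) := by
  unfold sndHom
  rw [← tensorHom_id]
  infer_instance

instance isComonHom_whiskerRight {X Y : C} (f : X ⟶ Y) (Z : C) [IsComonHom f] :
    IsComonHom (f ▷ Z) := by
  rw [← tensorHom_id]
  infer_instance

instance isComonHom_whiskerLeft {X Y : C} (f : X ⟶ Y) (Z : C) [IsComonHom f] :
    IsComonHom (Z ◁ f) := by
  rw [← id_tensorHom]
  infer_instance

theorem tensorHom_fst {X Y X' Y' : C} (f : X ⟶ Y) (g : X' ⟶ Y') [IsComonHom g] :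
    (f ⊗ₘ g) ≫ fstHom Y Y' = fstHom X X' ≫ f := by
  rw [← Category.id_comp (f ⊗ₘ g), ← pair_fst_snd, pair_tensorHom, pair_fst]

theorem tensorHom_snd {X Y X' Y' : C} (f : X ⟶ Y) (g : X' ⟶ Y') [IsComonHom f] :
    (f ⊗ₘ g) ≫ sndHom Y Y' = sndHom X X' ≫ g := by
  rw [← Category.id_comp (f ⊗ₘ g), ← pair_fst_snd, pair_tensorHom, pair_snd]

theorem whiskerRight_fst {X Y : C} (f : X ⟶ Y) (Z : C) :
    f ▷ Z ≫ fstHom Y Z = fstHom X Z ≫ f := by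
  rw [← tensorHom_id, tensorHom_fst]

theorem whiskerRight_snd {X Y : C} (f : X ⟶ Y) (Z : C) [IsComonHom f] :
    f ▷ Z ≫ sndHom Y Z = sndHom X Z := by
  rw [← tensorHom_id, tensorHom_snd, Category.comp_id]

theorem whiskerLeft_fst {X Y : C} (f : X ⟶ Y) (Z : C) [IsComonHom f] :
    Z ◁ f ≫ fstHom Z Y = fstHom Z X := by
  rw [← id_tensorHom, tensorHom_fst, Category.comp_id]

theorem whiskerLeft_snd {X Y : C} (f : X ⟶ Y) (Z : C) :
    Z ◁ f ≫ sndHom Z Y = sndHom Z X ≫ f := by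
  rw [← id_tensorHom, tensorHom_snd]

/-- A deterministic morphism is recovered by pairing its marginals, which fails for general
morphisms. -/
theorem tensor_hom_ext {X Y Z : C} {f g : X ⟶ Y ⊗ Z} [IsComonHom f] [IsComonHom g]
    (h1 : f ≫ fstHom Y Z = g ≫ fstHom Y Z) (h2 : f ≫ sndHom Y Z = g ≫ sndHom Y Z) : f = g := by
  rw [← comp_fst_snd f, ← comp_fst_snd g, h1, h2]

theorem associator_eq (X Y Z : C) : (α_ X Y Z).hom =
    pair (fstHom (X ⊗ Y) Z ≫ fstHom X Y)
      (pair (fstHom (X ⊗ Y) Z ≫ sndHom X Y) (sndHom (X ⊗ Y) Z)) := by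
  rw [← pair_assoc, comp_fst_snd, pair_fst_snd, Category.id_comp]

theorem associator_fst (X Y Z : C) :
    (α_ X Y Z).hom ≫ fstHom X (Y ⊗ Z) = fstHom (X ⊗ Y) Z ≫ fstHom X Y := by
  rw [associator_eq, pair_fst]

theorem associator_snd (X Y Z : C) :
    (α_ X Y Z).hom ≫ sndHom X (Y ⊗ Z) = sndHom X Y ▷ Z := by
  rw [associator_eq, pair_snd]
  apply tensor_hom_ext
  · rw [pair_fst, whiskerRight_fst]
  · rw [pair_snd, whiskerRight_snd]

theorem leftUnitor_eq_snd (X : C) : (λ_ X).hom = sndHom (𝟙_ C) X := by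
  rw [sndHom, CopyDiscardCategory.discard_unit, id_whiskerRight, Category.id_comp]

/-- The morphism `k` is arbitrary, so it may not be copied. The point is that pairing `sndHom` with
the identity on `Y ⊗ X` amounts to copying `X` alone and permuting factors, which leaves the result
of `k` untouched. Coassociativity and cocommutativity on `X` do the rest. This governs two
successive steps of an evaluation. -/
theorem pair_id_comp_pair {X Y Z : C} (k : X ⟶ Y) (k' : X ⟶ Z) :
    pair k (𝟙 X) ≫ pair (sndHom Y X ≫ k') (𝟙 _) = pair k' (pair k (𝟙 X)) := by
  have h1 : pair (sndHom Y X) (𝟙 _) =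
      Y ◁ Δ[X] ≫ (α_ Y X X).inv ≫ (β_ Y X).hom ▷ X ≫ (α_ X Y X).hom := by
    have h : Y ◁ Δ[X] = pair (fstHom Y X) (pair (sndHom Y X) (sndHom Y X)) := by
      rw [← comp_fst_snd (Y ◁ Δ[X]), whiskerLeft_fst, whiskerLeft_snd, ← pair_id_id, comp_pair,
        Category.comp_id]
    rw [h, ← Category.assoc, pair_assoc_inv, ← Category.assoc, pair_whiskerRight, pair_braiding,
      pair_assoc, pair_fst_snd]
  have h2 : pair (sndHom Y X ≫ k') (𝟙 (Y ⊗ X)) = pair (sndHom Y X) (𝟙 _) ≫ k' ▷ (Y ⊗ X) := by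
    rw [pair_whiskerRight]
  rw [h2, h1, ← Category.assoc, ← Category.assoc, pair_whiskerLeft, Category.id_comp, ← pair_id_id,
    ← Category.assoc, pair_assoc_inv, ← Category.assoc, pair_whiskerRight, pair_braiding,
    pair_assoc, pair_whiskerRight, Category.id_comp]

/-- Only `X` has effectively to be copied, since the extra copy of `Z` is discarded at once. This is
what carries idle wires through a step. -/
theorem pair_fst_comp_id {X Y : C} (Z : C) (k : X ⟶ Y) :
    pair (fstHom X Z ≫ k) (𝟙 (X ⊗ Z)) = pair k (𝟙 X) ▷ Z ≫ (α_ Y X Z).hom := by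
  have h : pair (fstHom X Z) (𝟙 (X ⊗ Z)) = pair (𝟙 X) (𝟙 X) ▷ Z ≫ (α_ X X Z).hom := by
    have : pair (𝟙 X) (𝟙 X) ▷ Z = pair (pair (fstHom X Z) (fstHom X Z)) (sndHom X Z) := by
      rw [← comp_fst_snd (pair (𝟙 X) (𝟙 X) ▷ Z), whiskerRight_fst, whiskerRight_snd, comp_pair,
        Category.comp_id]
    rw [this, pair_assoc, pair_fst_snd]
  rw [← pair_whiskerRight, h, Category.assoc, ← associator_naturality_left, ← Category.assoc,
    ← comp_whiskerRight, pair_whiskerRight, Category.id_comp]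

end Tens

/-! ### Projections and tupling for tensor products of lists. -/

section Lists

open scoped Classical in
/-- The projection from a tensor product to one of its factors. -/
noncomputable def proj {C : Type u₁} [Category.{v₁} C] [MonoidalCategory C]
    [CopyDiscardCategory C] {A : Type u} (v : A → C) :
    (L : List A) → (x : A) → x ∈ L → (tens (L.map v) ⟶ v x)
  | [], _, h => absurd h List.not_mem_nil
  | a :: L, x, h =>
    if e : x = a then fstHom (v a) (tens (L.map v)) ≫ eqToHom (congrArg v e).symm
    else sndHom (v a) (tens (L.map v)) ≫ proj v L x (List.mem_of_ne_of_mem e h)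

/-- The morphism into a tensor product with given components. -/
def lift {C : Type u₁} [Category.{v₁} C] [MonoidalCategory C]
    [CopyDiscardCategory C] {A : Type u} (v : A → C) {X : C} :
    (L : List A) → (∀ x ∈ L, X ⟶ v x) → (X ⟶ tens (L.map v))
  | [], _ => ε[X]
  | a :: L, g =>
    pair (g a List.mem_cons_self) (lift v L fun x hx => g x (List.mem_cons_of_mem _ hx))

variable {C : Type u₁} [Category.{v₁} C] [MonoidalCategory C] [CopyDiscardCategory C] [IsStrict C]
  {A : Type u} {B : Type v} (v : A → C)

theorem proj_head {a : A} {L : List A} (h : a ∈ a :: L) :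
    proj v (a :: L) a h = fstHom (v a) (tens (L.map v)) := by
  rw [proj, dif_pos rfl]
  exact Category.comp_id _

theorem proj_tail {a x : A} {L : List A} (h : x ∈ a :: L) (hx : x ∈ L) (e : x ≠ a) :
    proj v (a :: L) x h = sndHom (v a) (tens (L.map v)) ≫ proj v L x hx := by
  exact dif_neg e

instance isComonHom_proj (L : List A) (x : A) (h : x ∈ L) : IsComonHom (proj v L x h) := by
  induction L with
  | nil => exact absurd h List.not_mem_nil
  | cons a L ih =>
    by_cases e : x = a
    · subst e
      rw [proj_head]
      exact isComonHom_fst _ _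
    · have := ih (List.mem_of_ne_of_mem e h)
      rw [proj_tail v h (List.mem_of_ne_of_mem e h) e]
      have h' : IsComonHom (sndHom (v a) (tens (L.map v)) ≫
        proj v L x (List.mem_of_ne_of_mem e h)) := inferInstance
      exact h'

theorem isComonHom_lift {X : C} (L : List A) (g : ∀ x ∈ L, X ⟶ v x)
    (hg : ∀ x hx, IsComonHom (g x hx)) : IsComonHom (lift v L g) := by
  induction L with
  | nil => exact isComonHom_counit X
  | cons a L ih =>
    have := ih (fun x hx => g x (List.mem_cons_of_mem _ hx)) fun x hx => hg _ _
    have := hg a List.mem_cons_self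
    have h' : IsComonHom (pair (g a List.mem_cons_self)
      (lift v L fun x hx => g x (List.mem_cons_of_mem _ hx))) := inferInstance
    exact h'

theorem comp_lift {X' X : C} (d : X' ⟶ X) [IsComonHom d] (L : List A) (g : ∀ x ∈ L, X ⟶ v x) :
    d ≫ lift v L g = lift v L fun x hx => d ≫ g x hx := by
  induction L with
  | nil => exact IsComonHom.hom_counit d
  | cons a L ih => exact (comp_pair _ _ _).trans (congrArg _ (ih _))

/-- Repetitions in `L` do no harm: `proj` reads the first occurrence of `x`, and `lift` places the
same component at all of them. -/
theorem lift_proj {X : C} (L : List A) (g : ∀ x ∈ L, X ⟶ v x)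
    (hg : ∀ x hx, IsComonHom (g x hx)) (x : A) (h : x ∈ L) : lift v L g ≫ proj v L x h = g x h := by
  induction L with
  | nil => exact absurd h List.not_mem_nil
  | cons a L ih =>
    have h1 := isComonHom_lift v L (fun x hx => g x (List.mem_cons_of_mem _ hx)) fun x hx => hg _ _
    have h2 := hg a List.mem_cons_self
    by_cases e : x = a
    · subst e
      rw [proj_head]
      have h3 : pair (g x List.mem_cons_self) (lift v L fun x hx => g x
          (List.mem_cons_of_mem _ hx)) ≫ fstHom _ _ = g x h := pair_fst _ _
      exact h3
    · rw [proj_tail v h (List.mem_of_ne_of_mem e h) e]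
      have h3 : pair (g a List.mem_cons_self) (lift v L fun x hx => g x
          (List.mem_cons_of_mem _ hx)) ≫ sndHom _ _ ≫ proj v L x (List.mem_of_ne_of_mem e h) =
          g x h := by
        rw [← Category.assoc, pair_snd, ih _ fun x hx => hg _ _]
      exact h3

/-- Extensionality of finite products, by induction from the binary case. `Nodup` is essential, as
the projections do not see a later occurrence of a repeated entry. -/
theorem tens_hom_ext {X : C} {L : List A} (hL : L.Nodup) {f g : X ⟶ tens (L.map v)}
    (hf : IsComonHom f) (hg : IsComonHom g)
    (h : ∀ x hx, f ≫ proj v L x hx = g ≫ proj v L x hx) : f = g := by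
  induction L with
  | nil =>
    have h1 : ∀ f : X ⟶ 𝟙_ C, IsComonHom f → f = ε[X] := fun f hf => by
      rw [← IsComonHom.hom_counit f, CopyDiscardCategory.discard_unit, Category.comp_id]
    exact (h1 f hf).trans (h1 g hg).symm
  | cons a L ih =>
    rw [List.nodup_cons] at hL
    have key : ∀ (f g : X ⟶ v a ⊗ tens (L.map v)), IsComonHom f → IsComonHom g →
        f ≫ fstHom _ _ = g ≫ fstHom _ _ →
        (∀ x hx, f ≫ sndHom _ _ ≫ proj v L x hx = g ≫ sndHom _ _ ≫ proj v L x hx) → f = g := by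
      intro f g hf hg h1 h2
      refine tensor_hom_ext h1 (ih hL.2 inferInstance inferInstance fun x hx => ?_)
      rw [Category.assoc, Category.assoc, h2 x hx]
    refine key f g hf hg ?_ fun x hx => ?_
    · have := h a List.mem_cons_self
      rw [proj_head] at this
      exact this
    · have := h x (List.mem_cons_of_mem _ hx)
      rw [proj_tail v _ hx (fun e => hL.1 (by rwa [e] at hx))] at this
      exact this

theorem lift_proj_self {L : List A} (hL : L.Nodup) : lift v L (proj v L) = 𝟙 _ :=
  tens_hom_ext v hL (isComonHom_lift v L _ fun _ _ => inferInstance) inferInstance fun x hx => by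
    rw [lift_proj v L _ fun _ _ => inferInstance, Category.id_comp]

theorem tens_map_append (L M : List A) :
    tens (L.map v) ⊗ tens (M.map v) = tens ((L ++ M).map v) := by
  rw [List.map_append, tens_append]

/-- The canonical identification for the concatenation of two lists. -/
def app (L M : List A) : tens (L.map v) ⊗ tens (M.map v) ⟶ tens ((L ++ M).map v) :=
  eqToHom (tens_map_append v L M)

/-- The inverse of `app`. -/
def unapp (L M : List A) : tens ((L ++ M).map v) ⟶ tens (L.map v) ⊗ tens (M.map v) :=
  eqToHom (tens_map_append v L M).symm

instance isComonHom_app (L M : List A) : IsComonHom (app v L M) := isComonHom_eqToHom _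

instance isComonHom_unapp (L M : List A) : IsComonHom (unapp v L M) := isComonHom_eqToHom _

@[simp]
theorem app_unapp (L M : List A) : app v L M ≫ unapp v L M = 𝟙 _ := by
  simp [app, unapp]

@[simp]
theorem unapp_app (L M : List A) : unapp v L M ≫ app v L M = 𝟙 _ := by
  simp [app, unapp]

@[simp]
theorem app_unapp_assoc (L M : List A) {X : C} (f : tens (L.map v) ⊗ tens (M.map v) ⟶ X) :
    app v L M ≫ unapp v L M ≫ f = f := by
  rw [← Category.assoc, app_unapp, Category.id_comp]

theorem app_nil (M : List A) : app v [] M = (λ_ (tens (M.map v))).hom :=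
  (IsStrict.leftUnitor_hom _).symm

theorem app_cons (a : A) (L M : List A) : app v (a :: L) M =
    (α_ (v a) (tens (L.map v)) (tens (M.map v))).hom ≫ v a ◁ app v L M := by
  rw [IsStrict.associator_hom, app, app, whiskerLeft_eqToHom, eqToHom_trans]
  rfl

theorem app_proj_left (L M : List A) (x : A) (hx : x ∈ L) (h : x ∈ L ++ M) :
    app v L M ≫ proj v (L ++ M) x h = fstHom _ _ ≫ proj v L x hx := by
  induction L with
  | nil => exact absurd hx List.not_mem_nil
  | cons a L ih =>
    rw [app_cons]
    by_cases e : x = a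
    · subst e
      have h1 : ((α_ (v x) (tens (L.map v)) (tens (M.map v))).hom ≫ v x ◁ app v L M) ≫
          fstHom _ _ = fstHom _ _ ≫ fstHom _ _ := by
        rw [Category.assoc, whiskerLeft_fst, associator_fst]
      exact (congrArg (_ ≫ ·) (proj_head v (L := L ++ M) _)).trans
        (h1.trans (congrArg (_ ≫ ·) (proj_head v _).symm))
    · have hx' := List.mem_of_ne_of_mem e hx
      have h1 : ((α_ (v a) (tens (L.map v)) (tens (M.map v))).hom ≫ v a ◁ app v L M) ≫
          sndHom _ _ ≫ proj v (L ++ M) x (List.mem_append_left _ hx') =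
            fstHom _ _ ≫ sndHom _ _ ≫ proj v L x hx' := by
        rw [Category.assoc, ← Category.assoc (v a ◁ app v L M), whiskerLeft_snd, Category.assoc,
          ih hx', ← Category.assoc, associator_snd, ← Category.assoc, whiskerRight_fst,
          Category.assoc]
      exact (congrArg (_ ≫ ·) (proj_tail v (L := L ++ M) h (List.mem_append_left _ hx') e)).trans
        (h1.trans (congrArg (_ ≫ ·) (proj_tail v hx hx' e).symm))

/-- The condition `x ∉ L` is needed because `proj` would otherwise stop at the occurrence in `L`. -/
theorem app_proj_right (L M : List A) (x : A) (hx : x ∈ M) (hL : x ∉ L) (h : x ∈ L ++ M) :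
    app v L M ≫ proj v (L ++ M) x h = sndHom _ _ ≫ proj v M x hx := by
  induction L with
  | nil =>
    rw [app_nil, leftUnitor_eq_snd]
    rfl
  | cons a L ih =>
    rw [app_cons]
    rw [List.mem_cons, not_or] at hL
    have h1 : ((α_ (v a) (tens (L.map v)) (tens (M.map v))).hom ≫ v a ◁ app v L M) ≫
        sndHom _ _ ≫ proj v (L ++ M) x (List.mem_append_right _ hx) =
          sndHom _ _ ≫ proj v M x hx := by
      rw [Category.assoc, ← Category.assoc (v a ◁ app v L M), whiskerLeft_snd, Category.assoc,
        ih hL.2, ← Category.assoc, associator_snd, ← Category.assoc, whiskerRight_snd]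
    exact (congrArg (_ ≫ ·)
      (proj_tail v (L := L ++ M) h (List.mem_append_right _ hx) hL.1)).trans h1

/-- Iterated coassociativity; the components need not be deterministic. -/
theorem lift_append {X : C} (L M : List A) (g : ∀ x ∈ L ++ M, X ⟶ v x) :
    lift v (L ++ M) g = pair (lift v L fun x hx => g x (List.mem_append_left _ hx))
      (lift v M fun x hx => g x (List.mem_append_right _ hx)) ≫ app v L M := by
  induction L with
  | nil =>
    rw [app_nil]
    exact (discard_pair _).symm
  | cons a L ih =>
    rw [app_cons]
    have h : pair (pair (g a List.mem_cons_self) (lift v L fun x hx => g x (List.mem_cons_of_mem _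
          (List.mem_append_left _ hx)))) (lift v M fun x hx => g x (List.mem_append_right _ hx)) ≫
        (α_ (v a) (tens (L.map v)) (tens (M.map v))).hom ≫ v a ◁ app v L M =
          pair (g a List.mem_cons_self)
            (lift v (L ++ M) fun x hx => g x (List.mem_cons_of_mem _ hx)) := by
      rw [← Category.assoc, pair_assoc, pair_whiskerLeft, ih fun x hx => g x (List.mem_cons_of_mem _ hx)]
    exact h.symm

theorem lift_map (k : B → A) {X : C} (L : List B) (g : ∀ x ∈ L.map k, X ⟶ v x)
    (h : tens ((L.map k).map v) = tens (L.map (v ∘ k))) :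
    lift v (L.map k) g ≫ eqToHom h =
      lift (v ∘ k) L fun x hx => g (k x) (List.mem_map_of_mem hx) := by
  induction L with
  | nil => exact Category.comp_id _
  | cons a L ih =>
    have h' : tens ((L.map k).map v) = tens (L.map (v ∘ k)) := by rw [List.map_map]
    have e : eqToHom h = v (k a) ◁ eqToHom h' := by
      rw [whiskerLeft_eqToHom]
      rfl
    rw [e]
    exact (pair_whiskerLeft _ _ _).trans (congrArg _ (ih _ h'))

end Lists

/-! ## Rearrangements -/

section Rearrange

variable {C : Type u₁} [Category.{v₁} C] [MonoidalCategory C] [CopyDiscardCategory C]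
  {A : Type u} {B : Type v} (v : A → C)

/-- The rearrangement with components the projections to `h x`, for `x` in `L`. -/
noncomputable def rel (h : B → A) (M : List A) (L : List B) (hs : ∀ x ∈ L, h x ∈ M) :
    tens (M.map v) ⟶ tens (L.map (v ∘ h)) :=
  lift (v ∘ h) L fun x hx => proj v M (h x) (hs x hx)

/-- The rearrangement with components the projections to `x`, for `x` in `L`. -/
noncomputable def sel (M L : List A) (hs : L ⊆ M) : tens (M.map v) ⟶ tens (L.map v) :=
  lift v L fun x hx => proj v M x (hs hx)

variable [IsStrict C]

instance isComonHom_rel (h : B → A) (M : List A) (L : List B) (hs : ∀ x ∈ L, h x ∈ M) :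
    IsComonHom (rel v h M L hs) := isComonHom_lift _ _ _ fun _ _ => isComonHom_proj v _ _ _

instance isComonHom_sel (M L : List A) (hs : L ⊆ M) : IsComonHom (sel v M L hs) :=
  isComonHom_lift _ _ _ fun _ _ => inferInstance

theorem rel_proj (h : B → A) (M : List A) (L : List B) (hs : ∀ x ∈ L, h x ∈ M) (x : B)
    (hx : x ∈ L) : rel v h M L hs ≫ proj (v ∘ h) L x hx = proj v M (h x) (hs x hx) :=
  lift_proj (v ∘ h) L _ (fun _ _ => isComonHom_proj v _ _ _) x hx

theorem sel_proj (M L : List A) (hs : L ⊆ M) (x : A) (hx : x ∈ L) :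
    sel v M L hs ≫ proj v L x hx = proj v M x (hs hx) :=
  lift_proj v L _ (fun _ _ => inferInstance) x hx

/-- The first selection is deterministic, so it slides into the second one and meets each projection
separately. -/
theorem sel_sel (M L K : List A) (h : L ⊆ M) (h' : K ⊆ L) :
    sel v M L h ≫ sel v L K h' = sel v M K (List.Subset.trans h' h) := by
  rw [sel.eq_def v L K, comp_lift, sel.eq_def v M K]
  congr
  funext x hx
  exact sel_proj v M L h x (h' hx)

theorem rel_sel (h : B → A) (M : List A) (L K : List B) (hs : ∀ x ∈ L, h x ∈ M) (h' : K ⊆ L) :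
    rel v h M L hs ≫ sel (v ∘ h) L K h' = rel v h M K fun x hx => hs x (h' hx) := by
  rw [sel, comp_lift, rel]
  congr
  funext x hx
  exact rel_proj v h M L hs x (h' hx)

theorem sel_map (h : B → A) (M : List A) (L : List B) (hs : ∀ x ∈ L, h x ∈ M)
    (hs' : L.map h ⊆ M) (e : tens ((L.map h).map v) = tens (L.map (v ∘ h))) :
    sel v M (L.map h) hs' ≫ eqToHom e = rel v h M L hs :=
  lift_map v h L _ e

theorem sel_self {L : List A} (hL : L.Nodup) : sel v L L (List.Subset.refl L) = 𝟙 _ :=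
  lift_proj_self v hL

theorem sel_left {L M : List A} (hL : L.Nodup) :
    sel v (L ++ M) L (List.subset_append_left L M) = unapp v L M ≫ fstHom _ _ := by
  refine tens_hom_ext v hL inferInstance inferInstance fun x hx => ?_
  rw [sel_proj, Category.assoc, ← app_proj_left v L M x hx (List.mem_append_left _ hx),
    ← Category.assoc, unapp_app, Category.id_comp]

theorem sel_right {L M : List A} (hL : (L ++ M).Nodup) :
    sel v (L ++ M) M (List.subset_append_right L M) = unapp v L M ≫ sndHom _ _ := by
  rw [List.nodup_append'] at hL
  refine tens_hom_ext v hL.2.1 inferInstance inferInstance fun x hx => ?_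
  rw [sel_proj, Category.assoc, ← app_proj_right v L M x hx (fun h => hL.2.2 h hx)
    (List.mem_append_right _ hx), ← Category.assoc, unapp_app, Category.id_comp]

theorem sel_append (K L M : List A) (h : L ++ M ⊆ K) : sel v K (L ++ M) h =
    pair (sel v K L (List.Subset.trans (List.subset_append_left L M) h))
      (sel v K M (List.Subset.trans (List.subset_append_right L M) h)) ≫ app v L M :=
  lift_append v L M _

theorem eqToHom_proj (h : B → A) {L : List B} (hL : (L.map h).Nodup)
    (e : tens ((L.map h).map v) = tens (L.map (v ∘ h))) (x : B) (hx : x ∈ L) :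
    eqToHom e ≫ proj (v ∘ h) L x hx = proj v (L.map h) (h x) (List.mem_map_of_mem hx) := by
  rw [← rel_proj v h (L.map h) L (fun x hx => List.mem_map_of_mem hx) x hx,
    ← sel_map v h (L.map h) L _ (List.Subset.refl _) e, sel_self v hL, Category.id_comp]

/-- The entries of `K` are matched with their own images and those of `L` are looked up in `M`. As
the concatenations are repetition-free, no lookup crosses over, and the rearrangement is block
diagonal. -/
theorem rel_append (h : B → A) {M : List A} {K L : List B} (hM : (K.map h ++ M).Nodup)
    (hL : (K ++ L).Nodup) (hs : ∀ x ∈ L, h x ∈ M) (hs' : ∀ x ∈ K ++ L, h x ∈ K.map h ++ M)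
    (e : tens ((K.map h).map v) = tens (K.map (v ∘ h))) :
    rel v h (K.map h ++ M) (K ++ L) hs' =
      unapp v (K.map h) M ≫ (eqToHom e ⊗ₘ rel v h M L hs) ≫ app (v ∘ h) K L := by
  rw [List.nodup_append'] at hM
  refine tens_hom_ext _ hL inferInstance inferInstance fun x hx => ?_
  rw [rel_proj, Category.assoc, Category.assoc]
  by_cases hK : x ∈ K
  · rw [app_proj_left (v ∘ h) K L x hK hx, ← Category.assoc (_ ⊗ₘ _), tensorHom_fst,
      Category.assoc, eqToHom_proj v h hM.1 e x hK,
      ← app_proj_left v (K.map h) M (h x) (List.mem_map_of_mem hK) (hs' x hx), ← Category.assoc,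
      unapp_app, Category.id_comp]
  · have hL' : x ∈ L := (List.mem_append.1 hx).resolve_left hK
    rw [app_proj_right (v ∘ h) K L x hL' hK hx, ← Category.assoc (_ ⊗ₘ _), tensorHom_snd,
      Category.assoc, rel_proj,
      ← app_proj_right v (K.map h) M (h x) (hs x hL') (fun h' => hM.2.2 h' (hs x hL')) (hs' x hx),
      ← Category.assoc, unapp_app, Category.id_comp]

/-- Although written with projections, the second factor is just the symmetry on the first two
positions. This is why the identity holds for arbitrary `k`, `k'` and `l`. -/
theorem pair_pair_swap {X Y Z T : C} (k : X ⟶ Y) (k' : X ⟶ Z) (l : X ⟶ T) :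
    pair k' (pair k l) ≫ pair (sndHom _ _ ≫ fstHom _ _) (pair (fstHom _ _) (sndHom _ _ ≫ sndHom _ _))
      = pair k (pair k' l) := by
  have h : pair (sndHom Z (Y ⊗ T) ≫ fstHom Y T) (pair (fstHom Z (Y ⊗ T)) (sndHom _ _ ≫ sndHom _ _))
      = (α_ Z Y T).inv ≫ (β_ Z Y).hom ▷ T ≫ (α_ Y Z T).hom := by
    have h1 : 𝟙 (Z ⊗ (Y ⊗ T)) = pair (fstHom _ _)
        (pair (sndHom Z (Y ⊗ T) ≫ fstHom Y T) (sndHom _ _ ≫ sndHom _ _)) := by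
      rw [comp_fst_snd, pair_fst_snd]
    rw [← Category.id_comp ((α_ Z Y T).inv ≫ _), h1, ← Category.assoc, pair_assoc_inv,
      ← Category.assoc, pair_whiskerRight, pair_braiding, pair_assoc]
  rw [h, ← Category.assoc, pair_assoc_inv, ← Category.assoc, pair_whiskerRight, pair_braiding,
    pair_assoc]

end Rearrange

/-! ## Evaluation of sequences of boxes -/

/-- A set of boxes with lists of inputs and outputs in `A` and values in `C`. -/
structure Net {C : Type u₁} [Category.{v₁} C] [MonoidalCategory C] {A : Type u} (v : A → C) where
  Box : Type u₃
  ins : Box → List A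
  outs : Box → List A
  hom : ∀ b, tens ((ins b).map v) ⟶ tens ((outs b).map v)

namespace Net

variable {C : Type u₁} [Category.{v₁} C] [MonoidalCategory C] [CopyDiscardCategory C] [IsStrict C]
  {A : Type u} {B : Type v} {v : A → C}

/-- Apply a box to the available wires `L` and add its outputs to them. -/
noncomputable def step (N : Net.{u, u₁, v₁, u₃} v) (L : List A) (b : N.Box) (h : N.ins b ⊆ L) :
    tens (L.map v) ⟶ tens ((N.outs b ++ L).map v) :=
  pair (sel v L (N.ins b) h ≫ N.hom b) (𝟙 _) ≫ app v (N.outs b) L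

/-- `Eval N q L bs m` says that, starting with the available wires `L`, the boxes `bs` can be
applied in the given order, that the wires `q` are available afterwards, and that the resulting
morphism is `m`. -/
inductive Eval (N : Net.{u, u₁, v₁, u₃} v) (q : List A) :
    (L : List A) → List N.Box → (tens (L.map v) ⟶ tens (q.map v)) → Prop
  | nil (L : List A) (h : q ⊆ L) : Eval N q L [] (sel v L q h)
  | cons {L : List A} (b : N.Box) {bs : List N.Box} {m : tens ((N.outs b ++ L).map v) ⟶ _}
    (h : N.ins b ⊆ L) (hm : Eval N q (N.outs b ++ L) bs m) : Eval N q L (b :: bs) (N.step L b h ≫ m)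

/-- The wires `L` and the outputs of the boxes `bs` are pairwise distinct. -/
def Fresh (N : Net.{u, u₁, v₁, u₃} v) (L : List A) (bs : List N.Box) : Prop :=
  (bs.flatMap N.outs ++ L).Nodup

theorem Fresh.cons {N : Net.{u, u₁, v₁, u₃} v} {L : List A} {b : N.Box} {bs : List N.Box}
    (h : N.Fresh L (b :: bs)) : N.Fresh (N.outs b ++ L) bs := by
  refine (List.Perm.nodup_iff ?_).1 h
  rw [List.flatMap_cons, ← List.append_assoc]
  exact List.perm_append_comm.append_right L

theorem Fresh.nodup {N : Net.{u, u₁, v₁, u₃} v} {L : List A} {bs : List N.Box}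
    (h : N.Fresh L bs) : L.Nodup := (List.nodup_append'.1 h).2.1

theorem Fresh.perm {N : Net.{u, u₁, v₁, u₃} v} {L : List A} {bs bs' : List N.Box}
    (h : N.Fresh L bs) (e : bs.Perm bs') : N.Fresh L bs' :=
  (List.Perm.nodup_iff ((e.flatMap_right N.outs).append_right L)).1 h

theorem Eval.cast {N : Net.{u, u₁, v₁, u₃} v} {q q' L L' : List A} {bs bs' : List N.Box}
    {m : tens (L.map v) ⟶ tens (q.map v)} (hm : N.Eval q L bs m) (hL : L = L') (hb : bs = bs')
    (hq : q = q') :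
    N.Eval q' L' bs' (eqToHom (by rw [hL]) ≫ m ≫ eqToHom (by rw [hq])) := by
  subst hL hb hq
  rwa [eqToHom_refl, eqToHom_refl, Category.comp_id, Category.id_comp]

/-! ### Transport of evaluations along maps of nets. -/

/-- A map of nets along a map of wires. -/
structure Map {h : B → A} (N : Net.{v, u₁, v₁, u₂} (v ∘ h)) (N' : Net.{u, u₁, v₁, u₃} v) where
  box : N.Box → N'.Box
  ins_box : ∀ b, N'.ins (box b) = (N.ins b).map h
  outs_box : ∀ b, N'.outs (box b) = (N.outs b).map h
  hom_box : ∀ b, N'.hom (box b) = eqToHom (by rw [ins_box, List.map_map]) ≫ N.hom b ≫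
    eqToHom (by rw [outs_box, List.map_map])

/-- Naturality of a step. A rearrangement is deterministic and so passes through the copy made by
the step; the outputs of the box are new on both sides, so `rel_append` separates them from the old
wires. -/
theorem step_rel {h : B → A} {N : Net.{v, u₁, v₁, u₂} (v ∘ h)} {N' : Net.{u, u₁, v₁, u₃} v}
    (f : Map N N') {M : List A} {L : List B} (b : N.Box) (hi : N.ins b ⊆ L)
    (hi' : N'.ins (f.box b) ⊆ M) (hM : (N'.outs (f.box b) ++ M).Nodup) (hL : (N.outs b ++ L).Nodup)
    (hs : ∀ x ∈ L, h x ∈ M) (hs' : ∀ x ∈ N.outs b ++ L, h x ∈ N'.outs (f.box b) ++ M) :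
    N'.step M (f.box b) hi' ≫ rel v h _ _ hs' = rel v h M L hs ≫ N.step L b hi := by
  -- The input and output lists of `f.box b` become variables, so that the equations `ins_box` and
  -- `outs_box` can be substituted.
  have key : ∀ (i' o' : List A) (ei : i' = (N.ins b).map h) (eo : o' = (N.outs b).map h)
      (g : tens (i'.map v) ⟶ tens (o'.map v)) (hi' : i' ⊆ M) (hM : (o' ++ M).Nodup)
      (hs' : ∀ x ∈ N.outs b ++ L, h x ∈ o' ++ M),
      g = eqToHom (by rw [ei, List.map_map]) ≫ N.hom b ≫ eqToHom (by rw [eo, List.map_map]) →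
      (pair (sel v M i' hi' ≫ g) (𝟙 _) ≫ app v o' M) ≫ rel v h _ _ hs' =
        rel v h M L hs ≫ N.step L b hi := by
    intro i' o' ei eo g hi' hM hs' hg
    subst ei eo hg
    rw [rel_append v h hM hL hs hs' (by rw [List.map_map]), Category.assoc,
      ← Category.assoc (app _ _ _), app_unapp, Category.id_comp, ← Category.assoc, pair_tensorHom,
      step, ← Category.assoc (rel _ _ _ _ _), comp_pair, ← Category.assoc (rel _ _ _ _ _), rel_sel,
      ← sel_map v h M _ _ hi' (by rw [List.map_map])]
    simp
  exact key _ _ (f.ins_box b) (f.outs_box b) _ hi' hM hs' (f.hom_box b)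

/-- An execution can be replayed in another net from a supply `M` that may hold additional wires.
The initial rearrangement is pushed past one step after another by `step_rel` and is finally
absorbed by the selection of outputs. -/
theorem Eval.map {h : B → A} {N : Net.{v, u₁, v₁, u₂} (v ∘ h)} {N' : Net.{u, u₁, v₁, u₃} v}
    (f : Map N N') {q L : List B} {bs : List N.Box} {m : tens (L.map (v ∘ h)) ⟶ _}
    (hm : N.Eval q L bs m) (hL : N.Fresh L bs) (M : List A) (hM : N'.Fresh M (bs.map f.box))
    (hs : ∀ x ∈ L, h x ∈ M) :
    N'.Eval (q.map h) M (bs.map f.box) (rel v h M L hs ≫ m ≫ eqToHom (by rw [List.map_map])) := by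
  induction hm generalizing M with
  | nil L hq =>
    have hq' : q.map h ⊆ M := by
      intro x hx
      obtain ⟨y, hy, rfl⟩ := List.mem_map.1 hx
      exact hs y (hq hy)
    have := Eval.nil (N := N') M hq'
    rw [← Category.assoc, rel_sel, ← sel_map v h M q _ hq' (by rw [List.map_map])]
    simpa using this
  | @cons L b bs m hi hm ih =>
    have hi' : N'.ins (f.box b) ⊆ M := by
      intro x hx
      rw [f.ins_box] at hx
      obtain ⟨y, hy, rfl⟩ := List.mem_map.1 hx
      exact hs y (hi hy)
    have hs' : ∀ x ∈ N.outs b ++ L, h x ∈ N'.outs (f.box b) ++ M := by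
      intro x hx
      rcases List.mem_append.1 hx with hx | hx
      · refine List.mem_append_left _ ?_
        rw [f.outs_box]
        exact List.mem_map_of_mem hx
      · exact List.mem_append_right _ (hs x hx)
    have := Eval.cons (f.box b) hi' (ih hL.cons _ hM.cons hs')
    rw [← Category.assoc, step_rel f b hi hi' hM.cons.nodup hL.cons.nodup hs hs'] at this
    simpa using this

/-- The identity map of a net. -/
def Map.id (N : Net.{u, u₁, v₁, u₃} v) : Map (h := fun x : A => x) N N where
  box b := b
  ins_box b := (List.map_id _).symm
  outs_box b := (List.map_id _).symm
  hom_box b := by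
    simp only [eqToHom_refl]
    exact ((Category.id_comp _).trans (Category.comp_id _)).symm

/-- Weakening and reordering of the supply of wires: the case of the identity map of nets. -/
theorem Eval.sel {N : Net.{u, u₁, v₁, u₃} v} {q L : List A} {bs : List N.Box}
    {m : tens (L.map v) ⟶ tens (q.map v)} (hm : N.Eval q L bs m) (hL : N.Fresh L bs)
    (M : List A) (hM : N.Fresh M bs) (hs : L ⊆ M) : N.Eval q M bs (sel v M L hs ≫ m) := by
  have := (Eval.map (Map.id N) hm hL M (by simpa [Map.id] using hM) fun x hx => hs hx).cast rfl
    (List.map_id _) (List.map_id _)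
  convert this using 1
  simp only [eqToHom_refl, Category.id_comp, Category.assoc, eqToHom_trans, Category.comp_id]
  rfl

/-- The inputs of `b'` already lie in `L`, so the second step ignores the outputs of `b`. By
`pair_id_comp_pair` both boxes then act on copies of the same state. -/
theorem step_step (N : Net.{u, u₁, v₁, u₃} v) (L : List A) (b b' : N.Box) (h : N.ins b ⊆ L)
    (h' : N.ins b' ⊆ L) (h'' : N.ins b' ⊆ N.outs b ++ L) (hL : (N.outs b ++ L).Nodup) :
    N.step L b h ≫ N.step (N.outs b ++ L) b' h'' =
      pair (sel v L (N.ins b') h' ≫ N.hom b') (pair (sel v L (N.ins b) h ≫ N.hom b) (𝟙 _)) ≫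
        tens ((N.outs b').map v) ◁ app v (N.outs b) L ≫ app v (N.outs b') (N.outs b ++ L) := by
  have h1 : sel v (N.outs b ++ L) (N.ins b') h'' ≫ N.hom b' =
      unapp v _ _ ≫ sndHom _ _ ≫ sel v L (N.ins b') h' ≫ N.hom b' := by
    rw [← sel_sel v _ _ _ (List.subset_append_right _ _) h', sel_right v hL]
    simp
  rw [← pair_id_comp_pair, step, step, h1]
  have h2 : app v (N.outs b) L ≫ pair (unapp v _ _ ≫ sndHom _ _ ≫ sel v L (N.ins b') h' ≫ N.hom b')
      (𝟙 _) = pair (sndHom _ _ ≫ sel v L (N.ins b') h' ≫ N.hom b') (𝟙 _) ≫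
        tens ((N.outs b').map v) ◁ app v (N.outs b) L := by
    rw [comp_pair, ← Category.assoc, app_unapp, Category.id_comp, pair_whiskerLeft,
      Category.comp_id, Category.id_comp]
  rw [Category.assoc, ← Category.assoc (app _ _ _), h2]
  simp

/-- Exchange of two enabled boxes. By `step_step`, either order yields the triple of the two box
values and the old state, with the first two entries interchanged. Modulo concatenation of lists,
the selection is this interchange (`key`), and `pair_pair_swap` applies to arbitrary box values. -/
theorem step_step_sel (N : Net.{u, u₁, v₁, u₃} v) (L : List A) (b b' : N.Box) (h : N.ins b ⊆ L)
    (h' : N.ins b' ⊆ L) (hb : N.ins b ⊆ N.outs b' ++ L) (hb' : N.ins b' ⊆ N.outs b ++ L)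
    (hL : (N.outs b' ++ (N.outs b ++ L)).Nodup)
    (hs : N.outs b ++ (N.outs b' ++ L) ⊆ N.outs b' ++ (N.outs b ++ L)) :
    N.step L b h ≫ N.step (N.outs b ++ L) b' hb' ≫ sel v _ _ hs =
      N.step L b' h' ≫ N.step (N.outs b' ++ L) b hb := by
  have h1 := List.nodup_append'.1 hL
  have h2 := List.nodup_append'.1 h1.2.1
  have h3 : (N.outs b' ++ L).Nodup := List.nodup_append'.2
    ⟨h1.1, h2.2.1, fun x hx hx' => h1.2.2 hx (List.mem_append_right _ hx')⟩
  have key : sel v (N.outs b' ++ (N.outs b ++ L)) (N.outs b ++ (N.outs b' ++ L)) hs =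
      unapp v _ _ ≫ _ ◁ unapp v _ _ ≫ pair (sndHom _ _ ≫ fstHom _ _)
        (pair (fstHom _ _) (sndHom _ _ ≫ sndHom _ _)) ≫ _ ◁ app v _ _ ≫ app v _ _ := by
    rw [sel_append, sel_append, ← sel_sel v _ (N.outs b ++ L) (N.outs b)
      (List.subset_append_right _ _) (List.subset_append_left _ _),
      ← sel_sel v _ (N.outs b ++ L) L
      (List.subset_append_right _ _) (List.subset_append_right _ _), sel_right v hL,
      sel_left v h1.1, sel_left v h2.1, sel_right v h1.2.1, ← pair_whiskerLeft, Category.assoc]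
    simp only [← Category.assoc]
    congr 2
    have e1 : (unapp v (N.outs b') (N.outs b ++ L) ≫ _ ◁ unapp v (N.outs b) L) ≫ sndHom _ _ =
        (unapp v _ _ ≫ sndHom _ _) ≫ unapp v _ _ := by
      rw [Category.assoc, whiskerLeft_snd, Category.assoc]
    have e2 : (unapp v (N.outs b') (N.outs b ++ L) ≫ _ ◁ unapp v (N.outs b) L) ≫ fstHom _ _ =
        unapp v _ _ ≫ fstHom _ _ := by
      rw [Category.assoc, whiskerLeft_fst]
    rw [comp_pair, comp_pair, ← Category.assoc (_ ≫ _ ◁ _), ← Category.assoc (_ ≫ _ ◁ _), e1, e2]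
  rw [← Category.assoc, step_step N L b b' h h' hb' h1.2.1, step_step N L b' b h' h hb h3, key]
  rw [← pair_pair_swap (sel v L (N.ins b) h ≫ N.hom b) (sel v L (N.ins b') h' ≫ N.hom b')]
  simp only [Category.assoc]
  rw [← Category.assoc (app _ _ _) (unapp _ _ _), app_unapp, Category.id_comp,
    ← Category.assoc (_ ◁ _) (_ ◁ _), ← MonoidalCategory.whiskerLeft_comp, app_unapp,
    MonoidalCategory.whiskerLeft_id, Category.id_comp, ← Category.assoc, pair_pair_swap,
    ← Category.assoc]

/-- Induction on the boxes run before `b`: since `b` is already enabled, it first moves to the front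
of the tail, and is then exchanged with `c`. The exchange permutes the available wires, which
`Eval.sel` compensates. -/
theorem Eval.front {N : Net.{u, u₁, v₁, u₃} v} {q : List A} (b : N.Box) (r : List N.Box) :
    ∀ (s : List N.Box) {L : List A} {m : tens (L.map v) ⟶ tens (q.map v)},
      N.Eval q L (s ++ b :: r) m → N.ins b ⊆ L → N.Fresh L (s ++ b :: r) →
        N.Eval q L (b :: (s ++ r)) m := by
  intro s
  induction s with
  | nil => exact fun h _ _ => h
  | cons c s ih =>
    intro L m hm hb hL
    cases hm with
    | cons _ hc hm =>
    have hb' : N.ins b ⊆ N.outs c ++ L := List.Subset.trans hb (List.subset_append_right _ _)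
    have hc' : N.ins c ⊆ N.outs b ++ L := List.Subset.trans hc (List.subset_append_right _ _)
    have hF : N.Fresh L (c :: b :: (s ++ r)) := hL.perm (List.perm_middle.cons c)
    have hF' : N.Fresh L (b :: c :: (s ++ r)) := hF.perm (List.Perm.swap _ _ _)
    cases ih hm hb' hL.cons with
    | cons _ _ hm' =>
    have hs : N.outs b ++ (N.outs c ++ L) ⊆ N.outs c ++ (N.outs b ++ L) := by
      intro x
      simp only [List.mem_append]
      tauto
    have := Eval.cons b hb (Eval.cons c hc' (hm'.sel hF.cons.cons _ hF'.cons.cons hs))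
    rwa [← Category.assoc (N.step _ _ _), ← Category.assoc, Category.assoc (N.step _ _ _),
      step_step_sel N L b c hb hc hb' hc'
      hF'.cons.cons.nodup hs, Category.assoc] at this

/-- The value does not depend on the order of the boxes. -/
theorem Eval.unique {N : Net.{u, u₁, v₁, u₃} v} {q : List A} : ∀ (bs : List N.Box) {L : List A}
    {bs' : List N.Box} {m m' : tens (L.map v) ⟶ tens (q.map v)}, N.Eval q L bs m →
      N.Eval q L bs' m' → bs.Perm bs' → N.Fresh L bs → m = m' := by
  intro bs
  induction bs with
  | nil =>
    intro L bs' m m' h h' e _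
    obtain rfl := e.nil_eq
    obtain ⟨⟩ := h
    obtain ⟨⟩ := h'
    rfl
  | cons b bs ih =>
    intro L bs' m m' h h' e hL
    -- The second order is rewritten to begin with `b` as well; the tails are then compared from the
    -- same supply of wires.
    obtain ⟨s, r, rfl⟩ := List.append_of_mem (e.subset List.mem_cons_self)
    cases h with
    | cons _ hb hm =>
    cases Eval.front b r s h' hb (hL.perm e) with
    | cons _ _ hm' =>
    rw [ih hm hm' (List.perm_cons b |>.1 (e.trans List.perm_middle)) hL.cons]

/-! ### Sequential and parallel composition of evaluations. -/

/-- Vertical composition. -/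
theorem Eval.comp {h : B → A} {N : Net.{v, u₁, v₁, u₂} (v ∘ h)} {N' : Net.{u, u₁, v₁, u₃} v}
    (f : Map N N') {q L : List A} {bs : List N'.Box} {m : tens (L.map v) ⟶ tens (q.map v)}
    (hm : N'.Eval q L bs m) {r s : List B} {cs : List N.Box} {n : tens (r.map (v ∘ h)) ⟶ _}
    (hn : N.Eval s r cs n) (hr : N.Fresh r cs) (hL : N'.Fresh L (bs ++ cs.map f.box))
    (e : q = r.map h) :
    N'.Eval (s.map h) L (bs ++ cs.map f.box) (m ≫ eqToHom (by rw [e, List.map_map]) ≫ n ≫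
      eqToHom (by rw [List.map_map])) := by
  induction hm with
  -- The final selection of the first execution becomes the initial rearrangement of the second,
  -- which is replayed from the full supply `L`.
  | nil L hq =>
    subst e
    have := hn.map f hr L hL fun x hx => hq (List.mem_map_of_mem hx)
    rw [← Category.assoc, sel_map v h L r _ hq]
    exact this
  | @cons L b bs m hi hm ih =>
    rw [Category.assoc]
    exact Eval.cons b hi (ih hL.cons)

/-- The box reads only from `L`, so by `pair_fst_comp_id` the block `M` passes along unchanged. -/
theorem step_append (N : Net.{u, u₁, v₁, u₃} v) (L M : List A) (b : N.Box) (h : N.ins b ⊆ L)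
    (h' : N.ins b ⊆ L ++ M) (hL : L.Nodup) :
    N.step (L ++ M) b h' ≫ eqToHom (by rw [List.append_assoc]) =
      unapp v L M ≫ N.step L b h ▷ tens (M.map v) ≫ app v (N.outs b ++ L) M := by
  have h1 : sel v (L ++ M) (N.ins b) h' ≫ N.hom b =
      unapp v _ _ ≫ fstHom _ _ ≫ sel v L (N.ins b) h ≫ N.hom b := by
    rw [← sel_sel v _ _ _ (List.subset_append_left _ _) h, sel_left v hL]
    simp
  have h2 : pair (unapp v L M ≫ fstHom _ _ ≫ sel v L (N.ins b) h ≫ N.hom b) (𝟙 _) =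
      unapp v L M ≫ pair (fstHom _ _ ≫ sel v L (N.ins b) h ≫ N.hom b) (𝟙 _) ≫
        _ ◁ app v L M := by
    rw [pair_whiskerLeft, comp_pair, Category.id_comp, unapp_app]
  rw [step, step, h1, h2, pair_fst_comp_id]
  simp [app, unapp, IsStrict.associator_hom, whiskerLeft_eqToHom, eqToHom_whiskerRight]

/-- Whiskering. -/
theorem Eval.whisker {N : Net.{u, u₁, v₁, u₃} v} {q L : List A} {bs : List N.Box}
    {m : tens (L.map v) ⟶ tens (q.map v)} (hm : N.Eval q L bs m) (M : List A)
    (hL : N.Fresh (L ++ M) bs) :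
    N.Eval (q ++ M) (L ++ M) bs (unapp v L M ≫ m ▷ tens (M.map v) ≫ app v q M) := by
  induction hm with
  | nil L hq =>
    have := Eval.nil (N := N) (q := q ++ M) (L ++ M) (List.append_subset.2
      ⟨List.Subset.trans hq (List.subset_append_left _ _), List.subset_append_right _ _⟩)
    have hL' := List.nodup_append'.1 hL.nodup
    rw [sel_append, sel_right v hL.nodup, ← sel_sel v _ _ _ (List.subset_append_left _ _) hq,
      sel_left v hL'.1, Category.assoc, ← comp_pair, ← pair_whiskerRight, pair_fst_snd] at this
    simpa using this
  | @cons L b bs m hi hm ih =>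
    have hi' : N.ins b ⊆ L ++ M := List.Subset.trans hi (List.subset_append_left _ _)
    have hF : N.Fresh (N.outs b ++ L ++ M) bs := by
      rw [List.append_assoc]
      exact hL.cons
    have := Eval.cons b hi' ((ih hF).cast (List.append_assoc _ _ _) rfl rfl)
    rw [← Category.assoc, step_append N L M b hi hi' (List.nodup_append'.1 hL.nodup).1] at this
    simpa using this

end Net

/-! ## The net of a labelled hypergraph -/

namespace Hyp

/-- The map of boxes induced by a morphism of hypergraphs. -/
def Hom.onBox {G : Hyp.{u, v}} {H : Hyp.{u₁, v₁}} (f : G.Hom H) (b : G.Box) : H.Box :=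
  ⟨b.1, b.2.1, f.box b.2.2⟩

/-- The list of inputs of a box. -/
def inList (G : Hyp.{u, v}) (b : G.Box) : List G.W := List.ofFn (G.inp b.2.2)

/-- The list of outputs of a box. -/
def outList (G : Hyp.{u, v}) (b : G.Box) : List G.W := List.ofFn (G.out b.2.2)

theorem Hom.inList_onBox {G : Hyp.{u, v}} {H : Hyp.{u₁, v₁}} (f : G.Hom H) (b : G.Box) :
    H.inList (f.onBox b) = (G.inList b).map f.wire := by
  rw [inList, inList, List.map_ofFn]
  exact congrArg List.ofFn (funext (f.inp_box b.2.2))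

theorem Hom.outList_onBox {G : Hyp.{u, v}} {H : Hyp.{u₁, v₁}} (f : G.Hom H) (b : G.Box) :
    H.outList (f.onBox b) = (G.outList b).map f.wire := by
  rw [outList, outList, List.map_ofFn]
  exact congrArg List.ofFn (funext (f.out_box b.2.2))

theorem Hom.onBox_injective {G : Hyp.{u, v}} {H : Hyp.{u₁, v₁}} (f : G.Hom H)
    (hf : ∀ k l, Function.Injective (f.box : G.B k l → H.B k l)) : Function.Injective f.onBox := by
  rintro ⟨k, l, b⟩ ⟨k', l', b'⟩ h
  obtain ⟨rfl, h⟩ := Sigma.mk.inj_iff.1 h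
  obtain ⟨rfl, h⟩ := Sigma.mk.inj_iff.1 (eq_of_heq h)
  exact congrArg (fun x => (⟨k, l, x⟩ : G.Box)) (hf _ _ (eq_of_heq h))

/-- Left monogamy gives every wire a single origin. This is the source of all freshness hypotheses
for evaluations of diagrams. -/
theorem LeftMono.nodup_flatMap {G : Hyp.{u, v}} {p : List G.W} (hp : G.LeftMono p)
    {bs : List G.Box} (h : bs.Nodup) : (bs.flatMap G.outList ++ p).Nodup := by
  refine List.nodup_append'.2 ⟨List.nodup_flatMap.2 ⟨fun b _ => ?_, ?_⟩, hp.nodup, ?_⟩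
  · refine List.nodup_ofFn.2 fun i j h => ?_
    have := hp.inj _ _ _ _ h
    exact eq_of_heq (Sigma.mk.inj_iff.1 this).2
  · refine h.imp fun {b b'} hb => ?_
    intro x hx hx'
    obtain ⟨j, hj⟩ := (List.mem_ofFn' _ _).1 hx
    obtain ⟨j', hj'⟩ := (List.mem_ofFn' _ _).1 hx'
    exact hb (Sigma.mk.inj_iff.1 (hp.inj b.2.2 j b'.2.2 j' (hj.trans hj'.symm))).1
  · intro x hx hx'
    obtain ⟨b, -, hb⟩ := List.mem_flatMap.1 hx
    obtain ⟨j, rfl⟩ := (List.mem_ofFn' _ _).1 hb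
    exact hp.disj b.2.2 j hx'

/-- Otherwise every remaining box would wait for an unavailable wire, which is itself produced by a
remaining box. Following this backwards is impossible in a finite acyclic hypergraph. -/
theorem exists_enabled {G : Hyp.{u, v}} (hW : Finite G.W) (hG : G.Acyclic) {R : Set G.Box}
    (hR : R.Nonempty) {L : List G.W} (hL : ∀ w, w ∈ L ∨ ∃ b ∈ R, w ∈ G.outList b) :
    ∃ b ∈ R, G.inList b ⊆ L := by
  by_contra! hcon
  -- Acyclicity is irreflexivity of the transitive closure, and a strict order on a finite set is
  -- well-founded.
  have hwf : WellFounded (Relation.TransGen G.Step) :=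
    have : Std.Irrefl (Relation.TransGen G.Step) := ⟨hG⟩
    Finite.wellFounded_of_trans_of_irrefl _
  let U : Set G.W := {w | w ∉ L}
  have key : ∀ b ∈ R, ∃ w ∈ G.inList b, w ∈ U := by
    intro b hb
    have := hcon b hb
    rw [List.subset_def] at this
    push Not at this
    exact this
  obtain ⟨b, hb⟩ := hR
  obtain ⟨w, -, hw⟩ := key b hb
  -- The box that produces a minimal unavailable wire would have an unavailable input preceding it.
  obtain ⟨w, hw, hmin⟩ := hwf.has_min U ⟨w, hw⟩
  obtain ⟨b', hb', hwb⟩ := (hL w).resolve_left hw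
  obtain ⟨w', hw', hU⟩ := key b' hb'
  obtain ⟨i, hi⟩ := (List.mem_ofFn' _ _).1 hw'
  obtain ⟨j, hj⟩ := (List.mem_ofFn' _ _).1 hwb
  exact hmin w' hU (.single (step_iff.2 ⟨_, _, b'.2.2, i, j, hi, hj⟩))

end Hyp

section Semantics

variable {C : Type u₁} [Category.{v₁} C] [MonoidalCategory C] [CopyDiscardCategory C] [IsStrict C]

/-- The objects that label the wires. -/
def val {G : Hyp.{u, v}} (g : G.Hom (hyp C)) : G.W → C := g.wire

theorem tens_ofFn_map {G : Hyp.{u, v}} (g : G.Hom (hyp C)) {k : ℕ} (w : Fin k → G.W)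
    (A : Fin k → C) (h : ∀ i, A i = g.wire (w i)) :
    tens ((List.ofFn w).map (val g)) = tensorFin A := by
  rw [List.map_ofFn, show A = val g ∘ w from funext h]
  rfl

/-- The net given by a hypergraph labelled by the underlying hypergraph of `C`. -/
def netOf {G : Hyp.{u, v}} (g : G.Hom (hyp C)) : Net.{u, u₁, v₁, v} (val g) where
  Box := G.Box
  ins := G.inList
  outs := G.outList
  hom b := eqToHom (tens_ofFn_map g _ _ (g.inp_box b.2.2)) ≫ (g.box b.2.2).2.2 ≫
    eqToHom (tens_ofFn_map g _ _ (g.out_box b.2.2)).symm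

/-- The map of nets induced by a morphism of hypergraphs. -/
def netMap {G : Hyp.{u, v}} {H : Hyp.{u₂, v₂}} (h : G.Hom H) (g : H.Hom (hyp C)) :
    Net.Map (v := val g) (h := h.wire) (netOf (h.comp g)) (netOf g) where
  box := h.onBox
  ins_box := h.inList_onBox
  outs_box := h.outList_onBox
  hom_box b := by
    -- Separates the cancellation of transports from the concrete objects. The similar auxiliary
    -- statements below serve the same purpose.
    have key : ∀ {P Q X Y Z T : C} (x : X ⟶ Y) (h1 : P = X) (h2 : Y = Q) (h3 : P = Z) (h4 : Z = X)
        (h5 : Y = T) (h6 : T = Q), eqToHom h1 ≫ x ≫ eqToHom h2 =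
          eqToHom h3 ≫ (eqToHom h4 ≫ x ≫ eqToHom h5) ≫ eqToHom h6 := by
      intros
      simp
    exact key _ _ _ _ _ _ _

theorem rel_map_self {A : Type u} {B : Type v} (v : A → C) (h : B → A) {L : List B}
    (hL : (L.map h).Nodup) :
    rel v h (L.map h) L (fun _ hx => List.mem_map_of_mem hx) = eqToHom (by rw [List.map_map]) := by
  rw [← sel_map v h _ L _ (List.Subset.refl _) (by rw [List.map_map]), sel_self v hL,
    Category.id_comp]

theorem Eval.transfer {G : Hyp.{u, v}} {H : Hyp.{u₂, v₂}} (h : G.Hom H) {g : G.Hom (hyp C)}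
    {g' : H.Hom (hyp C)} (e : h.comp g' = g) {q L : List G.W} {bs : List G.Box}
    {m : tens (L.map (val g)) ⟶ tens (q.map (val g))} (hm : (netOf g).Eval q L bs m)
    (hL : (netOf g).Fresh L bs) (hM : (netOf g').Fresh (L.map h.wire) (bs.map h.onBox)) :
    (netOf g').Eval (q.map h.wire) (L.map h.wire) (bs.map h.onBox)
      (eqToHom (by rw [← e, List.map_map]; rfl) ≫ m ≫
        eqToHom (by rw [← e, List.map_map]; rfl)) := by
  subst e
  have := Net.Eval.map (netMap h g') hm hL _ hM (fun _ hx => List.mem_map_of_mem hx)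
  rw [rel_map_self (val g') h.wire hM.nodup] at this
  exact this

theorem Eval.comp_transfer {G : Hyp.{u, v}} {H : Hyp.{u₂, v₂}} (h : G.Hom H) {g : G.Hom (hyp C)}
    {g' : H.Hom (hyp C)} (e : h.comp g' = g) {q L : List H.W} {bs : List H.Box}
    {m : tens (L.map (val g')) ⟶ tens (q.map (val g'))} (hm : (netOf g').Eval q L bs m)
    {r s : List G.W} {cs : List G.Box} {n : tens (r.map (val g)) ⟶ tens (s.map (val g))}
    (hn : (netOf g).Eval s r cs n) (hr : (netOf g).Fresh r cs)
    (hL : (netOf g').Fresh L (bs ++ cs.map h.onBox)) (e' : q = r.map h.wire) :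
    (netOf g').Eval (s.map h.wire) L (bs ++ cs.map h.onBox)
      (m ≫ eqToHom (by rw [e', ← e, List.map_map]; rfl) ≫ n ≫
        eqToHom (by rw [← e, List.map_map]; rfl)) := by
  subst e
  exact Net.Eval.comp (netMap h g') hm hn hr hL e'

/-- Topological sorting: `R` holds the boxes still to be run, and the invariant is that every wire
is available or will be output by a box of `R`. Once `R` is empty all wires are available, so any
list `q` can be selected. -/
theorem exists_eval {G : Hyp.{u, v}} (hW : Finite G.W) (hG : G.Acyclic) (g : G.Hom (hyp C))
    (q : List G.W) : ∀ (n : ℕ) (R : Finset G.Box) (L : List G.W), R.card = n →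
      (∀ w, w ∈ L ∨ ∃ b ∈ R, w ∈ G.outList b) →
        ∃ bs : List G.Box, bs.Nodup ∧ (∀ b, b ∈ bs ↔ b ∈ R) ∧ ∃ m, (netOf g).Eval q L bs m := by
  classical
  intro n
  induction n with
  | zero =>
    intro R L hR hL
    obtain rfl := Finset.card_eq_zero.1 hR
    refine ⟨[], List.nodup_nil, by simp, _, Net.Eval.nil L fun w _ => ?_⟩
    simpa using hL w
  | succ n ih =>
    intro R L hR hL
    obtain ⟨b, hb, hi⟩ := Hyp.exists_enabled hW hG (R := R)
      (Finset.coe_nonempty.2 (Finset.card_pos.1 (by omega))) hL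
    obtain ⟨bs, h1, h2, m, hm⟩ := ih (R.erase b) (G.outList b ++ L)
      (by rw [Finset.card_erase_of_mem hb]; omega) (fun w => by
        rcases hL w with h | ⟨c, hc, hw⟩
        · exact Or.inl (List.mem_append_right _ h)
        · by_cases e : c = b
          · exact Or.inl (List.mem_append_left _ (e ▸ hw))
          · exact Or.inr ⟨c, Finset.mem_erase.2 ⟨e, hc⟩, hw⟩)
    refine ⟨b :: bs, List.nodup_cons.2 ⟨fun h => ?_, h1⟩, fun c => ?_, _,
      Net.Eval.cons (N := netOf g) b hi hm⟩
    · exact Finset.notMem_erase _ _ ((h2 b).1 h)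
    · rw [List.mem_cons, h2, Finset.mem_erase]
      by_cases e : c = b
      · subst e
        simpa using hb
      · simp [e]

/-! ## The value of a string diagram -/

variable {S : Hyp.{u, v}} (f : S.Hom (hyp C))

/-- The value of a word. -/
def wordObj (X : List S.W) : C := tens (X.map (val f))

theorem wordObj_eq {G : Hyp.{u₂, v₂}} (l : G.Hom S) {L : List G.W} {X : List S.W}
    (h : L.map l.wire = X) : tens (L.map (val (l.comp f))) = wordObj f X := by
  subst h
  rw [wordObj, List.map_map]
  rfl

/-- `Sem f D m` says that `m` is the value of the diagram `D`, where the generators are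
interpreted by `f`. -/
def Sem {X Y : List S.W} (D : Diagram S X Y) (m : wordObj f X ⟶ wordObj f Y) : Prop :=
  ∃ bs : List D.apex.Box, bs.Nodup ∧ (∀ b, b ∈ bs) ∧ ∃ m',
    (netOf (D.label.comp f)).Eval D.outs D.ins bs m' ∧
      m = eqToHom (wordObj_eq f D.label D.ins_label).symm ≫ m' ≫
        eqToHom (wordObj_eq f D.label D.outs_label)

theorem Sem.exists {X Y : List S.W} (D : Diagram S X Y) : ∃ m, Sem f D m := by
  have := D.finite.boxes
  have := Fintype.ofFinite D.apex.Box
  obtain ⟨bs, h1, h2, m, hm⟩ := exists_eval D.finite.wires D.acyclic (D.label.comp f) D.outs _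
    Finset.univ D.ins rfl (fun w => by
      rcases D.mono.cover w with h | ⟨k, l, b, j, h⟩
      · exact Or.inl h
      · exact Or.inr ⟨⟨k, l, b⟩, Finset.mem_univ _, (List.mem_ofFn' _ _).2 ⟨j, h⟩⟩)
  exact ⟨_, bs, h1, fun b => (h2 b).2 (Finset.mem_univ b), m, hm, rfl⟩

theorem Diagram.fresh {X Y : List S.W} (D : Diagram S X Y) {bs : List D.apex.Box} (h : bs.Nodup)
    (g : D.apex.Hom (hyp C)) : (netOf g).Fresh D.ins bs := D.mono.nodup_flatMap h

variable {f}

/-- Two complete listings of the boxes without repetition are permutations of each other, so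
`Net.Eval.unique` applies. -/
theorem Sem.unique {X Y : List S.W} {D : Diagram S X Y} {m m' : wordObj f X ⟶ wordObj f Y}
    (h : Sem f D m) (h' : Sem f D m') : m = m' := by
  obtain ⟨bs, h1, h2, m, hm, rfl⟩ := h
  obtain ⟨bs', h1', h2', m', hm', rfl⟩ := h'
  rw [hm.unique bs hm' ((List.perm_ext_iff_of_nodup h1 h1').2 fun b => by simp [h2, h2'])
    (D.fresh h1 _)]

theorem Sem.iso {X Y : List S.W} {D E : Diagram S X Y} (e : Diagram.Iso D E)
    {m : wordObj f X ⟶ wordObj f Y} (h : Sem f D m) : Sem f E m := by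
  obtain ⟨a, ha, h1, h2, h3⟩ := e
  obtain ⟨bs, hb, hb', m', hm, rfl⟩ := h
  have hn : (bs.map a.onBox).Nodup := hb.map (a.onBox_injective fun k l => (ha.box k l).1)
  have hF : (netOf (E.label.comp f)).Fresh (D.ins.map a.wire) (bs.map a.onBox) := by
    rw [h2]
    exact E.fresh hn _
  refine ⟨bs.map a.onBox, hn, ?_, _, (Eval.transfer a (g' := E.label.comp f)
    (by rw [← h1]; rfl) hm (D.fresh hb _) hF).cast h2 rfl h3, ?_⟩
  · rintro ⟨k, l, b⟩
    obtain ⟨b, rfl⟩ := (ha.box k l).2 b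
    exact List.mem_map_of_mem (f := a.onBox) (hb' ⟨k, l, b⟩)
  · simp

/-- In the pushout, the boxes of `D` are run before those of `E`. Gluing identifies the outputs of
`D` with the inputs of `E`, so the second execution can start where the first ends. -/
theorem Sem.comp {X Y Z : List S.W} {D : Diagram S X Y} {E : Diagram S Y Z}
    {m : wordObj f X ⟶ wordObj f Y} {n : wordObj f Y ⟶ wordObj f Z} (h : Sem f D m)
    (h' : Sem f E n) : Sem f (D.comp E) (m ≫ n) := by
  obtain ⟨bs, hb, hb', m, hm, rfl⟩ := h
  obtain ⟨cs, hc, hc', n, hn, rfl⟩ := h'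
  let a : D.apex.Hom (D.comp E).apex := FreeGS.pinlHom D.outs E.ins
  let b : E.apex.Hom (D.comp E).apex := FreeGS.pinrHom D.outs E.ins
  have hb1 : (bs.map a.onBox).Nodup := hb.map (a.onBox_injective fun k l => Sum.inl_injective)
  have hc1 : (cs.map b.onBox).Nodup := hc.map (b.onBox_injective fun k l => Sum.inr_injective)
  have hbc : (bs.map a.onBox ++ cs.map b.onBox).Nodup := by
    refine List.nodup_append'.2 ⟨hb1, hc1, fun x hx hx' => ?_⟩
    obtain ⟨⟨k, l, x⟩, -, rfl⟩ := List.mem_map.1 hx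
    obtain ⟨⟨k', l', y⟩, -, h⟩ := List.mem_map.1 hx'
    obtain ⟨rfl, h⟩ := Sigma.mk.inj_iff.1 h
    obtain ⟨rfl, h⟩ := Sigma.mk.inj_iff.1 (eq_of_heq h)
    exact Sum.inr_ne_inl (eq_of_heq h)
  refine ⟨bs.map a.onBox ++ cs.map b.onBox, hbc, ?_, _, Eval.comp_transfer b
    (g' := (D.comp E).label.comp f) rfl (Eval.transfer a (g' := (D.comp E).label.comp f)
    rfl hm (D.fresh hb _) ((D.comp E).fresh hb1 _)) hn (E.fresh hc _) ((D.comp E).fresh hbc _)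
    (Diagram.map_pinl_eq (Diagram.match_length D E)), ?_⟩
  · rintro ⟨k, l, x | x⟩
    · exact List.mem_append_left _ (List.mem_map_of_mem (f := a.onBox) (hb' ⟨k, l, x⟩))
    · exact List.mem_append_right _ (List.mem_map_of_mem (f := b.onBox) (hc' ⟨k, l, x⟩))
  · have key : ∀ {X₀ X₁ X₂ Y₀ Y₁ Y₂ Y₃ Z₀ Z₁ Z₂ : C} (m : X₁ ⟶ Y₁) (n : Y₃ ⟶ Z₁) (h1 : X₀ = X₁)
        (h2 : Y₁ = Y₀) (h3 : Y₀ = Y₃) (h4 : Z₁ = Z₀) (h5 : X₀ = X₂) (h6 : X₂ = X₁) (h7 : Y₁ = Y₂)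
        (h8 : Y₂ = Y₃) (h9 : Z₁ = Z₂) (h10 : Z₂ = Z₀),
        (eqToHom h1 ≫ m ≫ eqToHom h2) ≫ (eqToHom h3 ≫ n ≫ eqToHom h4) =
          eqToHom h5 ≫ ((eqToHom h6 ≫ m ≫ eqToHom h7) ≫ eqToHom h8 ≫ n ≫ eqToHom h9) ≫
            eqToHom h10 := by
      intros
      simp
    exact key _ _ _ _ _ _ _ _ _ _ _ _

theorem wordObj_append (X Y : List S.W) : wordObj f (X ++ Y) = wordObj f X ⊗ wordObj f Y :=
  (tens_map_append (val f) X Y).symm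

/-- The identity contributes no boxes, so the execution for `D` is that for the tensor product, with
the wires of `Z` idle. -/
theorem Sem.whiskerRight {X Y : List S.W} {D : Diagram S X Y} {m : wordObj f X ⟶ wordObj f Y}
    (h : Sem f D m) (Z : List S.W) : Sem f (D.tensor (FreeGS.idDiagram Z))
      (eqToHom (wordObj_append X Z) ≫ m ▷ wordObj f Z ≫ eqToHom (wordObj_append Y Z).symm) := by
  obtain ⟨bs, hb, hb', m, hm, rfl⟩ := h
  let T := D.tensor (FreeGS.idDiagram Z)
  let a : D.apex.Hom T.apex := FreeGS.sinlHom
  have hb1 : (bs.map a.onBox).Nodup := hb.map (a.onBox_injective fun k l => Sum.inl_injective)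
  have hF : (netOf (T.label.comp f)).Fresh (D.ins.map a.wire) (bs.map a.onBox) :=
    (T.fresh hb1 (T.label.comp f)).sublist ((List.sublist_append_left _ _).append_left _)
  refine ⟨bs.map a.onBox, hb1, ?_, _, (Eval.transfer a (g' := T.label.comp f)
    rfl hm (D.fresh hb _) hF).whisker ((FreeGS.idDiagram Z).ins.map Sum.inr) (T.fresh hb1 _), ?_⟩
  · rintro ⟨k, l, x | x⟩
    · exact List.mem_map_of_mem (f := a.onBox) (hb' ⟨k, l, x⟩)
    · exact x.elim
  · have hZ : wordObj f Z =
        tens (((FreeGS.idDiagram Z).ins.map Sum.inr).map (val (T.label.comp f))) := by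
      have h := wordObj_eq f T.label
        (L := (FreeGS.idDiagram Z).ins.map Sum.inr) (X := Z) (by
          rw [List.map_map]
          exact (FreeGS.idDiagram Z).ins_label)
      exact h.symm
    have key : ∀ {X₀ X₁ X₂ Y₀ Y₁ Y₂ Z Z' P Q P' Q' : C} (m : X₁ ⟶ Y₁) (h : Z = Z') (h1 : X₀ = X₁)
        (h2 : Y₁ = Y₀) (h3 : P = X₀ ⊗ Z) (h4 : Y₀ ⊗ Z = Q) (h5 : P = P') (h6 : P' = X₂ ⊗ Z')
        (h7 : X₂ = X₁) (h8 : Y₁ = Y₂) (h9 : Y₂ ⊗ Z' = Q') (h10 : Q' = Q),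
        eqToHom h3 ≫ (eqToHom h1 ≫ m ≫ eqToHom h2) ▷ Z ≫ eqToHom h4 =
          eqToHom h5 ≫ (eqToHom h6 ≫ (eqToHom h7 ≫ m ≫ eqToHom h8) ▷ Z' ≫ eqToHom h9) ≫
            eqToHom h10 := by
      intro X₀ X₁ X₂ Y₀ Y₁ Y₂ Z Z' P Q P' Q' m h
      intros
      subst h
      simp [eqToHom_whiskerRight]
    exact key m hZ _ _ _ _ _ _ _ _ _ _

/-- The empty execution, of which only the final selection remains. -/
theorem Sem.noBox {X Y : List S.W} {D : Diagram S X Y} (h : FreeGS.NoBox D) (h' : D.outs ⊆ D.ins) :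
    Sem f D (eqToHom (wordObj_eq f D.label D.ins_label).symm ≫
      sel (val (D.label.comp f)) D.ins D.outs h' ≫
        eqToHom (wordObj_eq f D.label D.outs_label)) :=
  ⟨[], List.nodup_nil, fun b => (h _ _).elim b.2.2, _, Net.Eval.nil _ h', rfl⟩

end Semantics

/-! ## The strict gs-monoidal functor given by a hypergraph morphism -/

section Interpretation

variable {C : Type u₁} [Category.{v₁} C] [MonoidalCategory C] [CopyDiscardCategory C] [IsStrict C]
  {S : Hyp.{u, v}}

/-! ### Values of the structural diagrams. -/

theorem Sem.id (f : S.Hom (hyp C)) (X : List S.W) : Sem f (FreeGS.idDiagram X) (𝟙 _) := by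
  let T : Diagram S X X := FreeGS.idDiagram X
  have h : Sem f T (eqToHom (wordObj_eq f T.label T.ins_label).symm ≫
      sel (val (T.label.comp f)) T.ins T.ins (List.Subset.refl _) ≫
        eqToHom (wordObj_eq f T.label T.outs_label)) :=
    Sem.noBox (FreeGS.id_noBox X) (List.Subset.refl _)
  rw [sel_self _ T.mono.nodup, Category.id_comp, eqToHom_trans] at h
  exact h

theorem Sem.swap (f : S.Hom (hyp C)) (X Y : List S.W) : Sem f (FreeGS.swapDiagram X Y)
    (eqToHom (wordObj_append X Y) ≫ (β_ (wordObj f X) (wordObj f Y)).hom ≫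
      eqToHom (wordObj_append Y X).symm) := by
  let T : Diagram S _ _ := FreeGS.swapDiagram X Y
  let w := val (T.label.comp f)
  let L : List T.apex.W := (List.finRange X.length).map Sum.inl
  let M : List T.apex.W := (List.finRange Y.length).map Sum.inr
  have hLM : (L ++ M).Nodup := T.mono.nodup
  have hs : M ++ L ⊆ L ++ M := fun x hx => by
    rw [List.mem_append] at hx ⊢
    exact hx.symm
  have h : Sem f T _ := Sem.noBox (f := f) (FreeGS.swap_noBox X Y) hs
  -- Selecting the second block and then the first pairs the marginals in reverse order, and this is
  -- the braiding applied to the pair `fstHom`, `sndHom`.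
  have e : sel w (L ++ M) (M ++ L) hs = unapp w L M ≫ (β_ _ _).hom ≫ app w M L := by
    rw [sel_append, sel_right w hLM, sel_left w (List.nodup_append'.1 hLM).1, ← comp_pair,
      ← pair_braiding, pair_fst_snd, Category.id_comp, Category.assoc]
  have hX : tens (L.map w) = wordObj f X := wordObj_eq f T.label (by
    refine List.map_map.trans ?_
    exact FreeGS.map_finRange_get X)
  have hY : tens (M.map w) = wordObj f Y := wordObj_eq f T.label (by
    refine List.map_map.trans ?_
    exact FreeGS.map_finRange_get Y)
  have key : ∀ {A A' B B' P P' Q Q' : C} (hA : A = A') (hB : B = B') (h1 : P = P') (h2 : P' = A ⊗ B)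
      (h3 : B ⊗ A = Q') (h4 : Q' = Q) (h5 : P = A' ⊗ B') (h6 : B' ⊗ A' = Q),
      eqToHom h5 ≫ (β_ A' B').hom ≫ eqToHom h6 =
        eqToHom h1 ≫ (eqToHom h2 ≫ (β_ A B).hom ≫ eqToHom h3) ≫ eqToHom h4 := by
    intro A A' B B' P P' Q Q' hA hB
    intros
    subst hA hB
    simp
  rw [key hX hY (wordObj_eq f T.label T.ins_label).symm (tens_map_append w L M).symm
    (tens_map_append w M L) (wordObj_eq f T.label T.outs_label)]
  exact e ▸ h

theorem Sem.copy (f : S.Hom (hyp C)) (X : List S.W) : Sem f (FreeGS.copyDiagram X)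
    (Δ[wordObj f X] ≫ eqToHom (wordObj_append X X).symm) := by
  let T : Diagram S _ _ := FreeGS.copyDiagram X
  let w := val (T.label.comp f)
  let L : List T.apex.W := List.finRange X.length
  have hL : L.Nodup := T.mono.nodup
  have hs : L ++ L ⊆ L := List.append_subset.2 ⟨List.Subset.refl _, List.Subset.refl _⟩
  have h : Sem f T _ := Sem.noBox (f := f) (FreeGS.copy_noBox X) hs
  have e : sel w L (L ++ L) hs = Δ[_] ≫ app w L L := by
    rw [sel_append, sel_self w hL, pair_id_id]
  have hX : tens (L.map w) = wordObj f X := wordObj_eq f T.label (FreeGS.map_finRange_get X)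
  have key : ∀ {A A' Q Q' : C} (hA : A = A') (h1 : A' = A) (h3 : A ⊗ A = Q') (h4 : Q' = Q)
      (h6 : A' ⊗ A' = Q),
      Δ[A'] ≫ eqToHom h6 = eqToHom h1 ≫ (Δ[A] ≫ eqToHom h3) ≫ eqToHom h4 := by
    intro A A' Q Q' hA
    intros
    subst hA
    simp
  rw [key hX hX.symm (tens_map_append w L L) (wordObj_eq f T.label T.outs_label)]
  exact e ▸ h

theorem Sem.del (f : S.Hom (hyp C)) (X : List S.W) : Sem f (FreeGS.delDiagram X)
    (ε[wordObj f X] ≫ eqToHom (rfl : 𝟙_ C = wordObj f [])) := by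
  let T : Diagram S _ _ := FreeGS.delDiagram X
  have h : Sem f T _ := Sem.noBox (f := f) (FreeGS.del_noBox X) (List.nil_subset _)
  have hX := wordObj_eq f T.label T.ins_label
  have key : ∀ {A A' : C} (hA : A = A'),
      ε[A'] = eqToHom hA.symm ≫ ε[A] := by
    intro A A' hA
    subst hA
    simp
  rw [key hX, Category.assoc]
  exact h

/-- The value of a morphism. -/
noncomputable def evalHom (f : S.Hom (hyp C)) {X Y : FreeGS S} (g : X ⟶ Y) :
    wordObj f X.word ⟶ wordObj f Y.word :=
  Quotient.lift (fun D => (Sem.exists f D).choose)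
    (fun D E h => ((Sem.exists f D).choose_spec.iso h).unique (Sem.exists f E).choose_spec) g

theorem evalHom_mk {f : S.Hom (hyp C)} {X Y : FreeGS S} {D : Diagram S X.word Y.word}
    {m : wordObj f X.word ⟶ wordObj f Y.word} (h : Sem f D m) : evalHom f (FreeGS.mk D) = m :=
  (Sem.exists f D).choose_spec.unique h

theorem sem_evalHom (f : S.Hom (hyp C)) {X Y : FreeGS S} (D : Diagram S X.word Y.word) :
    Sem f D (evalHom f (FreeGS.mk D)) :=
  (Sem.exists f D).choose_spec

/-- The functor given by a hypergraph morphism. -/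
noncomputable def evalFunctor (f : S.Hom (hyp C)) : FreeGS S ⥤ C where
  obj X := wordObj f X.word
  map := evalHom f
  map_id X := evalHom_mk (Sem.id f X.word)
  map_comp := by
    intro X Y Z g h
    obtain ⟨D, rfl⟩ := FreeGS.mk_surj g
    obtain ⟨E, rfl⟩ := FreeGS.mk_surj h
    exact evalHom_mk ((sem_evalHom f D).comp (sem_evalHom f E))

theorem evalFunctor_obj_tensor (f : S.Hom (hyp C)) (X Y : FreeGS S) :
    (evalFunctor f).obj (X ⊗ Y) = (evalFunctor f).obj X ⊗ (evalFunctor f).obj Y :=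
  wordObj_append X.word Y.word

theorem evalFunctor_whiskerRight (f : S.Hom (hyp C)) {X Y : FreeGS S} (g : X ⟶ Y) (Z : FreeGS S) :
    (evalFunctor f).map (g ▷ Z) = eqToHom (evalFunctor_obj_tensor f X Z) ≫
      (evalFunctor f).map g ▷ (evalFunctor f).obj Z ≫
        eqToHom (evalFunctor_obj_tensor f Y Z).symm := by
  obtain ⟨D, rfl⟩ := FreeGS.mk_surj g
  exact evalHom_mk (X := X ⊗ Z) (Y := Y ⊗ Z) ((sem_evalHom f D).whiskerRight Z.word)

theorem evalFunctor_braiding (f : S.Hom (hyp C)) (X Y : FreeGS S) :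
    (evalFunctor f).map (β_ X Y).hom = eqToHom (evalFunctor_obj_tensor f X Y) ≫
      (β_ ((evalFunctor f).obj X) ((evalFunctor f).obj Y)).hom ≫
        eqToHom (evalFunctor_obj_tensor f Y X).symm :=
  evalHom_mk (X := X ⊗ Y) (Y := Y ⊗ X) (Sem.swap f X.word Y.word)

/-- Evaluation is shown directly to respect right whiskering only; conjugation by the symmetry
supplies the left one, and together they give the tensor product of morphisms. -/
theorem whiskerLeft_eq_braiding {D : Type u₂} [Category.{v₂} D] [MonoidalCategory D]
    [SymmetricCategory D] {X Y : D} (Z : D) (g : X ⟶ Y) :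
    Z ◁ g = (β_ Z X).hom ≫ g ▷ Z ≫ (β_ Y Z).hom := by
  rw [← Category.assoc, ← BraidedCategory.braiding_naturality_right, Category.assoc,
    SymmetricCategory.symmetry, Category.comp_id]

theorem evalFunctor_whiskerLeft (f : S.Hom (hyp C)) {X Y : FreeGS S} (g : X ⟶ Y) (Z : FreeGS S) :
    (evalFunctor f).map (Z ◁ g) = eqToHom (evalFunctor_obj_tensor f Z X) ≫
      (evalFunctor f).obj Z ◁ (evalFunctor f).map g ≫
        eqToHom (evalFunctor_obj_tensor f Z Y).symm := by
  rw [whiskerLeft_eq_braiding, whiskerLeft_eq_braiding, Functor.map_comp, Functor.map_comp,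
    evalFunctor_braiding, evalFunctor_braiding, evalFunctor_whiskerRight]
  simp

/-- The strict gs-monoidal functor given by a hypergraph morphism. -/
noncomputable def evalGSFunctor (f : S.Hom (hyp C)) : StrictGSFunctor (FreeGS S) C where
  toFunctor := evalFunctor f
  obj_unit := rfl
  obj_tensor := evalFunctor_obj_tensor f
  map_tensor g h := by
    rw [MonoidalCategory.tensorHom_def, MonoidalCategory.tensorHom_def, Functor.map_comp, evalFunctor_whiskerRight,
      evalFunctor_whiskerLeft]
    simp
  map_braiding := evalFunctor_braiding f
  map_copy X := evalHom_mk (Y := X ⊗ X) (Sem.copy f X.word)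
  map_del X := evalHom_mk (Y := 𝟙_ (FreeGS S)) (Sem.del f X.word)

/-! ### The interpretation restricts to the given hypergraph morphism. -/

theorem hyp_box_ext {k l : ℕ} {b b' : (hyp C).B k l} (h1 : b.1 = b'.1) (h2 : b.2.1 = b'.2.1)
    (h3 : b.2.2 = eqToHom (by rw [h1]) ≫ b'.2.2 ≫ eqToHom (by rw [h2])) : b = b' := by
  obtain ⟨A, B, m⟩ := b
  obtain ⟨A', B', m'⟩ := b'
  obtain rfl : A = A' := h1
  obtain rfl : B = B' := h2
  obtain rfl : m = m' := by simpa using h3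
  rfl

theorem wordObj_single (f : S.Hom (hyp C)) (w : S.W) : wordObj f [w] = f.wire w :=
  IsStrict.tensor_unit (C := C) (f.wire w)

/-- One step adds the outputs of the box to the supply and the final selection keeps exactly these.
It is a first projection, which recovers the box value by `pair_fst`, even if that value is not
deterministic. -/
theorem Sem.box (f : S.Hom (hyp C)) {k l : ℕ} (b : S.B k l)
    (h1 : wordObj f (tensorFin fun i => FreeGS.single (S.inp b i)).word = tensorFin (f.box b).1)
    (h2 : tensorFin (f.box b).2.1 =
      wordObj f (tensorFin fun i => FreeGS.single (S.out b i)).word) :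
    Sem f (FreeGS.boxDiagram b) (eqToHom h1 ≫ (f.box b).2.2 ≫ eqToHom h2) := by
  let T := FreeGS.boxDiagram b
  let g := T.label.comp f
  let N := netOf g
  let c : T.apex.Box := ⟨k, l, ⟨rfl, rfl⟩⟩
  have hi : T.apex.inList c = T.ins := List.ofFn_eq_map
  have ho : T.apex.outList c = T.outs := List.ofFn_eq_map
  have hi' : N.ins c ⊆ T.ins := fun x hx => hi ▸ hx
  have ho' : T.outs ⊆ N.outs c ++ T.ins := ho ▸ List.subset_append_left _ _
  have hF := T.fresh (bs := [c]) (List.nodup_singleton c) g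
  have hF' : (N.outs c ++ T.ins).Nodup := hF.cons.nodup
  refine ⟨[c], List.nodup_singleton c, ?_, _, Net.Eval.cons (N := N) c hi' (Net.Eval.nil _ ho'), ?_⟩
  · rintro ⟨k', l', ⟨h⟩⟩
    obtain ⟨rfl, rfl⟩ := h
    exact List.mem_singleton_self _
  · have key : ∀ (i o : List T.apex.W) (ei : i = T.ins) (eo : o = T.outs)
        (m : tens (i.map (val g)) ⟶ tens (o.map (val g))) (hi' : i ⊆ T.ins)
        (ho' : T.outs ⊆ o ++ T.ins) (hF' : (o ++ T.ins).Nodup),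
        (pair (sel (val g) T.ins i hi' ≫ m) (𝟙 _) ≫ app (val g) o T.ins) ≫
          sel (val g) (o ++ T.ins) T.outs ho' = eqToHom (by rw [ei]) ≫ m ≫ eqToHom (by rw [eo]) := by
      intro i o ei eo m hi' ho' hF'
      subst ei eo
      rw [sel_self _ T.mono.nodup, sel_left _ (List.nodup_append'.1 hF').1]
      simp [pair_fst]
    have := key _ _ hi ho (N.hom c) hi' ho' hF'
    have key' : ∀ {X X₁ X₂ X₃ Y Y₁ Y₂ Y₃ : C} (m : X ⟶ Y) (h1 : X₁ = X) (h2 : Y = Y₁)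
      (h3 : X₁ = X₂) (h4 : X₂ = X₃) (h5 : X₃ = X) (h6 : Y = Y₃) (h7 : Y₃ = Y₂) (h8 : Y₂ = Y₁),
      eqToHom h1 ≫ m ≫ eqToHom h2 = eqToHom h3 ≫ (eqToHom h4 ≫ (eqToHom h5 ≫ m ≫ eqToHom h6) ≫
        eqToHom h7) ≫ eqToHom h8 := by
      intros
      simp
    refine Eq.trans ?_ (congrArg (fun t => eqToHom _ ≫ t ≫ eqToHom _) this.symm)
    exact key' _ _ _ _ _ _ _ _ _

theorem restrict_evalGSFunctor (f : S.Hom (hyp C)) : restrict (evalGSFunctor f) = f := by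
  apply Hyp.Hom.ext
  · exact funext (wordObj_single f)
  · funext k l b
    have h1 : ((restrict (evalGSFunctor f)).box b).1 = (f.box b).1 := funext fun i =>
      (wordObj_single f _).trans (f.inp_box b i).symm
    have h2 : ((restrict (evalGSFunctor f)).box b).2.1 = (f.box b).2.1 := funext fun i =>
      (wordObj_single f _).trans (f.out_box b i).symm
    refine hyp_box_ext h1 h2 ?_
    have e1 : wordObj f (tensorFin fun i => FreeGS.single (S.inp b i)).word =
        tensorFin (f.box b).1 := by
      rw [← h1]
      exact (evalGSFunctor f).obj_tensorFin _
    have e2 : wordObj f (tensorFin fun i => FreeGS.single (S.out b i)).word =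
        tensorFin (f.box b).2.1 := by
      rw [← h2]
      exact (evalGSFunctor f).obj_tensorFin _
    have h := evalHom_mk (Sem.box f b e1 e2.symm)
    have key : ∀ {X X₁ X₂ Y Y₁ Y₂ : C} (m : X ⟶ Y) (m' : X₁ ⟶ Y₁) (h1 : X = X₁) (h2 : Y₁ = Y)
      (h3 : X₂ = X) (h4 : Y = Y₂) (h5 : X₂ = X₁) (h6 : Y₁ = Y₂),
      m = eqToHom h1 ≫ m' ≫ eqToHom h2 → eqToHom h3 ≫ m ≫ eqToHom h4 =
        eqToHom h5 ≫ m' ≫ eqToHom h6 := by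
      intro _ _ _ _ _ _ m m' _ _ _ _ _ _ h
      rw [h]
      simp
    exact key _ _ _ _ _ _ _ _ h

end Interpretation

/-! ## Generation of string diagrams by boxes and the gs-monoidal structure -/

section Generation

open FreeGS Diagram Hyp

variable {S : Hyp.{u, v}}

/-- The diagrams generated by the boxes under the gs-monoidal operations, up to isomorphism. -/
inductive Generated : ∀ {X Y : List S.W}, Diagram S X Y → Prop
  | iso {X Y : List S.W} {D E : Diagram S X Y} (h : Iso D E) : Generated D → Generated E
  | recast {X Y X' Y' : List S.W} {D : Diagram S X Y} (hX : X = X') (hY : Y = Y') :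
      Generated D → Generated (FreeGS.recast hX hY D)
  | comp {X Y Z : List S.W} {D : Diagram S X Y} {E : Diagram S Y Z} :
      Generated D → Generated E → Generated (D.comp E)
  | tensor {X Y X' Y' : List S.W} {D : Diagram S X Y} {E : Diagram S X' Y'} :
      Generated D → Generated E → Generated (D.tensor E)
  | id (X : List S.W) : Generated (idDiagram X)
  | copy (X : List S.W) : Generated (copyDiagram X)
  | del (X : List S.W) : Generated (delDiagram X)
  | box {k l : ℕ} (b : S.B k l) : Generated (boxDiagram b)

/-- The wiring of a word given by a list of positions. -/
def select (X : List S.W) (o : List (Fin X.length)) : Diagram S X (o.map X.get) :=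
  wiring X.get (List.finRange X.length) o (finRange_spec _) (map_finRange_get X) rfl

/-- All letters but the chosen one are discarded, by recursion along the word. -/
theorem generated_select_singleton : ∀ (X : List S.W) (i : Fin X.length), Generated (select X [i])
  | [], i => i.elim0
  | x :: X, ⟨0, _⟩ => by
    refine Generated.iso ?_ (.tensor (.id [x]) (.del X))
    refine iso_of_noBox ((id_noBox _).tensor (del_noBox _)) wiring_noBox
      (Sum.elim (fun _ => (0 : Fin (X.length + 1))) Fin.succ) ?_ ?_ rfl
    · rintro (i | i)
      · exact congrArg [x].get ((inferInstance : Subsingleton (Fin 1)).elim 0 i)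
      · rfl
    · refine (map_append_map _ Sum.inl Sum.inr _ _).trans ?_
      exact List.finRange_succ.symm
  | x :: X, ⟨i + 1, hi⟩ => by
    refine Generated.iso ?_ (.tensor (.del [x])
      (generated_select_singleton X ⟨i, Nat.lt_of_succ_lt_succ hi⟩))
    refine iso_of_noBox ((del_noBox _).tensor wiring_noBox) wiring_noBox
      (Sum.elim (fun _ => (0 : Fin (X.length + 1))) Fin.succ) ?_ ?_ rfl
    · rintro (i | i)
      · exact congrArg [x].get ((inferInstance : Subsingleton (Fin 1)).elim 0 i)
      · rfl
    · refine (map_append_map _ Sum.inl Sum.inr _ _).trans ?_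
      exact List.finRange_succ.symm

/-- The word is copied once for each selected position, and each copy is reduced to the letter at
that position. -/
theorem generated_select (X : List S.W) : ∀ o : List (Fin X.length), Generated (select X o)
  | [] => .del X
  | i :: o => by
    refine Generated.iso ?_ (.comp (.copy X)
      (.tensor (generated_select_singleton X i) (generated_select X o)))
    refine comp_of_noBox (copy_noBox X) (wiring_noBox.tensor wiring_noBox) wiring_noBox
      id (Sum.elim id id) (fun _ => rfl) ?_ (List.map_id _) ?_ ?_
    · rintro (i | i) <;> rfl
    · refine (List.map_id _).trans
        (Eq.trans ?_ (map_append_map (Sum.elim id id) Sum.inl Sum.inr _ _).symm)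
      exact (congrArg₂ _ (List.map_id _) (List.map_id _)).symm
    · refine (map_append_map (Sum.elim id id) Sum.inl Sum.inr [i] o).trans ?_
      exact congrArg₂ _ (List.map_id _) (List.map_id _)

theorem exists_map_eq_of_subset {A B : Type*} (g : A → B) {l : List A} {o : List B}
    (h : o ⊆ l.map g) : ∃ o' : List A, o'.map g = o := by
  induction o with
  | nil => exact ⟨[], rfl⟩
  | cons x o ih =>
    obtain ⟨o', ho⟩ := ih fun y hy => h (List.mem_cons_of_mem _ hy)
    obtain ⟨a, -, ha⟩ := List.mem_map.1 (h List.mem_cons_self)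
    exact ⟨a :: o', congrArg₂ _ ha ho⟩

/-- Without boxes, left monogamy makes every wire an input, so the outputs form a list of input
positions. In particular permutations are obtained from copies and discards. -/
theorem NoBox.generated {X Y : List S.W} {D : Diagram S X Y} (hD : NoBox D) : Generated D := by
  obtain ⟨g, hg, hg'⟩ := exists_index D.ins_label
  have hs : D.outs ⊆ (List.finRange X.length).map g := by
    intro w _
    rw [hg]
    exact (D.mono.cover w).resolve_right fun ⟨k, l, b, _⟩ => (hD k l).elim b
  obtain ⟨o, ho⟩ := exists_map_eq_of_subset g hs
  have h : o.map X.get = Y := by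
    rw [← D.outs_label, ← ho, List.map_map]
    exact List.map_congr_left fun i _ => (hg' i).symm
  refine Generated.iso ?_ (.recast rfl h (generated_select X o))
  exact iso_of_noBox (wiring_noBox.recast _ _) hD g hg' hg ho

/-! ### Splitting off a box. -/

/-- The hypergraph obtained by removing a box. -/
def Hyp.erase (G : Hyp.{u, v}) (b : G.Box) : Hyp.{u, v} where
  W := G.W
  B k l := {c : G.B k l // (⟨k, l, c⟩ : G.Box) ≠ b}
  inp c := G.inp c.1
  out c := G.out c.1

/-- The inclusion of the hypergraph obtained by removing a box. -/
def Hyp.eraseHom (G : Hyp.{u, v}) (b : G.Box) : (G.erase b).Hom G :=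
  ⟨id, Subtype.val, fun _ _ => rfl, fun _ _ => rfl⟩

theorem Hyp.eraseHom_onBox_injective (G : Hyp.{u, v}) (b : G.Box) :
    Function.Injective (G.eraseHom b).onBox :=
  (G.eraseHom b).onBox_injective fun _ _ => Subtype.val_injective

theorem Hyp.finite_box_erase {G : Hyp.{u, v}} (h : Finite G.Box) (b : G.Box) :
    Finite (G.erase b).Box :=
  Finite.of_injective _ (G.eraseHom_onBox_injective b)

theorem Hyp.card_box_erase {G : Hyp.{u, v}} (h : Finite G.Box) (b : G.Box) :
    Nat.card (G.erase b).Box < Nat.card G.Box := by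
  refine lt_of_le_of_lt ?_ (Finite.card_subtype_lt (p := fun c : G.Box => c ≠ b) (x := b)
    fun h => h rfl)
  refine Nat.card_le_card_of_injective (fun c => ⟨(G.eraseHom b).onBox c, c.2.2.2⟩) fun c c' h => ?_
  exact G.eraseHom_onBox_injective b (congrArg Subtype.val h)

theorem Hyp.Acyclic.erase {G : Hyp.{u, v}} (h : G.Acyclic) (b : G.Box) : (G.erase b).Acyclic := by
  intro w hw
  refine h w (Relation.TransGen.mono (fun x y hxy => ?_) w w hw)
  obtain ⟨k, l, c, i, j, hi, hj⟩ := step_iff.1 hxy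
  exact step_iff.2 ⟨k, l, c.1, i, j, hi, hj⟩

/-- The wires that lose their origin when `b` is removed are its outputs, and exactly these are
added to the inputs. -/
theorem Hyp.LeftMono.erase {G : Hyp.{u, v}} {p : List G.W} (h : G.LeftMono p) (b : G.Box) :
    (G.erase b).LeftMono (G.outList b ++ p) where
  cover w := by
    rcases h.cover w with hw | ⟨k, l, c, j, hw⟩
    · exact Or.inl (List.mem_append_right _ hw)
    · by_cases e : (⟨k, l, c⟩ : G.Box) = b
      · subst e
        exact Or.inl (List.mem_append_left _ ((List.mem_ofFn' _ _).2 ⟨j, hw⟩))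
      · exact Or.inr ⟨k, l, ⟨c, e⟩, j, hw⟩
  nodup := by
    have := h.nodup_flatMap (List.nodup_singleton b)
    rwa [List.flatMap_singleton] at this
  disj := by
    intro k l c j hj
    rcases List.mem_append.1 hj with hj | hj
    · obtain ⟨i, hi⟩ := (List.mem_ofFn' _ _).1 hj
      exact c.2 (Sigma.mk.inj_iff.1 (h.inj b.2.2 i c.1 j hi)).1.symm
    · exact h.disj c.1 j hj
  inj := by
    intro k l c j k' l' c' j' e
    have := h.inj c.1 j c'.1 j' e
    obtain ⟨h1, h3⟩ := Sigma.mk.inj_iff.1 this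
    obtain ⟨rfl, h2⟩ := Sigma.mk.inj_iff.1 h1
    obtain ⟨rfl, h2⟩ := Sigma.mk.inj_iff.1 (eq_of_heq h2)
    obtain rfl : c = c' := Subtype.ext (eq_of_heq h2)
    obtain rfl := eq_of_heq h3
    rfl

/-- The diagram obtained by removing a box, with its outputs as new inputs. -/
def Diagram.erase {X Y Z : List S.W} (D : Diagram S X Y) (b : D.apex.Box)
    (hZ : (D.apex.outList b).map D.label.wire = Z) : Diagram S (Z ++ X) Y where
  apex := D.apex.erase b
  finite := ⟨D.finite.wires, Hyp.finite_box_erase D.finite.boxes b⟩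
  label := (D.apex.eraseHom b).comp D.label
  ins := D.apex.outList b ++ D.ins
  outs := D.outs
  ins_label := List.map_append.trans (congrArg₂ _ hZ D.ins_label)
  outs_label := D.outs_label
  acyclic := D.acyclic.erase b
  monogamous := (Hyp.leftMonogamous_iff (Hyp.finite_box_erase D.finite.boxes b) _).2 (D.mono.erase b)

/-- The morphism that picks a box. -/
def boxHom {G : Hyp.{u, v}} {k l : ℕ} (b : G.B k l) : (boxHyp k l).Hom G where
  wire := Sum.elim (G.inp b) (G.out b)
  box := fun {k' l'} e => (e.down.1 ▸ e.down.2 ▸ b : G.B k' l')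
  inp_box := by
    rintro k' l' ⟨h⟩ i
    obtain ⟨rfl, rfl⟩ := h
    rfl
  out_box := by
    rintro k' l' ⟨h⟩ j
    obtain ⟨rfl, rfl⟩ := h
    rfl

theorem boxHom_comp {G : Hyp.{u₁, v₁}} (f : G.Hom S) {k l : ℕ} (b : G.B k l) :
    (boxHom b).comp f = boxHom (f.box b) := by
  apply Hyp.Hom.ext
  · funext w
    obtain w | w := w
    · exact (f.inp_box b w).symm
    · exact (f.out_box b w).symm
  · funext k' l' e
    obtain ⟨h⟩ := e
    obtain ⟨rfl, rfl⟩ := h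
    rfl

/-- Here `o` lists the positions in `X` of the inputs of `b`. The wiring makes a copy of these
inputs and keeps all of `X`; the box consumes the copy, and what remains of `D` runs on the outputs
of the box together with `X`. -/
theorem Diagram.erase_iso {X Y : List S.W} (D : Diagram S X Y) (b : D.apex.Box)
    {o : List (Fin X.length)} {g : Fin X.length → D.apex.W}
    (hg : (List.finRange X.length).map g = D.ins)
    (hg' : ∀ i, D.label.wire (g i) = X.get i) (ho : o.map g = D.apex.inList b)
    (hZ : (D.apex.outList b).map D.label.wire =
      (tensorFin fun j => single (S.out (D.label.box b.2.2) j)).word)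
    (hX : (o ++ List.finRange X.length).map X.get =
      (tensorFin fun i => single (S.inp (D.label.box b.2.2) i)).word ++ X) :
    Iso ((wiring X.get (List.finRange X.length) (o ++ List.finRange X.length) (finRange_spec _)
      (map_finRange_get X) hX).comp
        (((boxDiagram (D.label.box b.2.2)).tensor (idDiagram X)).comp (D.erase b hZ))) D := by
  obtain ⟨k, l, b⟩ := b
  let p : ((boxDiagram (D.label.box b)).tensor (idDiagram X)).apex.Hom D.apex :=
    sumDesc (boxHom b) (discHom g)
  have hp : p.comp D.label = ((boxDiagram (D.label.box b)).tensor (idDiagram X)).label :=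
    have h1 : (boxHom b).comp D.label = boxHom (D.label.box b) := boxHom_comp D.label b
    have h2 : (discHom g).comp D.label = (idDiagram X).label := discHom_label rfl hg'
    sum_hom_ext h1 h2
  have h2 : ((boxDiagram (D.label.box b)).tensor (idDiagram X)).outs.map p.wire =
      (D.erase ⟨k, l, b⟩ hZ).ins.map (D.apex.eraseHom ⟨k, l, b⟩).wire := by
    refine (map_append_map _ sinl sinr _ _).trans (Eq.trans ?_ (List.map_id _).symm)
    refine congrArg₂ _ (List.map_map.trans ?_) hg
    exact List.ofFn_eq_map.symm
  refine wiring_comp (pushDesc p (D.apex.eraseHom ⟨k, l, b⟩) h2) g hg' (push_hom_ext hp rfl) hg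
    ?_ ?_ ?_
  · refine List.map_append.trans (Eq.trans ?_ List.map_map.symm)
    refine Eq.trans ?_ (map_append_map p.wire sinl sinr _ _).symm
    refine congrArg₂ _ (ho.trans ?_) rfl
    exact List.ofFn_eq_map.trans (map_map' (p.wire ∘ sinl) (Sum.inl : Fin k → Fin k ⊕ Fin l) _).symm
  · exact List.map_map.trans (List.map_id _)
  -- Each box of `D` is either `b`, coming from the single-box diagram, or one of the boxes kept by
  -- the erasure, but not both; the identity on `X` has none.
  · intro k' l'
    constructor
    · rintro ((h | x) | x) ((h' | y) | y) e
      · cases h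
        cases h'
        rfl
      · exact y.elim
      · obtain ⟨⟨rfl, rfl⟩⟩ := (h : PLift (k = k' ∧ l = l'))
        exact absurd (congrArg (fun x => (⟨k, l, x⟩ : D.apex.Box)) e.symm) y.2
      · exact x.elim
      · exact x.elim
      · exact x.elim
      · obtain ⟨⟨rfl, rfl⟩⟩ := (h' : PLift (k = k' ∧ l = l'))
        exact absurd (congrArg (fun x => (⟨k, l, x⟩ : D.apex.Box)) e) x.2
      · exact y.elim
      · exact congrArg Sum.inr (Subtype.ext e)
    · intro c
      by_cases e : (⟨k', l', c⟩ : D.apex.Box) = ⟨k, l, b⟩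
      · obtain ⟨rfl, h⟩ := Sigma.mk.inj_iff.1 e
        obtain ⟨rfl, h⟩ := Sigma.mk.inj_iff.1 (eq_of_heq h)
        obtain rfl := eq_of_heq h
        exact ⟨Sum.inl (Sum.inl ⟨rfl, rfl⟩), rfl⟩
      · exact ⟨Sum.inr ⟨c, e⟩, rfl⟩

/-- Strong induction on the number of boxes: a box that needs only global inputs exists by
`Hyp.exists_enabled`, and erasing it lowers the number. -/
theorem generated_of_card : ∀ (n : ℕ) {X Y : List S.W} (D : Diagram S X Y),
    Nat.card D.apex.Box = n → Generated D := by
  intro n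
  induction n using Nat.strong_induction_on with
  | _ n ih =>
    intro X Y D hn
    by_cases hD : Nonempty D.apex.Box
    · obtain ⟨b, -, hb⟩ := Hyp.exists_enabled D.finite.wires D.acyclic (R := Set.univ) (L := D.ins)
        (Set.univ_nonempty) (fun w => by
          rcases D.mono.cover w with h | ⟨k, l, b, j, h⟩
          · exact Or.inl h
          · exact Or.inr ⟨⟨k, l, b⟩, trivial, (List.mem_ofFn' _ _).2 ⟨j, h⟩⟩)
      obtain ⟨g, hg, hg'⟩ := exists_index D.ins_label
      -- All inputs of the chosen box are global inputs, so they have positions in `X`, possibly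
      -- repeated.
      obtain ⟨o, ho⟩ := exists_map_eq_of_subset g (hg.symm ▸ hb)
      have hZ : (D.apex.outList b).map D.label.wire =
          (tensorFin fun j => single (S.out (D.label.box b.2.2) j)).word := by
        rw [word_tensorFin]
        exact (D.label.outList_onBox b).symm
      have hX : (o ++ List.finRange X.length).map X.get =
          (tensorFin fun i => single (S.inp (D.label.box b.2.2) i)).word ++ X := by
        rw [List.map_append, map_finRange_get, word_tensorFin]
        refine congrArg (· ++ X) (Eq.trans ?_ (D.label.inList_onBox b).symm)
        rw [← ho, List.map_map]
        exact List.map_congr_left fun i _ => (hg' i).symm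
      refine Generated.iso (D.erase_iso b hg hg' ho hZ hX) ?_
      refine .comp (NoBox.generated wiring_noBox) (.comp (.tensor (.box _) (.id X)) ?_)
      exact ih _ (hn ▸ Hyp.card_box_erase D.finite.boxes b) _ rfl
    · exact NoBox.generated fun k l => ⟨fun b => hD ⟨⟨k, l, b⟩⟩⟩

theorem generated {X Y : List S.W} (D : Diagram S X Y) : Generated D := generated_of_card _ D rfl

end Generation

/-! ## Uniqueness of strict gs-monoidal functors -/

section Uniqueness

open FreeGS

variable {C : Type u₁} [Category.{v₁} C] [MonoidalCategory C] [CopyDiscardCategory C] [IsStrict C]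
  {S : Hyp.{u, v}}

/-- A word is the tensor product of its letters, and strict functors preserve tensor products and
the unit. -/
theorem obj_eq_of_wire {F F' : StrictGSFunctor (FreeGS S) C}
    (h : ∀ w, F.obj (single w) = F'.obj (single w)) (X : FreeGS S) : F.obj X = F'.obj X := by
  obtain ⟨X⟩ := X
  induction X with
  | nil => exact F.obj_unit.trans F'.obj_unit.symm
  | cons w X ih =>
    exact (F.obj_tensor (single w) (ofWord X)).trans
      ((congrArg₂ (· ⊗ ·) (h w) ih).trans (F'.obj_tensor (single w) (ofWord X)).symm)

theorem box_hom_eq {k l : ℕ} {b b' : (hyp C).B k l} (h : b = b') :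
    b.2.2 = eqToHom (by rw [h]) ≫ b'.2.2 ≫ eqToHom (by rw [h]) := by
  subst h
  simp

/-- Both functors preserve the operations that generate diagrams, so agreement spreads from the
boxes. As the objects agree only up to a proved equality, the morphisms are compared through
transports. -/
theorem map_mk_eq_of_restrict_eq {F F' : StrictGSFunctor (FreeGS S) C}
    (h : restrict F = restrict F') (hobj : ∀ X, F.obj X = F'.obj X) {X Y : List S.W}
    {D : Diagram S X Y} (hD : Generated D) :
    F.map (mk (X := ofWord X) (Y := ofWord Y) D) = eqToHom (hobj _) ≫
      F'.map (mk (X := ofWord X) (Y := ofWord Y) D) ≫ eqToHom (hobj _).symm := by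
  induction hD with
  | @iso X Y D E h _ ih =>
    rw [mk_eq (X := ofWord X) (Y := ofWord Y) h] at ih
    exact ih
  | recast hX hY _ ih =>
    subst hX hY
    exact ih
  | @comp X Y Z D E _ _ ih ih' =>
    rw [← mk_comp (X := ofWord X) (Y := ofWord Y) (Z := ofWord Z), Functor.map_comp,
      Functor.map_comp, ih, ih']
    simp
  | @tensor X Y X' Y' D E _ _ ih ih' =>
    have e := F.map_tensor (mk (X := ofWord X) (Y := ofWord Y) D)
      (mk (X := ofWord X') (Y := ofWord Y') E)
    have e' := F'.map_tensor (mk (X := ofWord X) (Y := ofWord Y) D)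
      (mk (X := ofWord X') (Y := ofWord Y') E)
    rw [ih, ih'] at e
    refine e.trans (Eq.trans ?_ (congrArg (fun t => eqToHom _ ≫ t ≫ eqToHom _) e'.symm))
    have key : ∀ {A A' B B' P P' Q Q' T T' U U' : C} (m : A ⟶ B) (n : A' ⟶ B') (h1 : P = A)
        (h2 : B = Q) (h3 : P' = A') (h4 : B' = Q') (h5 : T = P ⊗ P') (h6 : Q ⊗ Q' = U)
        (h7 : T = T') (h8 : T' = A ⊗ A') (h9 : B ⊗ B' = U') (h10 : U' = U),
        eqToHom h5 ≫ ((eqToHom h1 ≫ m ≫ eqToHom h2) ⊗ₘ (eqToHom h3 ≫ n ≫ eqToHom h4)) ≫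
          eqToHom h6 = eqToHom h7 ≫ (eqToHom h8 ≫ (m ⊗ₘ n) ≫ eqToHom h9) ≫ eqToHom h10 := by
      intro A A' B B' P P' Q Q' T T' U U' m n h1 h2 h3 h4
      subst h1 h2 h3 h4
      intros
      simp
    exact key _ _ _ _ _ _ _ _ _ _ _ _
  | id X =>
    rw [← FreeGS.id_eq (ofWord X)]
    simp
  | copy X =>
    refine (F.map_copy (ofWord X)).trans
      (Eq.trans ?_ (congrArg (fun t => eqToHom _ ≫ t ≫ eqToHom _) (F'.map_copy (ofWord X)).symm))
    have key : ∀ {A A' Q Q' : C} (hA : A = A') (h1 : A ⊗ A = Q) (h2 : A' ⊗ A' = Q') (h3 : Q' = Q),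
        Δ[A] ≫ eqToHom h1 = eqToHom hA ≫ (Δ[A'] ≫ eqToHom h2) ≫ eqToHom h3 := by
      intro A A' Q Q' hA
      intros
      subst hA
      simp
    exact key _ _ _ _
  | del X =>
    refine (F.map_del (ofWord X)).trans
      (Eq.trans ?_ (congrArg (fun t => eqToHom _ ≫ t ≫ eqToHom _) (F'.map_del (ofWord X)).symm))
    have key : ∀ {A A' Q Q' : C} (hA : A = A') (h1 : 𝟙_ C = Q) (h2 : 𝟙_ C = Q') (h3 : Q' = Q),
        ε[A] ≫ eqToHom h1 = eqToHom hA ≫ (ε[A'] ≫ eqToHom h2) ≫ eqToHom h3 := by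
      intro A A' Q Q' hA
      intros
      subst hA
      simp
    exact key _ _ _ _
  | box b =>
    -- Equality of the restrictions at `b` already contains the claim, up to the transports in
    -- `hypMap`.
    have e := box_hom_eq (Hyp.Hom.box_congr h b)
    have key : ∀ {P Q P' Q' A B A' B' : C} (m : P ⟶ Q) (m' : P' ⟶ Q') (h1 : A = P) (h2 : Q = B)
        (h3 : A' = P') (h4 : Q' = B') (h5 : A = A') (h6 : B' = B) (h7 : P = P') (h8 : Q' = Q),
        eqToHom h1 ≫ m ≫ eqToHom h2 =
          eqToHom h5 ≫ (eqToHom h3 ≫ m' ≫ eqToHom h4) ≫ eqToHom h6 →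
            m = eqToHom h7 ≫ m' ≫ eqToHom h8 := by
      intro P Q P' Q' A B A' B' m m' h1 h2 h3 h4 h5 h6 h7 h8 e
      subst h1 h2 h3 h4 h7 h8
      simpa using e
    exact key _ _ _ _ _ _ _ _ _ _ e

theorem restrict_injective :
    Function.Injective (restrict : StrictGSFunctor (FreeGS S) C → S.Hom (hyp C)) := by
  intro F F' h
  have hobj : ∀ X, F.obj X = F'.obj X :=
    obj_eq_of_wire fun w => congrFun (congrArg Hyp.Hom.wire h) w
  have key : F.toFunctor = F'.toFunctor := by
    refine CategoryTheory.Functor.ext hobj fun X Y g => ?_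
    obtain ⟨D, rfl⟩ := mk_surj g
    exact map_mk_eq_of_restrict_eq h hobj (generated D)
  -- Apart from the underlying functor, a strict gs-monoidal functor consists of propositions.
  obtain ⟨F⟩ := F
  obtain ⟨F'⟩ := F'
  obtain rfl : F = F' := key
  rfl

theorem restrict_bijective :
    Function.Bijective (restrict : StrictGSFunctor (FreeGS S) C → S.Hom (hyp C)) :=
  ⟨restrict_injective, fun f => ⟨evalGSFunctor f, restrict_evalGSFunctor f⟩⟩

end Uniqueness

end GSMon

theorem mainTheorem2 {S : GSMon.Hyp.{u, v}} {C : Type u₁} [CategoryTheory.Category.{v₁} C]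
    [CategoryTheory.MonoidalCategory C] [CategoryTheory.CopyDiscardCategory C] [GSMon.IsStrict C]
    (e : FreeMonoid S.W ≃ C) (he_one : e 1 = CategoryTheory.MonoidalCategoryStruct.tensorUnit C)
    (he_mul : ∀ x y : FreeMonoid S.W,
      e (x * y) = CategoryTheory.MonoidalCategoryStruct.tensorObj (e x) (e y)) :
    Function.Bijective
        (GSMon.restrict : GSMon.StrictGSFunctor (GSMon.FreeGS S) C → S.Hom (GSMon.hyp C)) ∧
      Set.BijOn (GSMon.restrict : GSMon.StrictGSFunctor (GSMon.FreeGS S) C → S.Hom (GSMon.hyp C))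
        {F | ∀ X : GSMon.FreeGS S, F.obj X = e (FreeMonoid.ofList X.word)}
        {f | ∀ w : S.W, f.wire w = e (FreeMonoid.of w)} := by
  refine ⟨GSMon.restrict_bijective, fun F hF w => hF (GSMon.FreeGS.single w),
    GSMon.restrict_injective.injOn, fun f hf => ?_⟩
  obtain ⟨F, rfl⟩ := GSMon.restrict_bijective.2 f
  refine ⟨F, ?_, rfl⟩
  replace hf : ∀ w, F.obj (GSMon.FreeGS.single w) = e (FreeMonoid.of w) := hf
  rintro ⟨X⟩
  -- Each word is built from letters by multiplication, which both `F` and `e` respect.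
  induction X with
  | nil => exact F.obj_unit.trans he_one.symm
  | cons w X ih =>
    exact (F.obj_tensor (GSMon.FreeGS.single w) (GSMon.FreeGS.ofWord X)).trans
      ((congrArg₂ CategoryTheory.MonoidalCategoryStruct.tensorObj (hf w) ih).trans
        (he_mul (FreeMonoid.of w) (FreeMonoid.ofList X)).symm)
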